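/- Let $0\le\tau<1$. For $N\ge 1$ let $X_N$ be a random real $N\times N$ matrix from the real elliptic Gaussian ensemble, i.e. with density $$C_N^{-1}\exp\Big[-\frac{1}{2(1-\tau^2)}\mathrm{Tr}\,(XX^T-\tau X^2)\Big],\qquad C_N=(2\pi)^{N^2/2}(1+\tau)^{N/2}(1-\tau^2)^{N(N-1)/4},$$ with respect to the Lebesgue measure $\prod_{i,j}dX_{ij}$. For a real eigenvalue $\lambda_i$ of $X_N$ (almost surely all eigenvalues are simple) let $\mathbf r_i,\mathbf l_i$ be real vectors with $X_N\mathbf r_i=\lambda_i\mathbf r_i$, $X_N^T\mathbf l_i=\lambda_i\mathbf l_i$, $\mathbf l_i^T\mathbf r_i=1$, and let $O_{ii}=(\mathbf l_i^T\mathbf l_i)(\mathbf r_i^T\mathbf r_i)$ be the squared eigenvalue condition number. Let $$\mathcal P_N(z,t)=\Big\langle\sum_i\delta(O_{ii}-1-t)\,\delta(z-\lambda_i)\Big\rangle ,$$ where the sum is over the real eigenvalues; that is, $\mathcal P_N$ is the function on $\mathbb R\times(0,\infty)$ such that $\mathbb E\sum_i f(\lambda_i,O_{ii}-1)=\int_{\mathbb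 R}\int_0^\infty f(z,t)\,\mathcal P_N(z,t)\,dt\,dz$ for every measurable $f:\mathbb R^2\to[0,\infty]$. Then for every $N\ge2$ a nonnegative continuous such density $\mathcal P_N$ on $\mathbb R\times(0,\infty)$ exists (it is then unique), and for every real $z$ with $|z|<1+\tau$ and every $t>0$ $$\lim_{N\to\infty}N\,\mathcal P_N(\sqrt N z,Nt)=\frac{\sqrt{1-\tau^2}}{2\sqrt{2\pi}}\,\frac{1-\frac{z^2}{(1+\tau)^2}}{t^2}\,\exp\Big(-\frac{1-\tau^2}{2t}\Big[1-\frac{z^2}{(1+\tau)^2}\Big]\Big).$$ The limit has the same inverse-gamma form as the bulk law of the real eigenvalues of the real Ginibre ensemble ($\tau=0$): it equals $\frac{\rho}{t}\,e^{-\tilde O/(t\rho)}\,\frac{\tilde O}{t\rho}$ with $\rho=\frac{1}{\sqrt{2\pi(1-\tau^2)}}$ and $\tilde O=\frac{\sqrt{1-\tau^2}}{2\sqrt{2\pi}}\big(1-\frac{z^2}{(1+\tau)^2}\big)$. -/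

import Mathlib

open MeasureTheory Filter Topology
open scoped ENNReal Matrix

noncomputable section

namespace EllipticGinibre

/-- The normalization constant
`C_N = (2π)^{N²/2} (1+τ)^{N/2} (1-τ²)^{N(N-1)/4}`. -/
def normConst (τ : ℝ) (N : ℕ) : ℝ :=
  (2 * Real.pi) ^ ((N : ℝ) ^ 2 / 2) * (1 + τ) ^ ((N : ℝ) / 2)
    * (1 - τ ^ 2) ^ ((N : ℝ) * ((N : ℝ) - 1) / 4)

/-- The density of the real elliptic Gaussian ensemble,
`C_N⁻¹ exp (-Tr (X Xᵀ - τ X²) / (2 (1-τ²)))`. -/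
def matrixDensity (τ : ℝ) {N : ℕ} (X : Matrix (Fin N) (Fin N) ℝ) : ℝ :=
  (normConst τ N)⁻¹ *
    Real.exp (-(1 / (2 * (1 - τ ^ 2))) * (X * Xᵀ - τ • X ^ 2).trace)

/-- The law of the real elliptic Gaussian ensemble of `N × N` matrices, as a measure on the array of
matrix entries; `volume` is the product Lebesgue measure `∏ dX_{ij}`. -/
def ensemble (τ : ℝ) (N : ℕ) : Measure (Fin N → Fin N → ℝ) :=
  volume.withDensity fun X => ENNReal.ofReal (matrixDensity τ (Matrix.of X))

/-- `l` and `r` are a left and a right eigenvector of `X` for the real eigenvalue `x`,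
with the bi-orthogonal normalization `lᵀ r = 1`. -/
structure IsEigenPair {N : ℕ} (X : Matrix (Fin N) (Fin N) ℝ) (x : ℝ) (l r : Fin N → ℝ) : Prop where
  right : X *ᵥ r = x • r
  left : Xᵀ *ᵥ l = x • l
  normalized : l ⬝ᵥ r = 1

/-- The diagonal overlap (squared eigenvalue condition number) `(lᵀ l) (rᵀ r)` of the real
eigenvalue `x` of `X`. For a simple eigenvalue, hence for all eigenvalues of almost every matrix,
the product is the same for all normalized pairs `l, r`, so that the infimum is over one number. -/
def overlap {N : ℕ} (X : Matrix (Fin N) (Fin N) ℝ) (x : ℝ) : ℝ :=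
  sInf {κ : ℝ | ∃ l r : Fin N → ℝ, IsEigenPair X x l r ∧ κ = (l ⬝ᵥ l) * (r ⬝ᵥ r)}

/-- The sum `∑ᵢ f (λᵢ, Oᵢᵢ - 1)` over the real eigenvalues `λᵢ` of `X`. -/
def eigenSum {N : ℕ} (X : Matrix (Fin N) (Fin N) ℝ) (f : ℝ × ℝ → ℝ≥0∞) : ℝ≥0∞ :=
  (X.charpoly.roots.map fun x => f (x, overlap X x - 1)).sum

/-- `p` is the joint density function `p(z,t) = ⟨∑ᵢ δ(Oᵢᵢ - 1 - t) δ(z - λᵢ)⟩`, the sum being over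
the real eigenvalues: paired with any nonnegative test function, `p` gives the expectation of the
sum of the test function over the points `(λᵢ, Oᵢᵢ - 1)`. The density is the continuous one on
`t > 0`, which makes its values there unique; its values for `t ≤ 0` are irrelevant. -/
structure IsJointDensity (τ : ℝ) (N : ℕ) (p : ℝ → ℝ → ℝ) : Prop where
  nonneg : ∀ z t : ℝ, 0 < t → 0 ≤ p z t
  continuousOn : ContinuousOn (fun y : ℝ × ℝ => p y.1 y.2) (Set.univ ×ˢ Set.Ioi 0)
  expectation : ∀ f : ℝ × ℝ → ℝ≥0∞, Measurable f →
    ∫⁻ X, eigenSum (Matrix.of X) f ∂(ensemble τ N)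
      = ∫⁻ y in Set.univ ×ˢ Set.Ioi (0 : ℝ), f y * ENNReal.ofReal (p y.1 y.2)

/-- The limiting bulk density. -/
def bulkDensity (τ z t : ℝ) : ℝ :=
  Real.sqrt (1 - τ ^ 2) / (2 * Real.sqrt (2 * Real.pi)) * ((1 - z ^ 2 / (1 + τ) ^ 2) / t ^ 2)
    * Real.exp (-((1 - τ ^ 2) / (2 * t)) * (1 - z ^ 2 / (1 + τ) ^ 2))

/-- The inverse gamma law `(ρ / t) e^{-O / (t ρ)} (O / (t ρ))^β` with `β = 1`, the form of the bulk
law for the real eigenvalues of the real Ginibre ensemble. -/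
def inverseGammaLaw (ρ O t : ℝ) : ℝ :=
  ρ / t * Real.exp (-(O / (t * ρ))) * (O / (t * ρ)) ^ 1

end EllipticGinibre

end

/-! The expected sum over the real eigenvalues is computed by a Kac–Rice type formula. A matrix of
size `n + 1` with eigenvalue `x` and right eigenvector `(1, q)` is determined by `x`, `q`, the rest
`u` of its first row and its lower right block `B` (`eigenMatrix`). The map `eigenParam` from these
parameters to the matrix has Jacobian `det (x - deflated q u B)`, and almost every matrix is hit
exactly once for each of its real eigenvalues: the critical values form a null set, so the
eigenvalues are simple, and a Krylov determinant excludes eigenvectors whose first coordinate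
vanishes. The area formula then gives `lintegral_eigenSum`.

Orthogonal invariance rotates `(1, q)` into the first axis (`lintegral_eigenIntegrand_rotate`),
which leaves the block triangular matrices `[[x, uᵀ], [0, B]]`. Their left eigenvector is `(1, w)`
with `(x - B)ᵀ w = u`, and the overlap minus one is `|w|²`. Taking `w` as variable instead of `u`
squares the Jacobian. Hence the density at `(x, t)` is, up to explicit factors, the mean of `det (x
- B)² exp (-|(x - B)ᵀ w|² / (2 (1 - τ²)))` with `|w|² = t`, where `B` is drawn from the ensemble of
size `N - 1`.

By invariance `w` may be put on the first axis, and then only the first row of `x - B` is tilted.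
The ensemble is recursive: the border of a matrix is Gaussian and independent of the inner block
(`lintegral_ensemble_succ`). The tilt changes only means and variances of the border, so Wick's
formula expresses the density through averages of products of determinants, adjugates and traces of
the inner block, of size `m = N - 2` (`lintegral_tilted`). Bordering once more gives recursions for
these averages, solved by `τ`-weighted sums of `C_k(x) C_k(y) / k!` with scaled Hermite polynomials
`C_k` (`avgDetDet_eq_and`).

For the limit, let the eigenvalue be `x = √N z` and replace `t` by `N t`. Mehler's formula gives the
total mass of the weights `C_k(x)² / k!` and their Laplace transform at scale `N`, which shows that
they concentrate at `k ≈ N z² / (1 + τ)²`. Only the mean of `Tr (adj adjᵀ)` survives in the tilt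
average; it behaves like `m! m (1 - z² / (1 + τ)²) / (1 - τ)` times the mass
(`tendsto_sum_kernelSum`). The exponential of the limit comes from `(1 + (1 - τ²) / (N t))^(-m/2)`
and from the Gaussian weight in `x`. -/

noncomputable section

namespace EllipticGinibre

open ProbabilityTheory

/-! ### Bordered matrices -/

section Bordered

variable {R : Type*} {n : ℕ}

/-- The matrix `[[a, uᵀ], [v, B]]`. -/
def bordered (a : R) (u v : Fin n → R) (B : Matrix (Fin n) (Fin n) R) :
    Matrix (Fin (n + 1)) (Fin (n + 1)) R :=
  Matrix.of (Fin.cons (Fin.cons a u) fun i => Fin.cons (v i) (B i))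

@[simp] lemma bordered_zero_zero (a : R) (u v : Fin n → R) (B : Matrix (Fin n) (Fin n) R) :
    bordered a u v B 0 0 = a := rfl

@[simp] lemma bordered_zero_succ (a : R) (u v : Fin n → R) (B : Matrix (Fin n) (Fin n) R) (j : Fin n) :
    bordered a u v B 0 j.succ = u j := rfl

@[simp] lemma bordered_succ_zero (a : R) (u v : Fin n → R) (B : Matrix (Fin n) (Fin n) R) (i : Fin n) :
    bordered a u v B i.succ 0 = v i := rfl

@[simp] lemma bordered_succ_succ (a : R) (u v : Fin n → R) (B : Matrix (Fin n) (Fin n) R) (i j : Fin n) :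
    bordered a u v B i.succ j.succ = B i j := rfl

lemma eq_bordered (X : Matrix (Fin (n + 1)) (Fin (n + 1)) R) :
    X = bordered (X 0 0) (fun j => X 0 j.succ) (fun i => X i.succ 0)
      (X.submatrix Fin.succ Fin.succ) := by
  ext i j
  refine Fin.cases ?_ (fun i => ?_) i <;> refine Fin.cases ?_ (fun j => ?_) j <;> rfl

lemma bordered_transpose (a : R) (u v : Fin n → R) (B : Matrix (Fin n) (Fin n) R) :
    (bordered a u v B)ᵀ = bordered a v u Bᵀ := by
  ext i j
  refine Fin.cases ?_ (fun i => ?_) i <;> refine Fin.cases ?_ (fun j => ?_) j <;> rfl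

variable [CommRing R]

lemma adjugate_bordered_zero_zero (a : R) (u v : Fin n → R) (B : Matrix (Fin n) (Fin n) R) :
    (bordered a u v B).adjugate 0 0 = B.det := by
  rw [Matrix.adjugate_fin_succ_eq_det_submatrix]
  simp only [Fin.val_zero, add_zero, pow_zero, one_mul]
  congr 1

/-- Deleting row `j + 1` and column `0` leaves `u` on top of `B` without row `j`; expansion along
`u` produces the cofactors of `B`. -/
lemma adjugate_bordered_zero_succ (a : R) (u v : Fin n → R) (B : Matrix (Fin n) (Fin n) R) (j : Fin n) :
    (bordered a u v B).adjugate 0 j.succ = -(u ᵥ* B.adjugate) j := by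
  obtain _ | n := n
  · exact j.elim0
  rw [Matrix.adjugate_fin_succ_eq_det_submatrix, Matrix.det_succ_row_zero]
  simp only [Matrix.vecMul, dotProduct, Matrix.adjugate_fin_succ_eq_det_submatrix,
    Finset.mul_sum, ← Finset.sum_neg_distrib]
  refine Finset.sum_congr rfl fun k _ => ?_
  have h : ((bordered a u v B).submatrix j.succ.succAbove (Fin.succAbove 0)).submatrix
      Fin.succ k.succAbove = B.submatrix j.succAbove k.succAbove := by
    ext i l
    simp
  rw [h]
  simp only [Fin.val_succ, Fin.val_zero, Matrix.submatrix_apply, Fin.succAbove_zero,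
    Fin.succAbove_ne_zero_zero (Fin.succ_ne_zero j), bordered_zero_succ]
  ring

/-- The `(0, 0)` entry of `adj M * M = det M • 1`, with the first row of the adjugate known. This
form of Schur's formula inverts nothing, so it serves singular blocks and polynomial entries as
well. -/
lemma det_bordered (a : R) (u v : Fin n → R) (B : Matrix (Fin n) (Fin n) R) :
    (bordered a u v B).det
      = a * B.det - u ⬝ᵥ (B.adjugate *ᵥ v) := by
  have h := congrFun (congrFun (Matrix.adjugate_mul (bordered a u v B)) 0) 0
  rw [Matrix.mul_apply, Fin.sum_univ_succ, adjugate_bordered_zero_zero] at h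
  simp only [adjugate_bordered_zero_succ, Matrix.smul_apply, Matrix.one_apply_eq, smul_eq_mul,
    mul_one, bordered_zero_zero, bordered_succ_zero] at h
  rw [← h, Matrix.dotProduct_mulVec]
  simp only [dotProduct, neg_mul, Finset.sum_neg_distrib]
  ring

lemma bordered_mulVec_cons (a : R) (u v : Fin n → R) (B : Matrix (Fin n) (Fin n) R) (s : R)
    (q : Fin n → R) :
    (bordered a u v B) *ᵥ (Fin.cons s q : Fin (n + 1) → R)
      = Fin.cons (a * s + u ⬝ᵥ q) (s • v + B *ᵥ q) := by
  funext i
  refine Fin.cases ?_ (fun i => ?_) i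
  · simp [Matrix.mulVec, dotProduct, Fin.sum_univ_succ]
  · simp [Matrix.mulVec, dotProduct, Fin.sum_univ_succ, mul_comm]

lemma bordered_mul_bordered (a a' : R) (u v u' v' : Fin n → R) (B B' : Matrix (Fin n) (Fin n) R) :
    (bordered a u v B) * (bordered a' u' v' B')
      = (bordered (a * a' + u ⬝ᵥ v') (a • u' + u ᵥ* B')
          (a' • v + B *ᵥ v')
          (Matrix.vecMulVec v u' + B * B')) := by
  ext i j
  refine Fin.cases ?_ (fun i => ?_) i <;> refine Fin.cases ?_ (fun j => ?_) j <;>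
    simp [Matrix.mul_apply, Fin.sum_univ_succ, dotProduct, Matrix.vecMul, Matrix.mulVec,
      Matrix.vecMulVec_apply, mul_comm]

lemma scalar_sub_bordered (x a : R) (u v : Fin n → R) (B : Matrix (Fin n) (Fin n) R) :
    Matrix.scalar (Fin (n + 1)) x - (bordered a u v B)
      = (bordered (x - a) (-u) (-v) (Matrix.scalar (Fin n) x - B)) := by
  ext i j
  refine Fin.cases ?_ (fun i => ?_) i <;> refine Fin.cases ?_ (fun j => ?_) j
  · simp
  · simp [(Fin.succ_ne_zero _).symm]
  · simp
  · by_cases h : i = j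
    · subst h; simp
    · simp [h]

lemma one_eq_bordered : (1 : Matrix (Fin (n + 1)) (Fin (n + 1)) R)
    = (bordered 1 0 0 (1 : Matrix (Fin n) (Fin n) R)) := by
  ext i j
  refine Fin.cases ?_ (fun i => ?_) i <;> refine Fin.cases ?_ (fun j => ?_) j
  · simp
  · simp [(Fin.succ_ne_zero _).symm]
  · simp
  · simp [Matrix.one_apply]

lemma charpoly_bordered_zero (a : R) (u : Fin n → R) (B : Matrix (Fin n) (Fin n) R) :
    (bordered a u 0 B).charpoly
      = (Polynomial.X - Polynomial.C a) * B.charpoly := by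
  have h : Matrix.charmatrix (bordered a u 0 B)
      = (bordered (Polynomial.X - Polynomial.C a) (fun j => -Polynomial.C (u j)) 0
          (Matrix.charmatrix B)) := by
    ext1 i j
    refine Fin.cases ?_ (fun i => ?_) i <;> refine Fin.cases ?_ (fun j => ?_) j
    · simp
    · simp [(Fin.succ_ne_zero _).symm]
    · simp
    · by_cases h : i = j
      · subst h; simp
      · simp [h]
  rw [Matrix.charpoly, h, det_bordered]
  simp [Matrix.charpoly]

/-- The adjugate form of the resolvent identity. -/
lemma sub_smul_adjugate_mul_adjugate (M : Matrix (Fin n) (Fin n) R) (x y : R) :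
    (y - x) • ((Matrix.scalar (Fin n) x - M).adjugate * (Matrix.scalar (Fin n) y - M).adjugate)
      = (Matrix.scalar (Fin n) y - M).det • (Matrix.scalar (Fin n) x - M).adjugate
        - (Matrix.scalar (Fin n) x - M).det • (Matrix.scalar (Fin n) y - M).adjugate := by
  have hy : (Matrix.scalar (Fin n) x - M).adjugate * ((Matrix.scalar (Fin n) y - M)
      * (Matrix.scalar (Fin n) y - M).adjugate)
      = (Matrix.scalar (Fin n) y - M).det • (Matrix.scalar (Fin n) x - M).adjugate := by
    rw [Matrix.mul_adjugate]; simp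
  have hx : ((Matrix.scalar (Fin n) x - M).adjugate * (Matrix.scalar (Fin n) x - M))
      * (Matrix.scalar (Fin n) y - M).adjugate
      = (Matrix.scalar (Fin n) x - M).det • (Matrix.scalar (Fin n) y - M).adjugate := by
    rw [Matrix.adjugate_mul]; simp
  have hs : Matrix.scalar (Fin n) y - M - (Matrix.scalar (Fin n) x - M)
      = (y - x) • (1 : Matrix (Fin n) (Fin n) R) := by
    rw [Matrix.smul_one_eq_diagonal]
    ext i j
    simp [Matrix.diagonal_apply]
    split_ifs <;> simp
  rw [← hy, ← hx, Matrix.mul_assoc, ← Matrix.mul_sub, ← Matrix.sub_mul, hs]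
  simp

end Bordered

/-- The determinant is multilinear in the rows, and row `i` of `y - M` moves with velocity `e_i`;
replacing row `i` by `e_i` gives the diagonal entry `i` of the adjugate. -/
lemma hasDerivAt_det_scalar_sub {n : ℕ} (M : Matrix (Fin n) (Fin n) ℝ) (y : ℝ) :
    HasDerivAt (fun y => (Matrix.scalar (Fin n) y - M).det)
      ((Matrix.scalar (Fin n) y - M).adjugate.trace) y := by
  let f : ContinuousMultilinearMap ℝ (fun _ : Fin n => Fin n → ℝ) ℝ :=
    { (Matrix.detRowAlternating (n := Fin n) (R := ℝ)).toMultilinearMap with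
      cont := Continuous.matrix_det (A := fun X : Fin n → Fin n → ℝ => Matrix.of X)
        (continuous_matrix fun i j => (continuous_apply j).comp (continuous_apply i)) }
  have hf (X : Fin n → Fin n → ℝ) : f X = (Matrix.of X).det := rfl
  have hrow (i : Fin n) : HasFDerivAt (fun y : ℝ => fun j => (Matrix.scalar (Fin n) y - M) i j)
      (ContinuousLinearMap.toSpanSingleton ℝ (Pi.single i 1 : Fin n → ℝ)) y := by
    refine HasDerivAt.hasFDerivAt (hasDerivAt_pi.2 fun j => ?_)
    by_cases h : i = j
    · subst h
      simpa using (hasDerivAt_id y).sub_const (M i i)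
    · simpa [h, Pi.single_apply, Ne.symm h, eq_comm] using hasDerivAt_const y (-M i j)
  have h := (HasFDerivAt.multilinear_comp f hrow).hasDerivAt
  refine HasDerivAt.congr_deriv h ?_
  simp only [Matrix.trace, Matrix.diag, Matrix.adjugate_apply, sum_apply,
    ContinuousLinearMap.comp_apply, ContinuousLinearMap.toSpanSingleton_apply, one_smul,
    ContinuousMultilinearMap.toContinuousLinearMap_apply]
  rfl

/-! ### Eigenvalues, eigenvectors and overlaps -/

section Eigen

variable {n : ℕ}

lemma isRoot_charpoly_iff (X : Matrix (Fin n) (Fin n) ℝ) (x : ℝ) :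
    X.charpoly.IsRoot x ↔ ∃ r : Fin n → ℝ, r ≠ 0 ∧ X *ᵥ r = x • r := by
  rw [Polynomial.IsRoot, Matrix.eval_charpoly, ← Matrix.exists_mulVec_eq_zero_iff]
  refine exists_congr fun r => and_congr_right fun _ => ?_
  rw [Matrix.sub_mulVec, sub_eq_zero, Matrix.scalar_apply, ← Matrix.smul_one_eq_diagonal,
    Matrix.smul_mulVec, Matrix.one_mulVec, eq_comm]

lemma overlap_orthogonal_conj (Q Y : Matrix (Fin n) (Fin n) ℝ) (hQ : Qᵀ * Q = 1) (x : ℝ) :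
    overlap (Q * Y * Qᵀ) x = overlap Y x := by
  have hQ' : Q * Qᵀ = 1 := mul_eq_one_comm.1 hQ
  have hdot (a b : Fin n → ℝ) : (Q *ᵥ a) ⬝ᵥ (Q *ᵥ b) = a ⬝ᵥ b := by
    rw [Matrix.dotProduct_mulVec, Matrix.vecMul_mulVec, hQ, Matrix.vecMul_one]
  have hdot' (a b : Fin n → ℝ) : (Qᵀ *ᵥ a) ⬝ᵥ (Qᵀ *ᵥ b) = a ⬝ᵥ b := by
    rw [Matrix.dotProduct_mulVec, Matrix.vecMul_mulVec, Matrix.transpose_transpose, hQ',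
      Matrix.vecMul_one]
  have hcancel (A : Matrix (Fin n) (Fin n) ℝ) : Qᵀ * (Q * A * Qᵀ) = A * Qᵀ := by
    rw [← Matrix.mul_assoc, ← Matrix.mul_assoc, hQ, Matrix.one_mul]
  have hcancel' (A : Matrix (Fin n) (Fin n) ℝ) : Q * A * Qᵀ * Q = Q * A := by
    rw [Matrix.mul_assoc, hQ, Matrix.mul_one]
  have htr : (Q * Y * Qᵀ)ᵀ = Q * Yᵀ * Qᵀ := by
    simp [Matrix.transpose_mul, Matrix.mul_assoc]
  unfold overlap
  congr 1
  ext κ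
  constructor
  · rintro ⟨l, r, h, rfl⟩
    refine ⟨Qᵀ *ᵥ l, Qᵀ *ᵥ r, ⟨?_, ?_, ?_⟩, ?_⟩
    · rw [Matrix.mulVec_mulVec, ← hcancel, ← Matrix.mulVec_mulVec, h.right, Matrix.mulVec_smul]
    · rw [Matrix.mulVec_mulVec, ← hcancel, ← htr, ← Matrix.mulVec_mulVec, h.left,
        Matrix.mulVec_smul]
    · rw [hdot', h.normalized]
    · rw [hdot', hdot']
  · rintro ⟨l, r, h, rfl⟩
    refine ⟨Q *ᵥ l, Q *ᵥ r, ⟨?_, ?_, ?_⟩, ?_⟩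
    · rw [Matrix.mulVec_mulVec, hcancel', ← Matrix.mulVec_mulVec, h.right, Matrix.mulVec_smul]
    · rw [htr, Matrix.mulVec_mulVec, hcancel', ← Matrix.mulVec_mulVec, h.left, Matrix.mulVec_smul]
    · rw [hdot, h.normalized]
    · rw [hdot, hdot]

/-- When both eigenspaces are lines, the normalization leaves only the rescaling of `l` and `r` by
reciprocal factors, under which the product of squared lengths is invariant; the infimum is over one
point. -/
lemma overlap_eq_of_simple {X : Matrix (Fin n) (Fin n) ℝ} {x : ℝ} {l r : Fin n → ℝ}
    (h : IsEigenPair X x l r) (hr : ∀ r', X *ᵥ r' = x • r' → ∃ c : ℝ, r' = c • r)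
    (hl : ∀ l', Xᵀ *ᵥ l' = x • l' → ∃ c : ℝ, l' = c • l) :
    overlap X x = (l ⬝ᵥ l) * (r ⬝ᵥ r) := by
  have hset : {κ : ℝ | ∃ l r : Fin n → ℝ, IsEigenPair X x l r ∧ κ = (l ⬝ᵥ l) * (r ⬝ᵥ r)}
      = {(l ⬝ᵥ l) * (r ⬝ᵥ r)} := by
    refine Set.eq_singleton_iff_unique_mem.2 ⟨⟨l, r, h, rfl⟩, ?_⟩
    rintro _ ⟨l', r', h', rfl⟩
    obtain ⟨c, rfl⟩ := hl l' h'.left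
    obtain ⟨d, rfl⟩ := hr r' h'.right
    have hcd : c * d = 1 := by
      simpa [h.normalized, mul_comm] using h'.normalized
    simp only [smul_dotProduct, dotProduct_smul, smul_eq_mul]
    linear_combination (l ⬝ᵥ l) * (r ⬝ᵥ r) * (c * d + 1) * hcd
  rw [overlap, hset, csInf_singleton]

/-- The matrix with first row `(x - u ⬝ q, u)`, lower right block `B`, eigenvalue `x` and right
eigenvector `(1, q)`. -/
def eigenMatrix (x : ℝ) (q u : Fin n → ℝ) (B : Matrix (Fin n) (Fin n) ℝ) :
    Matrix (Fin (n + 1)) (Fin (n + 1)) ℝ :=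
  bordered (x - u ⬝ᵥ q) u (x • q - B *ᵥ q) B

/-- The matrix induced by `eigenMatrix` on the quotient by the eigenvector. -/
def deflated (q u : Fin n → ℝ) (B : Matrix (Fin n) (Fin n) ℝ) : Matrix (Fin n) (Fin n) ℝ :=
  B - Matrix.vecMulVec q u

lemma eigenMatrix_mulVec (x : ℝ) (q u : Fin n → ℝ) (B : Matrix (Fin n) (Fin n) ℝ) :
    eigenMatrix x q u B *ᵥ (Fin.cons 1 q : Fin (n + 1) → ℝ)
      = x • (Fin.cons 1 q : Fin (n + 1) → ℝ) := by
  rw [eigenMatrix, bordered_mulVec_cons]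
  funext i
  refine Fin.cases ?_ (fun i => ?_) i <;> simp

/-- The eigenvalue equation determines the corner and the first column from the other entries. The
free data `u` and `B`, with `x` and `q`, have the dimension of the matrix space. -/
lemma eq_eigenMatrix_of_mulVec (X : Matrix (Fin (n + 1)) (Fin (n + 1)) ℝ) (x : ℝ)
    (q : Fin n → ℝ) (h : X *ᵥ (Fin.cons 1 q : Fin (n + 1) → ℝ)
      = x • (Fin.cons 1 q : Fin (n + 1) → ℝ)) :
    X = eigenMatrix x q (fun j => X 0 j.succ) (X.submatrix Fin.succ Fin.succ) := by
  conv_lhs => rw [eq_bordered X]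
  rw [eq_bordered X, bordered_mulVec_cons] at h
  have h0 := congrFun h 0
  have hs (i : Fin n) := congrFun h i.succ
  simp only [Fin.cons_zero, Fin.cons_succ, Pi.smul_apply, smul_eq_mul, mul_one, Pi.add_apply,
    one_mul] at h0 hs
  rw [eigenMatrix]
  congr 1
  · rw [← h0]; simp
  · funext i
    have := hs i
    simp only [Pi.sub_apply, Pi.smul_apply, smul_eq_mul, ← this]
    simp only [add_sub_cancel_right]

/-- The shear which carries the first basis vector to `(1, q)`. -/
def shear (q : Fin n → ℝ) : Matrix (Fin (n + 1)) (Fin (n + 1)) ℝ := bordered 1 0 q 1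

lemma shear_mul_shear_neg (q : Fin n → ℝ) : shear q * shear (-q) = 1 := by
  rw [shear, shear, bordered_mul_bordered, one_eq_bordered]
  congr 1 <;> simp

lemma shear_neg_mul_shear (q : Fin n → ℝ) : shear (-q) * shear q = 1 :=
  mul_eq_one_comm.1 (shear_mul_shear_neg q)

/-- In the basis whose first vector is the eigenvector `(1, q)` the matrix is block triangular, so
its spectrum and eigenvectors can be read off the blocks `x` and `deflated q u B`. -/
lemma eigenMatrix_mul_shear (x : ℝ) (q u : Fin n → ℝ) (B : Matrix (Fin n) (Fin n) ℝ) :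
    eigenMatrix x q u B * shear q = shear q * bordered x u 0 (deflated q u B) := by
  rw [eigenMatrix, shear, bordered_mul_bordered, bordered_mul_bordered]
  congr 1 <;> simp [deflated, sub_eq_add_neg]

lemma eigenMatrix_eq_conj (x : ℝ) (q u : Fin n → ℝ) (B : Matrix (Fin n) (Fin n) ℝ) :
    eigenMatrix x q u B = shear q * bordered x u 0 (deflated q u B) * shear (-q) := by
  rw [← eigenMatrix_mul_shear, Matrix.mul_assoc, shear_mul_shear_neg, Matrix.mul_one]

lemma charpoly_eigenMatrix (x : ℝ) (q u : Fin n → ℝ) (B : Matrix (Fin n) (Fin n) ℝ) :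
    (eigenMatrix x q u B).charpoly
      = (Polynomial.X - Polynomial.C x) * (deflated q u B).charpoly := by
  let S : (Matrix (Fin (n + 1)) (Fin (n + 1)) ℝ)ˣ :=
    ⟨shear q, shear (-q), shear_mul_shear_neg q, shear_neg_mul_shear q⟩
  have h := Matrix.charpoly_units_conj S (bordered x u 0 (deflated q u B))
  rw [charpoly_bordered_zero, ← Matrix.coe_units_inv] at h
  rw [← h, eigenMatrix_eq_conj]
  rfl

lemma eigenMatrix_zero (x : ℝ) (u : Fin n → ℝ) (B : Matrix (Fin n) (Fin n) ℝ) :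
    eigenMatrix x 0 u B = bordered x u 0 B := by
  simp [eigenMatrix]

lemma deflated_zero (u : Fin n → ℝ) (B : Matrix (Fin n) (Fin n) ℝ) : deflated 0 u B = B := by
  simp [deflated]

/-- The part of the left eigenvector of `eigenMatrix x q u B` which is orthogonal to the first
basis vector. -/
def leftTail (x : ℝ) (q u : Fin n → ℝ) (B : Matrix (Fin n) (Fin n) ℝ) : Fin n → ℝ :=
  ((Matrix.scalar (Fin n) x - deflated q u B)ᵀ)⁻¹ *ᵥ u

/-- In the sheared basis the right eigenvector is `e_0` and the left one is `(1, w)` with `(x -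
deflated)ᵀ w = u`. Undoing the shear gives `(1, q)` and `(1 - q ⬝ᵥ w, w)`, whose pairing is `1`. -/
lemma overlap_eigenMatrix (x : ℝ) (q u : Fin n → ℝ) (B : Matrix (Fin n) (Fin n) ℝ)
    (h : (Matrix.scalar (Fin n) x - deflated q u B).det ≠ 0) :
    overlap (eigenMatrix x q u B) x
      = ((1 - q ⬝ᵥ leftTail x q u B) ^ 2 + leftTail x q u B ⬝ᵥ leftTail x q u B)
        * (1 + q ⬝ᵥ q) := by
  set w := leftTail x q u B with hw
  set T := bordered x u 0 (deflated q u B) with hT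
  set M := Matrix.scalar (Fin n) x - deflated q u B with hM
  have hMT : IsUnit Mᵀ.det := by rw [Matrix.det_transpose]; exact h.isUnit
  have hMw : Mᵀ *ᵥ w = u := by
    rw [hw, leftTail, Matrix.mulVec_mulVec, Matrix.mul_nonsing_inv _ hMT, Matrix.one_mulVec]
  have hinj {a b : Fin n → ℝ} (hab : Mᵀ *ᵥ a = Mᵀ *ᵥ b) : a = b :=
    Matrix.mulVec_injective_iff_isUnit.2 ((Matrix.isUnit_iff_isUnit_det _).2 hMT) hab
  have hinj' {a b : Fin n → ℝ} (hab : M *ᵥ a = M *ᵥ b) : a = b :=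
    Matrix.mulVec_injective_iff_isUnit.2 ((Matrix.isUnit_iff_isUnit_det _).2 h.isUnit) hab
  have hMmul (a : Fin n → ℝ) : M *ᵥ a = x • a - deflated q u B *ᵥ a := by
    rw [hM, Matrix.sub_mulVec, Matrix.scalar_apply, ← Matrix.smul_one_eq_diagonal,
      Matrix.smul_mulVec, Matrix.one_mulVec]
  have hMTmul (a : Fin n → ℝ) : Mᵀ *ᵥ a = x • a - (deflated q u B)ᵀ *ᵥ a := by
    rw [hM, Matrix.transpose_sub, Matrix.sub_mulVec, Matrix.scalar_apply,
      Matrix.diagonal_transpose, ← Matrix.smul_one_eq_diagonal, Matrix.smul_mulVec,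
      Matrix.one_mulVec]
  -- Invertibility of `x - deflated q u B` makes both eigenspaces of the triangular matrix
  -- one-dimensional: here the right one, in `hTl` the left one.
  have hTr (r : Fin (n + 1) → ℝ) (hr : T *ᵥ r = x • r) : r = r 0 • Fin.cons 1 0 := by
    rw [← Fin.cons_self_tail r, hT, bordered_mulVec_cons] at hr
    have hs : M *ᵥ Fin.tail r = M *ᵥ 0 := by
      rw [hMmul, Matrix.mulVec_zero]
      funext i
      have := congrFun hr i.succ
      simp only [Fin.cons_succ, smul_zero, zero_add, Pi.smul_apply] at this
      simp [this]
    have := hinj' hs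
    funext i
    refine Fin.cases ?_ (fun i => ?_) i
    · simp
    · simpa [Fin.tail] using congrFun this i
  have hTl (l : Fin (n + 1) → ℝ) (hl : Tᵀ *ᵥ l = x • l) : l = l 0 • Fin.cons 1 w := by
    rw [← Fin.cons_self_tail l, hT, bordered_transpose, bordered_mulVec_cons] at hl
    have hs : Mᵀ *ᵥ Fin.tail l = Mᵀ *ᵥ (l 0 • w) := by
      rw [hMTmul, Matrix.mulVec_smul, hMw]
      funext i
      have := congrFun hl i.succ
      simp only [Fin.cons_succ, Pi.smul_apply, Pi.add_apply, smul_eq_mul] at this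
      simp only [Pi.sub_apply, Pi.smul_apply, smul_eq_mul, ← this, add_sub_cancel_right]
    have := hinj hs
    funext i
    refine Fin.cases ?_ (fun i => ?_) i
    · simp
    · simpa [Fin.tail] using congrFun this i
  have hTr0 : T *ᵥ (Fin.cons 1 0 : Fin (n + 1) → ℝ) = x • (Fin.cons 1 0 : Fin (n + 1) → ℝ) := by
    rw [hT, bordered_mulVec_cons]
    funext i
    refine Fin.cases ?_ (fun i => ?_) i <;> simp
  have hTl0 : Tᵀ *ᵥ (Fin.cons 1 w : Fin (n + 1) → ℝ) = x • (Fin.cons 1 w : Fin (n + 1) → ℝ) := by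
    rw [hT, bordered_transpose, bordered_mulVec_cons]
    have : u + (deflated q u B)ᵀ *ᵥ w = x • w := by
      have := hMTmul w
      rw [hMw] at this
      exact eq_sub_iff_add_eq.1 this
    funext i
    refine Fin.cases ?_ (fun i => ?_) i
    · simp
    · simpa using congrFun this i
  have hXT : eigenMatrix x q u B = shear q * T * shear (-q) := eigenMatrix_eq_conj ..
  have hXTt : (eigenMatrix x q u B)ᵀ = (shear (-q))ᵀ * Tᵀ * (shear q)ᵀ := by
    rw [hXT, Matrix.transpose_mul, Matrix.transpose_mul, Matrix.mul_assoc]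
  have hSr : shear q *ᵥ (Fin.cons 1 0 : Fin (n + 1) → ℝ) = Fin.cons 1 q := by
    rw [shear, bordered_mulVec_cons]; simp
  have hSl : (shear (-q))ᵀ *ᵥ (Fin.cons 1 w : Fin (n + 1) → ℝ) = Fin.cons (1 - q ⬝ᵥ w) w := by
    rw [shear, bordered_transpose, bordered_mulVec_cons]
    simp [sub_eq_add_neg]
  have hSS : (shear q)ᵀ * (shear (-q))ᵀ = 1 := by
    rw [← Matrix.transpose_mul, shear_neg_mul_shear, Matrix.transpose_one]
  have hSS' : (shear (-q))ᵀ * (shear q)ᵀ = 1 := mul_eq_one_comm.1 hSS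
  rw [overlap_eq_of_simple (l := Fin.cons (1 - q ⬝ᵥ w) w) (r := Fin.cons 1 q)]
  · simp only [dotProduct, Fin.sum_univ_succ, Fin.cons_zero, Fin.cons_succ]
    ring
  · refine ⟨eigenMatrix_mulVec .., ?_, ?_⟩
    · rw [← hSl, hXTt, Matrix.mulVec_mulVec, Matrix.mul_assoc, hSS, Matrix.mul_one,
        ← Matrix.mulVec_mulVec, hTl0, Matrix.mulVec_smul]
    · simp only [dotProduct, Fin.sum_univ_succ, Fin.cons_zero, Fin.cons_succ]
      simp only [mul_comm]
      ring
  · intro r hr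
    have h1 : T *ᵥ (shear (-q) *ᵥ r) = x • (shear (-q) *ᵥ r) := by
      rw [← Matrix.mulVec_smul, ← hr, hXT, Matrix.mulVec_mulVec, Matrix.mulVec_mulVec,
        ← Matrix.mul_assoc, ← Matrix.mul_assoc, shear_neg_mul_shear, Matrix.one_mul]
    refine ⟨(shear (-q) *ᵥ r) 0, ?_⟩
    rw [← hSr, ← Matrix.mulVec_smul, ← hTr _ h1, Matrix.mulVec_mulVec, shear_mul_shear_neg,
      Matrix.one_mulVec]
  · intro l hl
    have h1 : Tᵀ *ᵥ ((shear q)ᵀ *ᵥ l) = x • ((shear q)ᵀ *ᵥ l) := by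
      rw [← Matrix.mulVec_smul, ← hl, hXTt, Matrix.mulVec_mulVec, Matrix.mulVec_mulVec,
        ← Matrix.mul_assoc, ← Matrix.mul_assoc, hSS, Matrix.one_mul]
    refine ⟨((shear q)ᵀ *ᵥ l) 0, ?_⟩
    rw [← hSl, ← Matrix.mulVec_smul, ← hTl _ h1, Matrix.mulVec_mulVec, hSS', Matrix.one_mulVec]

end Eigen

/-! ### Lebesgue measure on bordered matrices, Gaussian vectors -/

section Measures

variable {n : ℕ}

/-- The array of entries of a bordered matrix, as a function of its four blocks. -/
def borderedArray (p : ℝ × (Fin n → ℝ) × (Fin n → ℝ) × (Fin n → Fin n → ℝ)) :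
    Fin (n + 1) → Fin (n + 1) → ℝ :=
  Matrix.of.symm (bordered p.1 p.2.1 p.2.2.1 (Matrix.of p.2.2.2))

lemma of_borderedArray (p : ℝ × (Fin n → ℝ) × (Fin n → ℝ) × (Fin n → Fin n → ℝ)) :
    Matrix.of (borderedArray p) = bordered p.1 p.2.1 p.2.2.1 (Matrix.of p.2.2.2) := rfl

lemma measurePreserving_cons {α : Type*} [MeasurableSpace α] (μ : Measure α) [SigmaFinite μ] :
    MeasurePreserving (fun p : α × (Fin n → α) => (Fin.cons p.1 p.2 : Fin (n + 1) → α))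
      (μ.prod (Measure.pi fun _ => μ)) (Measure.pi fun _ => μ) := by
  have h := (measurePreserving_piFinSuccAbove (fun _ : Fin (n + 1) => μ) 0).symm
  convert h using 1
  funext p
  simp [MeasurableEquiv.piFinSuccAbove, Fin.insertNthEquiv]

lemma measurePreserving_borderedArray :
    MeasurePreserving (borderedArray (n := n)) volume volume := by
  have h1 : MeasurePreserving
      (fun p : ℝ × (Fin n → ℝ) => (Fin.cons p.1 p.2 : Fin (n + 1) → ℝ)) volume volume :=
    measurePreserving_cons volume
  have h2 : MeasurePreserving
      (fun p : (Fin (n + 1) → ℝ) × (Fin n → Fin (n + 1) → ℝ) =>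
        (Fin.cons p.1 p.2 : Fin (n + 1) → Fin (n + 1) → ℝ)) volume volume :=
    measurePreserving_cons volume
  have h3 : MeasurePreserving (fun p : (Fin n → ℝ) × (Fin n → Fin n → ℝ) =>
      fun i : Fin n => (Fin.cons (p.1 i) (p.2 i) : Fin (n + 1) → ℝ)) volume volume :=
    (volume_preserving_pi fun _ : Fin n => h1).comp
      (volume_measurePreserving_arrowProdEquivProdArrow ℝ (Fin n → ℝ) (Fin n)).symm
  have h4 : MeasurePreserving (fun p : (ℝ × (Fin n → ℝ)) × (Fin n → ℝ) × (Fin n → Fin n → ℝ) =>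
      borderedArray (p.1.1, p.1.2, p.2)) volume volume :=
    h2.comp (h1.prod h3)
  exact h4.comp volume_preserving_prodAssoc.symm

lemma measurable_borderedArray : Measurable (borderedArray (n := n)) :=
  measurePreserving_borderedArray.measurable

lemma lintegral_borderedArray {F : (Fin (n + 1) → Fin (n + 1) → ℝ) → ℝ≥0∞} (hF : Measurable F) :
    ∫⁻ X, F X = ∫⁻ a, ∫⁻ u, ∫⁻ v, ∫⁻ B, F (borderedArray (a, u, v, B)) := by
  have hm : Measurable fun p => F (borderedArray (n := n) p) := hF.comp measurable_borderedArray
  rw [← measurePreserving_borderedArray.lintegral_comp hF, Measure.volume_eq_prod,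
    lintegral_prod _ hm.aemeasurable]
  refine lintegral_congr fun a => ?_
  have hm1 : Measurable fun p => F (borderedArray (n := n) (a, p)) :=
    hm.comp measurable_prodMk_left
  rw [Measure.volume_eq_prod, lintegral_prod _ hm1.aemeasurable]
  refine lintegral_congr fun u => ?_
  have hm2 : Measurable fun p => F (borderedArray (n := n) (a, u, p)) :=
    hm1.comp measurable_prodMk_left
  rw [Measure.volume_eq_prod, lintegral_prod _ hm2.aemeasurable]

/-- The standard Gaussian measure on `ℝⁿ`. -/
def stdGauss (n : ℕ) : Measure (Fin n → ℝ) := Measure.pi fun _ => gaussianReal 0 1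

instance : IsProbabilityMeasure (stdGauss n) := by unfold stdGauss; infer_instance

lemma lintegral_gaussian_shift_scale {F : ℝ → ℝ≥0∞} (hF : Measurable F) (m : ℝ) {c : ℝ}
    (hc : 0 < c) :
    ∫⁻ a, F a * ENNReal.ofReal (Real.exp (-(a - m) ^ 2 / (2 * c)))
      = ENNReal.ofReal (√(2 * Real.pi * c)) * ∫⁻ g, F (m + √c * g) ∂gaussianReal 0 1 := by
  lift c to NNReal using hc.le
  have hc0 : c ≠ 0 := by
    rintro rfl
    simp at hc
  have hpos : 0 < √(2 * Real.pi * (c : ℝ)) := by positivity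
  have hmap : (gaussianReal 0 1).map (fun g => m + √(c : ℝ) * g) = gaussianReal m c := by
    have h1 := gaussianReal_map_const_mul (μ := 0) (v := 1) (√(c : ℝ))
    have h2 := gaussianReal_map_const_add (μ := 0) (v := c) m
    have h3 : (NNReal.mk (√(c : ℝ) ^ 2) (sq_nonneg _) * 1 : NNReal) = c := by
      ext; simp
    rw [mul_zero, h3] at h1
    rw [zero_add, ← h1, Measure.map_map (by fun_prop) (by fun_prop)] at h2
    exact h2
  have hF' : ∫⁻ g, F (m + √(c : ℝ) * g) ∂gaussianReal 0 1 = ∫⁻ a, F a ∂gaussianReal m c := by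
    rw [← hmap, lintegral_map hF (by fun_prop)]
  rw [hF', gaussianReal_of_var_ne_zero m hc0,
    lintegral_withDensity_eq_lintegral_mul _ (measurable_gaussianPDF m c) hF,
    ← lintegral_const_mul _ ((measurable_gaussianPDF m c).mul hF)]
  refine lintegral_congr fun a => ?_
  rw [Pi.mul_apply, gaussianPDF, gaussianPDFReal, ← mul_assoc, ← ENNReal.ofReal_mul hpos.le,
    ← mul_assoc, mul_inv_cancel₀ hpos.ne', one_mul, mul_comm]

lemma lintegral_gaussian_vector {F : (Fin n → ℝ) → ℝ≥0∞} (hF : Measurable F) {c : ℝ}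
    (hc : 0 < c) :
    ∫⁻ w, F w * ENNReal.ofReal (Real.exp (-(w ⬝ᵥ w) / (2 * c)))
      = ENNReal.ofReal (√(2 * Real.pi * c) ^ n) * ∫⁻ g, F (√c • g) ∂stdGauss n := by
  induction n with
  | zero =>
    rw [stdGauss, volume_pi, Measure.pi_of_empty _ (fun i => i.elim0),
      Measure.pi_of_empty _ (fun i => i.elim0), lintegral_dirac, lintegral_dirac]
    simp only [dotProduct, Finset.univ_eq_empty, Finset.sum_empty, neg_zero, zero_div,
      Real.exp_zero, ENNReal.ofReal_one, mul_one, pow_zero, one_mul]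
    congr 1
    exact Subsingleton.elim _ _
  | succ n ih =>
    have hdot (a : ℝ) (w : Fin n → ℝ) : (Fin.cons a w : Fin (n + 1) → ℝ) ⬝ᵥ Fin.cons a w
        = a ^ 2 + w ⬝ᵥ w := by
      simp [dotProduct, Fin.sum_univ_succ, sq]
    have hsm (a : ℝ) (w : Fin n → ℝ) : √c • (Fin.cons a w : Fin (n + 1) → ℝ)
        = Fin.cons (√c * a) (√c • w) := by
      funext i
      refine Fin.cases ?_ (fun i => ?_) i <;> simp
    have hcons : Measurable fun p : ℝ × (Fin n → ℝ) => (Fin.cons p.1 p.2 : Fin (n + 1) → ℝ) :=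
      (measurePreserving_cons (volume : Measure ℝ)).measurable
    have hFc := hF.comp hcons
    rw [stdGauss, ← (measurePreserving_cons (n := n) (gaussianReal 0 1)).lintegral_comp
      (by fun_prop), volume_pi, ← (measurePreserving_cons (n := n) (volume : Measure ℝ)).lintegral_comp
      (by fun_prop), lintegral_prod _ (by fun_prop), lintegral_prod _ (by fun_prop)]
    simp only [hdot, hsm]
    have h1 (a : ℝ) : ∫⁻ w, F (Fin.cons a w)
          * ENNReal.ofReal (Real.exp (-(a ^ 2 + w ⬝ᵥ w) / (2 * c))) ∂(Measure.pi fun _ : Fin n => volume)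
        = (ENNReal.ofReal (√(2 * Real.pi * c) ^ n) * ∫⁻ g, F (Fin.cons a (√c • g)) ∂stdGauss n)
          * ENNReal.ofReal (Real.exp (-(a - 0) ^ 2 / (2 * c))) := by
      have hFa : Measurable fun w : Fin n → ℝ => F (Fin.cons a w) :=
        hFc.comp measurable_prodMk_left
      rw [← ih hFa, ← lintegral_mul_const _ (by fun_prop)]
      refine lintegral_congr fun w => ?_
      rw [mul_assoc, ← ENNReal.ofReal_mul (Real.exp_nonneg _), ← Real.exp_add]
      congr 4
      ring
    have hmeas : Measurable fun a : ℝ => ∫⁻ g, F (Fin.cons a (√c • g)) ∂stdGauss n := by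
      refine Measurable.lintegral_prod_right' (f := fun p : ℝ × (Fin n → ℝ) =>
        F (Fin.cons p.1 (√c • p.2))) ?_
      exact hFc.comp (g := fun p : ℝ × (Fin n → ℝ) => F (Fin.cons p.1 p.2))
        (f := fun p : ℝ × (Fin n → ℝ) => (p.1, √c • p.2)) (by fun_prop)
    simp only [h1]
    rw [lintegral_gaussian_shift_scale (hmeas.const_mul _) 0 hc, lintegral_const_mul]
    · rw [← mul_assoc, ← ENNReal.ofReal_mul (Real.sqrt_nonneg _), pow_succ']
      simp only [zero_add]
      rfl
    · exact hmeas.comp (by fun_prop)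

end Measures

/-! ### Recursive structure of the ensemble -/

section Ensemble

variable {n : ℕ} {τ : ℝ}

/-- No term couples the corner `a` to `u` and `v`, or the border to `B`. This independence makes the
ensemble recursive. -/
lemma trace_bordered (τ a : ℝ) (u v : Fin n → ℝ) (B : Matrix (Fin n) (Fin n) ℝ) :
    (bordered a u v B * (bordered a u v B)ᵀ - τ • bordered a u v B ^ 2).trace
      = (1 - τ) * a ^ 2 + u ⬝ᵥ u + v ⬝ᵥ v - 2 * τ * (u ⬝ᵥ v) + (B * Bᵀ - τ • B ^ 2).trace := by
  have htr (a : ℝ) (u v : Fin n → ℝ) (B : Matrix (Fin n) (Fin n) ℝ) :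
      (bordered a u v B).trace = a + B.trace := by
    simp [Matrix.trace, Fin.sum_univ_succ]
  rw [bordered_transpose, pow_two, bordered_mul_bordered, bordered_mul_bordered, Matrix.trace_sub,
    Matrix.trace_smul, htr, htr, Matrix.trace_add, Matrix.trace_add, Matrix.trace_vecMulVec,
    Matrix.trace_vecMulVec, Matrix.trace_sub, Matrix.trace_smul, pow_two B, dotProduct_comm v u]
  simp only [smul_eq_mul]
  ring

lemma normConst_pos (hτ₀ : 0 ≤ τ) (hτ₁ : τ < 1) (n : ℕ) : 0 < normConst τ n := by
  have h1 : 0 < 1 - τ ^ 2 := by nlinarith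
  have h2 : 0 < 1 + τ := by linarith
  unfold normConst
  positivity

lemma normConst_succ (hτ₀ : 0 ≤ τ) (hτ₁ : τ < 1) (n : ℕ) :
    normConst τ (n + 1) = √(2 * Real.pi * (1 + τ)) * √(2 * Real.pi * 1) ^ n
      * √(2 * Real.pi * (1 - τ ^ 2)) ^ n * normConst τ n := by
  have h1 : 0 < 1 - τ ^ 2 := by nlinarith
  have h2 : 0 < 1 + τ := by linarith
  have hpi : 0 < 2 * Real.pi := by positivity
  unfold normConst
  rw [mul_one, Real.sqrt_mul hpi.le, Real.sqrt_mul hpi.le, mul_pow]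
  simp only [Real.sqrt_eq_rpow, ← Real.rpow_natCast _ n, ← Real.rpow_mul hpi.le,
    ← Real.rpow_mul h1.le]
  push_cast
  have e1 : ((n : ℝ) + 1) ^ 2 / 2 = 1 / 2 + 1 / 2 * n + 1 / 2 * n + (n : ℝ) ^ 2 / 2 := by ring
  have e2 : ((n : ℝ) + 1) / 2 = 1 / 2 + (n : ℝ) / 2 := by ring
  have e3 : ((n : ℝ) + 1) * ((n : ℝ) + 1 - 1) / 4 = 1 / 2 * n + (n : ℝ) * ((n : ℝ) - 1) / 4 := by
    ring
  rw [e1, e2, e3, Real.rpow_add hpi, Real.rpow_add hpi, Real.rpow_add hpi, Real.rpow_add h2,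
    Real.rpow_add h1]
  ring

/-- The unnormalized density of the ensemble. -/
def weight (τ : ℝ) (X : Matrix (Fin n) (Fin n) ℝ) : ℝ :=
  Real.exp (-(1 / (2 * (1 - τ ^ 2))) * (X * Xᵀ - τ • X ^ 2).trace)

/-- Completion of the square: `|u|² + |v|² - 2τ u ⬝ᵥ v = (1 - τ²)|u|² + |v - τ u|²`. Given the row
`u`, the column `v` is Gaussian with mean `τ u` and variance `1 - τ²`. -/
lemma weight_bordered (hτ₀ : 0 ≤ τ) (hτ₁ : τ < 1) (a : ℝ) (u v : Fin n → ℝ)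
    (B : Matrix (Fin n) (Fin n) ℝ) :
    weight τ (bordered a u v B) = Real.exp (-(a - 0) ^ 2 / (2 * (1 + τ)))
      * (Real.exp (-(u ⬝ᵥ u) / (2 * 1))
        * (Real.exp (-((v - τ • u) ⬝ᵥ (v - τ • u)) / (2 * (1 - τ ^ 2))) * weight τ B)) := by
  have h1 : 1 - τ ^ 2 ≠ 0 := by nlinarith
  have h2 : 1 + τ ≠ 0 := by linarith
  have h3 : 1 - τ ≠ 0 := by linarith
  unfold weight
  rw [trace_bordered, ← Real.exp_add, ← Real.exp_add, ← Real.exp_add]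
  congr 1
  rw [sub_dotProduct, dotProduct_sub, dotProduct_sub, smul_dotProduct, smul_dotProduct,
    dotProduct_smul, dotProduct_comm v u, dotProduct_smul]
  simp only [smul_eq_mul]
  have h4 : 1 - τ ^ 2 = (1 - τ) * (1 + τ) := by ring
  rw [h4]
  field_simp
  ring

lemma continuous_weight (τ : ℝ) :
    Continuous fun X : Fin n → Fin n → ℝ => weight τ (Matrix.of X) := by
  have h : Continuous fun X : Fin n → Fin n → ℝ => Matrix.of X :=
    continuous_matrix fun i j => (continuous_apply j).comp (continuous_apply i)
  unfold weight
  refine Real.continuous_exp.comp (continuous_const.mul ?_)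
  exact ((h.matrix_mul h.matrix_transpose).sub ((h.pow 2).const_smul τ)).matrix_trace

lemma measurable_weight (τ : ℝ) :
    Measurable fun X : Fin n → Fin n → ℝ => weight τ (Matrix.of X) :=
  (continuous_weight τ).measurable

lemma lintegral_ensemble (hτ₀ : 0 ≤ τ) (hτ₁ : τ < 1) {F : (Fin n → Fin n → ℝ) → ℝ≥0∞} :
    ∫⁻ X, F X ∂ensemble τ n
      = ENNReal.ofReal (normConst τ n)⁻¹
        * ∫⁻ X, F X * ENNReal.ofReal (weight τ (Matrix.of X)) := by
  have hd (X : Fin n → Fin n → ℝ) : ENNReal.ofReal (matrixDensity τ (Matrix.of X))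
      = ENNReal.ofReal (normConst τ n)⁻¹ * ENNReal.ofReal (weight τ (Matrix.of X)) := by
    rw [← ENNReal.ofReal_mul (inv_nonneg.2 (normConst_pos hτ₀ hτ₁ n).le)]
    rfl
  have hm := (measurable_weight (n := n) τ).ennreal_ofReal
  rw [ensemble, lintegral_withDensity_eq_lintegral_mul_non_measurable]
  · simp only [Pi.mul_apply, hd]
    rw [← lintegral_const_mul' _ _ ENNReal.ofReal_ne_top]
    refine lintegral_congr fun X => ?_
    ring
  · simp only [hd]
    exact hm.const_mul _
  · exact ae_of_all _ fun _ => ENNReal.ofReal_lt_top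

instance : SFinite (ensemble τ n) := by unfold ensemble; infer_instance

/-- The factorized weight is integrated block by block; the Gaussian normalizations of the border
are exactly the ratio of two consecutive constants `normConst`. -/
lemma lintegral_ensemble_succ (hτ₀ : 0 ≤ τ) (hτ₁ : τ < 1)
    {F : (Fin (n + 1) → Fin (n + 1) → ℝ) → ℝ≥0∞} (hF : Measurable F) :
    ∫⁻ X, F X ∂ensemble τ (n + 1)
      = ∫⁻ a, ∫⁻ u, ∫⁻ g, ∫⁻ B,
          F (borderedArray (√(1 + τ) * a, u, τ • u + √(1 - τ ^ 2) • g, B))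
          ∂ensemble τ n ∂stdGauss n ∂stdGauss n ∂gaussianReal 0 1 := by
  have h1 : 0 < 1 - τ ^ 2 := by nlinarith
  have h2 : 0 < 1 + τ := by linarith
  have hC := normConst_pos hτ₀ hτ₁ n
  have hFb : Measurable fun p => F (borderedArray (n := n) p) := hF.comp measurable_borderedArray
  have hw := (measurable_weight (n := n) τ).ennreal_ofReal
  have hw' := (measurable_weight (n := n + 1) τ).ennreal_ofReal
  have hCe : ENNReal.ofReal (normConst τ n) ≠ 0 := by simpa using hC
  have hB (a : ℝ) (u v : Fin n → ℝ) :
      ∫⁻ B, F (borderedArray (a, u, v, B)) * ENNReal.ofReal (weight τ (Matrix.of B))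
        = ENNReal.ofReal (normConst τ n) * ∫⁻ B, F (borderedArray (a, u, v, B)) ∂ensemble τ n := by
    rw [lintegral_ensemble hτ₀ hτ₁, ← mul_assoc, ENNReal.ofReal_inv_of_pos hC,
      ENNReal.mul_inv_cancel hCe ENNReal.ofReal_ne_top, one_mul]
  set K₄ : ℝ × (Fin n → ℝ) × (Fin n → ℝ) → ℝ≥0∞ :=
    fun p => ∫⁻ B, F (borderedArray (p.1, p.2.1, p.2.2, B)) ∂ensemble τ n with hK₄
  have hK₄m : Measurable K₄ :=
    Measurable.lintegral_prod_right'
      (f := fun p : (ℝ × (Fin n → ℝ) × (Fin n → ℝ)) × (Fin n → Fin n → ℝ) =>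
        F (borderedArray (p.1.1, p.1.2.1, p.1.2.2, p.2)))
      (hFb.comp (by fun_prop :
        Measurable fun p : (ℝ × (Fin n → ℝ) × (Fin n → ℝ)) × (Fin n → Fin n → ℝ) =>
          (p.1.1, p.1.2.1, p.1.2.2, p.2)))
  set K₃ : ℝ × (Fin n → ℝ) → ℝ≥0∞ :=
    fun p => ∫⁻ g, K₄ (p.1, p.2, τ • p.2 + √(1 - τ ^ 2) • g) ∂stdGauss n with hK₃
  have hK₃m : Measurable K₃ :=
    Measurable.lintegral_prod_right'
      (f := fun p : (ℝ × (Fin n → ℝ)) × (Fin n → ℝ) =>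
        K₄ (p.1.1, p.1.2, τ • p.1.2 + √(1 - τ ^ 2) • p.2))
      (hK₄m.comp (by fun_prop))
  set K₂ : ℝ → ℝ≥0∞ := fun a => ∫⁻ u, K₃ (a, u) ∂stdGauss n with hK₂
  have hK₂m : Measurable K₂ := hK₃m.lintegral_prod_right'
  set e₁ : ℝ → ℝ := fun a => Real.exp (-(a - 0) ^ 2 / (2 * (1 + τ))) with he₁
  set e₂ : (Fin n → ℝ) → ℝ := fun u => Real.exp (-(u ⬝ᵥ u) / (2 * 1)) with he₂
  set e₃ : (Fin n → ℝ) → ℝ := fun v => Real.exp (-(v ⬝ᵥ v) / (2 * (1 - τ ^ 2))) with he₃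
  have hv (a : ℝ) (u : Fin n → ℝ) :
      ∫⁻ v, K₄ (a, u, v) * ENNReal.ofReal (e₃ (v - τ • u))
        = ENNReal.ofReal (√(2 * Real.pi * (1 - τ ^ 2)) ^ n) * K₃ (a, u) := by
    rw [← lintegral_add_left_eq_self _ (τ • u)]
    simp only [add_sub_cancel_left]
    exact lintegral_gaussian_vector (F := fun v => K₄ (a, u, τ • u + v))
      (hK₄m.comp (by fun_prop)) h1
  have hu (a : ℝ) : ∫⁻ u, K₃ (a, u) * ENNReal.ofReal (e₂ u)
      = ENNReal.ofReal (√(2 * Real.pi * 1) ^ n) * K₂ a := by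
    have := lintegral_gaussian_vector (F := fun u => K₃ (a, u)) (hK₃m.comp (by fun_prop)) one_pos
    simpa only [Real.sqrt_one, one_smul] using this
  have ha : ∫⁻ a, K₂ a * ENNReal.ofReal (e₁ a) = ENNReal.ofReal (√(2 * Real.pi * (1 + τ)))
      * ∫⁻ a, K₂ (√(1 + τ) * a) ∂gaussianReal 0 1 := by
    have := lintegral_gaussian_shift_scale hK₂m 0 h2
    simpa only [zero_add] using this
  have hB' (a : ℝ) (u v : Fin n → ℝ) :
      ∫⁻ B, F (borderedArray (a, u, v, B))
          * ENNReal.ofReal (weight τ (Matrix.of (borderedArray (a, u, v, B))))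
        = ENNReal.ofReal (e₁ a) * (ENNReal.ofReal (e₂ u) * (ENNReal.ofReal (normConst τ n)
          * (K₄ (a, u, v) * ENNReal.ofReal (e₃ (v - τ • u))))) := by
    have he (B : Fin n → Fin n → ℝ) : F (borderedArray (a, u, v, B))
          * ENNReal.ofReal (weight τ (Matrix.of (borderedArray (a, u, v, B))))
        = ENNReal.ofReal (e₁ a) * ENNReal.ofReal (e₂ u) * ENNReal.ofReal (e₃ (v - τ • u))
          * (F (borderedArray (a, u, v, B)) * ENNReal.ofReal (weight τ (Matrix.of B))) := by
      rw [of_borderedArray, weight_bordered hτ₀ hτ₁, ENNReal.ofReal_mul (Real.exp_nonneg _),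
        ENNReal.ofReal_mul (Real.exp_nonneg _), ENNReal.ofReal_mul (Real.exp_nonneg _)]
      ring
    simp only [he]
    rw [lintegral_const_mul' _ _ (by finiteness), hB]
    ring
  have hFw : Measurable fun X => F X * ENNReal.ofReal (weight τ (Matrix.of X)) := hF.mul hw'
  rw [lintegral_ensemble hτ₀ hτ₁, lintegral_borderedArray hFw]
  simp only [hB', lintegral_const_mul' _ _ ENNReal.ofReal_ne_top, hv]
  have hu' (a : ℝ) : ∫⁻ u, ENNReal.ofReal (e₂ u) * (ENNReal.ofReal (normConst τ n)
        * (ENNReal.ofReal (√(2 * Real.pi * (1 - τ ^ 2)) ^ n) * K₃ (a, u)))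
      = ENNReal.ofReal (normConst τ n) * ENNReal.ofReal (√(2 * Real.pi * (1 - τ ^ 2)) ^ n)
        * (ENNReal.ofReal (√(2 * Real.pi * 1) ^ n) * K₂ a) := by
    rw [← hu, ← lintegral_const_mul' _ _ (by finiteness)]
    refine lintegral_congr fun u => ?_
    ring
  have ha' : ∫⁻ a, ENNReal.ofReal (e₁ a) * (ENNReal.ofReal (normConst τ n)
        * ENNReal.ofReal (√(2 * Real.pi * (1 - τ ^ 2)) ^ n)
        * (ENNReal.ofReal (√(2 * Real.pi * 1) ^ n) * K₂ a))
      = ENNReal.ofReal (normConst τ n) * ENNReal.ofReal (√(2 * Real.pi * (1 - τ ^ 2)) ^ n)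
        * ENNReal.ofReal (√(2 * Real.pi * 1) ^ n)
        * (ENNReal.ofReal (√(2 * Real.pi * (1 + τ))) * ∫⁻ a, K₂ (√(1 + τ) * a) ∂gaussianReal 0 1) := by
    rw [← ha, ← lintegral_const_mul' _ _ (by finiteness)]
    refine lintegral_congr fun a => ?_
    ring
  simp only [hu']
  rw [ha', ← mul_assoc, ← mul_assoc, ← ENNReal.ofReal_mul hC.le,
    ← ENNReal.ofReal_mul (by positivity), mul_assoc (ENNReal.ofReal _),
    ← ENNReal.ofReal_mul (by positivity), ← ENNReal.ofReal_mul
      (inv_nonneg.2 (normConst_pos hτ₀ hτ₁ (n + 1)).le)]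
  have : (normConst τ (n + 1))⁻¹ * (normConst τ n * √(2 * Real.pi * (1 - τ ^ 2)) ^ n
      * √(2 * Real.pi * 1) ^ n * √(2 * Real.pi * (1 + τ))) = 1 := by
    rw [inv_mul_eq_one₀ (normConst_pos hτ₀ hτ₁ (n + 1)).ne', normConst_succ hτ₀ hτ₁]
    ring
  rw [this, ENNReal.ofReal_one, one_mul]

/-- The entries of a matrix of the ensemble in terms of independent variables. -/
def blockMap (τ : ℝ) (p : ℝ × (Fin n → ℝ) × (Fin n → ℝ) × (Fin n → Fin n → ℝ)) :
    Fin (n + 1) → Fin (n + 1) → ℝ :=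
  borderedArray (√(1 + τ) * p.1, p.2.1, τ • p.2.1 + √(1 - τ ^ 2) • p.2.2.1, p.2.2.2)

lemma measurable_blockMap (τ : ℝ) : Measurable (blockMap (n := n) τ) :=
  measurable_borderedArray.comp (by fun_prop)

lemma measurePreserving_blockMap (hτ₀ : 0 ≤ τ) (hτ₁ : τ < 1) (n : ℕ) :
    MeasurePreserving (blockMap (n := n) τ)
      ((gaussianReal 0 1).prod ((stdGauss n).prod ((stdGauss n).prod (ensemble τ n))))
      (ensemble τ (n + 1)) := by
  refine ⟨measurable_blockMap τ, Measure.ext_of_lintegral _ fun F hF => ?_⟩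
  have : SFinite ((stdGauss n).prod (ensemble τ n)) := Measure.prod.instSFinite
  have : SFinite ((stdGauss n).prod ((stdGauss n).prod (ensemble τ n))) :=
    Measure.prod.instSFinite
  have hm : Measurable fun p => F (blockMap (n := n) τ p) := hF.comp (measurable_blockMap τ)
  rw [lintegral_map hF (measurable_blockMap τ), lintegral_ensemble_succ hτ₀ hτ₁ hF,
    lintegral_prod _ hm.aemeasurable]
  refine lintegral_congr fun a => ?_
  have hm1 : Measurable fun p => F (blockMap (n := n) τ (a, p)) := hm.comp measurable_prodMk_left
  rw [lintegral_prod _ hm1.aemeasurable]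
  refine lintegral_congr fun u => ?_
  have hm2 : Measurable fun p => F (blockMap (n := n) τ (a, u, p)) :=
    hm1.comp measurable_prodMk_left
  rw [lintegral_prod _ hm2.aemeasurable]
  rfl

/-- The normalization is inherited through the block decomposition, starting from the empty matrix.
-/
lemma isProbabilityMeasure_ensemble (hτ₀ : 0 ≤ τ) (hτ₁ : τ < 1) (n : ℕ) :
    IsProbabilityMeasure (ensemble τ n) := by
  induction n with
  | zero =>
    constructor
    rw [← lintegral_one, lintegral_ensemble hτ₀ hτ₁, volume_pi,
      Measure.pi_of_empty _ (fun i => i.elim0), lintegral_dirac]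
    simp [weight, normConst]
  | succ n ih =>
    rw [← (measurePreserving_blockMap hτ₀ hτ₁ n).map_eq]
    exact Measure.isProbabilityMeasure_map (measurable_blockMap τ).aemeasurable

end Ensemble

/-! ### Linear changes of variables -/

section Linear

lemma ofReal_abs_det_mul_lintegral_comp {E : Type*} [NormedAddCommGroup E] [NormedSpace ℝ E]
    [MeasurableSpace E] [BorelSpace E] [FiniteDimensional ℝ E] (μ : Measure E)
    [μ.IsAddHaarMeasure] {f : E →ₗ[ℝ] E} (hf : LinearMap.det f ≠ 0) {F : E → ℝ≥0∞}
    (hF : Measurable F) :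
    ENNReal.ofReal |LinearMap.det f| * ∫⁻ x, F (f x) ∂μ = ∫⁻ x, F x ∂μ := by
  have hfm : Measurable f := f.continuous_of_finiteDimensional.measurable
  rw [← lintegral_map hF hfm, Measure.map_linearMap_addHaar_eq_smul_addHaar μ hf,
    lintegral_smul_measure, smul_eq_mul, ← mul_assoc, ← ENNReal.ofReal_mul (abs_nonneg _),
    ← abs_mul, mul_inv_cancel₀ hf, abs_one, ENNReal.ofReal_one, one_mul]

lemma lintegral_matrix_mulVec {n : ℕ} {M : Matrix (Fin n) (Fin n) ℝ} (hM : M.det ≠ 0)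
    {F : (Fin n → ℝ) → ℝ≥0∞} (hF : Measurable F) :
    ENNReal.ofReal |M.det| * ∫⁻ w, F (M *ᵥ w) = ∫⁻ w, F w := by
  have h := ofReal_abs_det_mul_lintegral_comp (volume : Measure (Fin n → ℝ))
    (f := Matrix.toLin' M) (by rwa [LinearMap.det_toLin']) hF
  simpa only [LinearMap.det_toLin', Matrix.toLin'_apply] using h

variable {m n : ℕ}

/-- Multiplication of `m × n` arrays by a matrix on the right. -/
def mulRightMap (K : Matrix (Fin n) (Fin n) ℝ) :
    (Fin m → Fin n → ℝ) →ₗ[ℝ] (Fin m → Fin n → ℝ) :=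
  LinearMap.pi fun i => Matrix.toLin' Kᵀ ∘ₗ LinearMap.proj i

lemma mulRightMap_apply (K : Matrix (Fin n) (Fin n) ℝ) (Z : Fin m → Fin n → ℝ) :
    mulRightMap K Z = Matrix.of.symm (Matrix.of Z * K) := by
  funext i j
  simp [mulRightMap, Matrix.mulVec, dotProduct, Matrix.mul_apply, mul_comm]

lemma det_mulRightMap (K : Matrix (Fin n) (Fin n) ℝ) :
    LinearMap.det (mulRightMap (m := m) K) = K.det ^ m := by
  simp [mulRightMap, LinearMap.det_pi]

/-- Multiplication of `m × n` arrays by a matrix on the left. -/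
def mulLeftMap (Q : Matrix (Fin m) (Fin m) ℝ) :
    (Fin m → Fin n → ℝ) →ₗ[ℝ] (Fin m → Fin n → ℝ) where
  toFun Z := Matrix.of.symm (Q * Matrix.of Z)
  map_add' Z W := by
    change Matrix.of.symm (Q * (Matrix.of Z + Matrix.of W)) = _
    rw [Matrix.mul_add]; rfl
  map_smul' c Z := by
    change Matrix.of.symm (Q * (c • Matrix.of Z)) = _
    rw [Matrix.mul_smul]; rfl

lemma det_mulLeftMap (Q : Matrix (Fin m) (Fin m) ℝ) :
    LinearMap.det (mulLeftMap (n := n) Q) = Q.det ^ n := by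
  let e : (Fin n → Fin m → ℝ) ≃ₗ[ℝ] (Fin m → Fin n → ℝ) :=
    { toFun := fun Z i j => Z j i
      invFun := fun Z i j => Z j i
      map_add' := fun _ _ => rfl
      map_smul' := fun _ _ => rfl
      left_inv := fun _ => rfl
      right_inv := fun _ => rfl }
  have h : mulLeftMap (n := n) Q = e.toLinearMap ∘ₗ mulRightMap Qᵀ ∘ₗ e.symm.toLinearMap := by
    refine LinearMap.ext fun Z => ?_
    funext i j
    simp [mulLeftMap, mulRightMap_apply, e, Matrix.mul_apply, mul_comm]
  rw [h, LinearMap.det_conj, det_mulRightMap, Matrix.det_transpose]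

lemma lintegral_mul_mul (Q : Matrix (Fin m) (Fin m) ℝ) (K : Matrix (Fin n) (Fin n) ℝ)
    (hQ : |Q.det| = 1) (hK : K.det ≠ 0) {F : (Fin m → Fin n → ℝ) → ℝ≥0∞} (hF : Measurable F) :
    ENNReal.ofReal (|K.det| ^ m) * ∫⁻ Z : Fin m → Fin n → ℝ, F (Matrix.of.symm (Q * Matrix.of Z * K)) = ∫⁻ Z, F Z := by
  have hQ0 : Q.det ≠ 0 := fun h => by simp [h] at hQ
  have hf : LinearMap.det (mulRightMap (m := m) K ∘ₗ mulLeftMap Q) = K.det ^ m * Q.det ^ n := by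
    rw [LinearMap.det_comp, det_mulRightMap, det_mulLeftMap]
  have h := ofReal_abs_det_mul_lintegral_comp (volume : Measure (Fin m → Fin n → ℝ))
    (f := mulRightMap K ∘ₗ mulLeftMap Q) (by rw [hf]; positivity) hF
  rw [hf, abs_mul, abs_pow, abs_pow, hQ, one_pow, mul_one] at h
  rw [← h]
  congr 2
  funext Z
  rw [LinearMap.comp_apply, mulRightMap_apply]
  rfl

lemma abs_det_of_orthogonal {Q : Matrix (Fin n) (Fin n) ℝ} (hQ : Qᵀ * Q = 1) : |Q.det| = 1 := by
  have h := congrArg Matrix.det hQ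
  rw [Matrix.det_mul, Matrix.det_transpose, Matrix.det_one] at h
  rcases mul_self_eq_one_iff.1 h with h | h <;> simp [h]

lemma weight_orthogonal_conj (τ : ℝ) {Q : Matrix (Fin n) (Fin n) ℝ} (hQ : Qᵀ * Q = 1)
    (X : Matrix (Fin n) (Fin n) ℝ) : weight τ (Q * X * Qᵀ) = weight τ X := by
  have h1 : Q * X * Qᵀ * (Q * X * Qᵀ)ᵀ = Q * (X * Xᵀ) * Qᵀ := by
    rw [Matrix.transpose_mul, Matrix.transpose_mul, Matrix.transpose_transpose]
    calc Q * X * Qᵀ * (Q * (Xᵀ * Qᵀ)) = Q * X * (Qᵀ * Q) * Xᵀ * Qᵀ := by noncomm_ring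
      _ = _ := by rw [hQ, Matrix.mul_one, Matrix.mul_assoc Q X]
  have h2 : (Q * X * Qᵀ) ^ 2 = Q * X ^ 2 * Qᵀ := by
    calc (Q * X * Qᵀ) ^ 2 = Q * X * (Qᵀ * Q) * X * Qᵀ := by noncomm_ring
      _ = _ := by rw [hQ]; noncomm_ring
  have htr (Y : Matrix (Fin n) (Fin n) ℝ) : (Q * Y * Qᵀ).trace = Y.trace := by
    rw [Matrix.trace_mul_comm, ← Matrix.mul_assoc, hQ, Matrix.one_mul]
  unfold weight
  rw [h1, h2, Matrix.trace_sub, Matrix.trace_smul, htr, htr, Matrix.trace_sub, Matrix.trace_smul]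

lemma lintegral_weight_orthogonal_conj {τ : ℝ} {Q : Matrix (Fin n) (Fin n) ℝ} (hQ : Qᵀ * Q = 1)
    {F : (Fin n → Fin n → ℝ) → ℝ≥0∞} (hF : Measurable F) :
    ∫⁻ X, F (Matrix.of.symm (Q * Matrix.of X * Qᵀ)) * ENNReal.ofReal (weight τ (Matrix.of X))
      = ∫⁻ X, F X * ENNReal.ofReal (weight τ (Matrix.of X)) := by
  have hdet := abs_det_of_orthogonal hQ
  have hdet0 : Qᵀ.det ≠ 0 := fun h => by rw [← Matrix.det_transpose, h] at hdet; simp at hdet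
  have hFw : Measurable fun X => F X * ENNReal.ofReal (weight τ (Matrix.of X)) :=
    hF.mul (measurable_weight τ).ennreal_ofReal
  rw [← lintegral_mul_mul Q Qᵀ hdet hdet0 hFw, Matrix.det_transpose, hdet, one_pow,
    ENNReal.ofReal_one, one_mul]
  refine lintegral_congr fun X => ?_
  rw [Equiv.apply_symm_apply, weight_orthogonal_conj τ hQ]

lemma measurePreserving_orthogonal_conj {τ : ℝ} (hτ₀ : 0 ≤ τ) (hτ₁ : τ < 1)
    {Q : Matrix (Fin n) (Fin n) ℝ} (hQ : Qᵀ * Q = 1) :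
    MeasurePreserving (fun X : Fin n → Fin n → ℝ => Matrix.of.symm (Q * Matrix.of X * Qᵀ))
      (ensemble τ n) (ensemble τ n) := by
  have hm : Measurable fun X : Fin n → Fin n → ℝ => Matrix.of.symm (Q * Matrix.of X * Qᵀ) := by
    refine measurable_pi_lambda _ fun i => measurable_pi_lambda _ fun j => ?_
    simp only [Matrix.of_symm_apply, Matrix.mul_apply, Matrix.of_apply]
    fun_prop
  refine ⟨hm, Measure.ext_of_lintegral _ fun F hF => ?_⟩
  rw [lintegral_map hF hm, lintegral_ensemble hτ₀ hτ₁, lintegral_ensemble hτ₀ hτ₁,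
    lintegral_weight_orthogonal_conj hQ hF]

end Linear

/-! ### Functions with all moments -/

section Moments

variable {Ω Ω' : Type*} [MeasurableSpace Ω] [MeasurableSpace Ω'] {μ : Measure Ω} {ν : Measure Ω'}

/-- All absolute moments of `f` are finite. -/
def HasMoments (f : Ω → ℝ) (μ : Measure Ω) : Prop := ∀ p : ℝ≥0∞, p ≠ ∞ → MemLp f p μ

lemma HasMoments.integrable {f : Ω → ℝ} (hf : HasMoments f μ) : Integrable f μ :=
  memLp_one_iff_integrable.1 (hf 1 (by simp))

lemma hasMoments_const [IsFiniteMeasure μ] (c : ℝ) : HasMoments (fun _ => c) μ :=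
  fun _ _ => memLp_const c

lemma HasMoments.add {f g : Ω → ℝ} (hf : HasMoments f μ) (hg : HasMoments g μ) :
    HasMoments (fun x => f x + g x) μ := fun p hp => (hf p hp).add (hg p hp)

lemma HasMoments.sub {f g : Ω → ℝ} (hf : HasMoments f μ) (hg : HasMoments g μ) :
    HasMoments (fun x => f x - g x) μ := fun p hp => (hf p hp).sub (hg p hp)

lemma HasMoments.mul {f g : Ω → ℝ} (hf : HasMoments f μ) (hg : HasMoments g μ) :
    HasMoments (fun x => f x * g x) μ := fun p hp => by
  have h2 : (2 : ℝ≥0∞) * p ≠ ∞ := by finiteness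
  -- Cauchy–Schwarz: the `p`-th moment of a product is controlled by the moments of order `2p` of
  -- the factors.
  have : ENNReal.HolderTriple (2 * p) (2 * p) p := ⟨by
    rw [ENNReal.mul_inv (by simp) (by simp), ← add_mul, ENNReal.inv_two_add_inv_two, one_mul]⟩
  exact (hg _ h2).mul' (hf _ h2)

lemma HasMoments.sum {ι : Type*} (s : Finset ι) {f : ι → Ω → ℝ}
    (hf : ∀ i ∈ s, HasMoments (f i) μ) : HasMoments (fun x => ∑ i ∈ s, f i x) μ :=
  fun p hp => memLp_finsetSum s fun i hi => hf i hi p hp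

lemma HasMoments.prod [IsFiniteMeasure μ] {ι : Type*} (s : Finset ι) {f : ι → Ω → ℝ}
    (hf : ∀ i ∈ s, HasMoments (f i) μ) : HasMoments (fun x => ∏ i ∈ s, f i x) μ := by
  classical
  induction s using Finset.induction_on with
  | empty => simpa using hasMoments_const 1
  | insert a s ha ih =>
    simp only [Finset.prod_insert ha]
    exact (hf a (Finset.mem_insert_self a s)).mul
      (ih fun i hi => hf i (Finset.mem_insert_of_mem hi))

lemma HasMoments.const_mul [IsFiniteMeasure μ] {f : Ω → ℝ} (hf : HasMoments f μ) (c : ℝ) :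
    HasMoments (fun x => c * f x) μ := (hasMoments_const c).mul hf

lemma HasMoments.comp {f : Ω' → ℝ} (hf : HasMoments f ν) {φ : Ω → Ω'}
    (hφ : MeasurePreserving φ μ ν) : HasMoments (fun x => f (φ x)) μ :=
  fun p hp => (hf p hp).comp_measurePreserving hφ

lemma HasMoments.of_map {f : Ω' → ℝ} {φ : Ω → Ω'} (hφ : MeasurePreserving φ μ ν)
    (hf : HasMoments (fun x => f (φ x)) μ) (hfm : Measurable f) : HasMoments f ν := fun p hp => by
  rw [← hφ.map_eq, memLp_map_measure_iff hfm.aestronglyMeasurable hφ.aemeasurable]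
  exact hf p hp

lemma HasMoments.dotProduct {n : ℕ} {v w : Ω → Fin n → ℝ}
    (hv : ∀ i, HasMoments (fun x => v x i) μ) (hw : ∀ i, HasMoments (fun x => w x i) μ) :
    HasMoments (fun x => v x ⬝ᵥ w x) μ :=
  HasMoments.sum _ fun i _ => (hv i).mul (hw i)

lemma HasMoments.mulVec {n : ℕ} {M : Ω → Matrix (Fin n) (Fin n) ℝ} {v : Ω → Fin n → ℝ}
    (hM : ∀ i j, HasMoments (fun x => M x i j) μ) (hv : ∀ i, HasMoments (fun x => v x i) μ)
    (i : Fin n) : HasMoments (fun x => (M x *ᵥ v x) i) μ := by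
  simp only [Matrix.mulVec]
  exact HasMoments.sum _ fun j _ => (hM i j).mul (hv j)

lemma HasMoments.trace_mul {n : ℕ} {M M' : Ω → Matrix (Fin n) (Fin n) ℝ}
    (hM : ∀ i j, HasMoments (fun x => M x i j) μ) (hM' : ∀ i j, HasMoments (fun x => M' x i j) μ) :
    HasMoments (fun x => (M x * M' x).trace) μ := by
  simp only [Matrix.trace, Matrix.diag, Matrix.mul_apply]
  exact HasMoments.sum _ fun i _ => HasMoments.sum _ fun j _ => (hM i j).mul (hM' j i)

lemma hasMoments_gaussianReal : HasMoments (fun x => x) (gaussianReal 0 1) :=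
  fun p hp => memLp_id_gaussianReal' p hp

lemma hasMoments_stdGauss {n : ℕ} (i : Fin n) : HasMoments (fun g => g i) (stdGauss n) :=
  hasMoments_gaussianReal.comp (measurePreserving_eval (fun _ : Fin n => gaussianReal 0 1) i)

end Moments

/-! ### Gaussian moments -/

section Gaussian

lemma integrable_pow_gaussianReal (k : ℕ) : Integrable (fun x : ℝ => x ^ k) (gaussianReal 0 1) := by
  have h : HasMoments (fun x : ℝ => ∏ _i ∈ Finset.range k, x) (gaussianReal 0 1) :=
    HasMoments.prod _ fun _ _ => hasMoments_gaussianReal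
  simpa using h.integrable

lemma integral_pow_two_gaussianReal : ∫ x, x ^ 2 ∂gaussianReal 0 1 = 1 := by
  have h := variance_fun_id_gaussianReal (μ := 0) (v := 1)
  rw [variance_eq_integral (by fun_prop)] at h
  simpa [integral_id_gaussianReal] using h

lemma integral_pow_odd_gaussianReal {k : ℕ} (hk : Odd k) : ∫ x, x ^ k ∂gaussianReal 0 1 = 0 := by
  have hmap : MeasurePreserving (fun x : ℝ => -x) (gaussianReal 0 1) (gaussianReal 0 1) :=
    ⟨by fun_prop, by rw [gaussianReal_map_neg, neg_zero]⟩
  have h := hmap.integral_comp (MeasurableEquiv.neg ℝ).measurableEmbedding (fun x : ℝ => x ^ k)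
  simp only [hk.neg_pow, integral_neg] at h
  linarith

/-- The sum of two independent standard Gaussians is distributed as `√2` times one of them.
Comparing fourth moments gives `4 m = 2 m + 6`. -/
lemma integral_pow_four_gaussianReal : ∫ x, x ^ 4 ∂gaussianReal 0 1 = 3 := by
  set m := ∫ x, x ^ 4 ∂gaussianReal 0 1 with hm
  have hint (k : ℕ) := integrable_pow_gaussianReal k
  have hmap : (gaussianReal 0 1).map (√2 * ·) = gaussianReal 0 1 ∗ gaussianReal 0 1 := by
    rw [gaussianReal_conv_gaussianReal, gaussianReal_map_const_mul]
    congr 1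
    · simp
    · ext
      norm_num
  have h1 : ∫ x, x ^ 4 ∂(gaussianReal 0 1 ∗ gaussianReal 0 1) = 4 * m := by
    rw [← hmap, integral_map (by fun_prop) (by fun_prop), hm, ← integral_const_mul]
    congr 1
    funext x
    rw [mul_pow, show √2 ^ 4 = (√2 ^ 2) ^ 2 by ring, Real.sq_sqrt (by norm_num)]
    norm_num
  have hint4 : Integrable (fun x : ℝ => x ^ 4) (gaussianReal 0 1 ∗ gaussianReal 0 1) := by
    rw [← hmap, integrable_map_measure (by fun_prop) (by fun_prop)]
    simp only [Function.comp_def, mul_pow]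
    exact (hint 4).const_mul _
  have h2 (x : ℝ) : ∫ y, (x + y) ^ 4 ∂gaussianReal 0 1 = x ^ 4 + 6 * x ^ 2 + m := by
    have hexp (y : ℝ) : (x + y) ^ 4
        = x ^ 4 + (4 * x ^ 3 * y ^ 1 + (6 * x ^ 2 * y ^ 2 + (4 * x * y ^ 3 + y ^ 4))) := by ring
    simp only [hexp]
    rw [integral_add (integrable_const _) (by fun_prop), integral_add (by fun_prop) (by fun_prop),
      integral_add (by fun_prop) (by fun_prop), integral_add (by fun_prop) (by fun_prop),
      integral_const_mul, integral_const_mul, integral_const_mul,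
      integral_pow_odd_gaussianReal (k := 1) (by decide),
      integral_pow_odd_gaussianReal (k := 3) (by decide), integral_pow_two_gaussianReal]
    simp [hm]
    ring
  rw [integral_conv hint4] at h1
  simp only [h2] at h1
  rw [integral_add (by fun_prop) (by fun_prop), integral_add (by fun_prop) (by fun_prop),
    integral_const_mul, integral_pow_two_gaussianReal, ← hm] at h1
  simp at h1
  linarith

variable {n : ℕ}

lemma integral_mul_stdGauss_eq_prod (e : Fin n → ℕ) :
    ∫ g, ∏ p, g p ^ e p ∂stdGauss n = ∏ p, ∫ x, x ^ e p ∂gaussianReal 0 1 :=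
  integral_fintype_prod_eq_prod (fun p x => x ^ e p)

lemma integral_stdGauss_apply (i : Fin n) : ∫ g, g i ∂stdGauss n = 0 := by
  have h := integral_mul_stdGauss_eq_prod (n := n) (Pi.single i 1)
  have hp (g : Fin n → ℝ) : ∏ p, g p ^ (Pi.single i 1 : Fin n → ℕ) p = g i := by
    rw [Finset.prod_eq_single i] <;> simp +contextual
  simp only [hp] at h
  rw [h]
  refine Finset.prod_eq_zero (Finset.mem_univ i) ?_
  simp

lemma integral_stdGauss_mul_apply (i j : Fin n) :
    ∫ g, g i * g j ∂stdGauss n = if i = j then 1 else 0 := by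
  have h := integral_mul_stdGauss_eq_prod (n := n) (Pi.single i 1 + Pi.single j 1)
  have hp (g : Fin n → ℝ) (i : Fin n) : ∏ p, g p ^ (Pi.single i 1 : Fin n → ℕ) p = g i := by
    rw [Finset.prod_eq_single i] <;> simp +contextual
  simp only [Pi.add_apply, pow_add, Finset.prod_mul_distrib, hp] at h
  rw [h]
  split_ifs with hij
  · subst hij
    rw [Finset.prod_eq_single i]
    · simp only [Pi.single_eq_same]
      simpa [pow_two] using integral_pow_two_gaussianReal
    · intro p _ hp
      simp [hp]
    · simp
  · refine Finset.prod_eq_zero (Finset.mem_univ i) ?_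
    simp [hij]

/-- Wick's formula of order four. -/
lemma integral_stdGauss_wick_four (i j k l : Fin n) :
    ∫ g, g i * g j * (g k * g l) ∂stdGauss n
      = (if i = j then 1 else 0) * (if k = l then 1 else 0)
        + (if i = k then 1 else 0) * (if j = l then 1 else 0)
        + (if i = l then 1 else 0) * (if j = k then 1 else 0) := by
  set e : Fin n → ℕ := Pi.single i 1 + Pi.single j 1 + (Pi.single k 1 + Pi.single l 1) with he
  have h := integral_mul_stdGauss_eq_prod (n := n) e
  have hp (g : Fin n → ℝ) (i : Fin n) : ∏ p, g p ^ (Pi.single i 1 : Fin n → ℕ) p = g i := by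
    rw [Finset.prod_eq_single i] <;> simp +contextual
  have hlhs (g : Fin n → ℝ) : ∏ p, g p ^ e p = g i * g j * (g k * g l) := by
    simp only [he, Pi.add_apply, pow_add, Finset.prod_mul_distrib, hp]
  simp only [hlhs] at h
  rw [h]
  -- The exponent `e p` counts how often the index `p` occurs. An index occurring exactly once makes
  -- the mean vanish; otherwise all four indices coincide (moment `3`) or they form two distinct
  -- pairs (moment `1`).
  have hone (p : Fin n) (hp : e p = 1) : ∏ p, ∫ x, x ^ e p ∂gaussianReal 0 1 = 0 :=
    Finset.prod_eq_zero (Finset.mem_univ p)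
      (by rw [hp]; exact integral_pow_odd_gaussianReal (by decide))
  have hfour (p : Fin n) (hp : ∀ q, e q = if q = p then 4 else 0) :
      ∏ p, ∫ x, x ^ e p ∂gaussianReal 0 1 = 3 := by
    rw [Finset.prod_eq_single p]
    · rw [hp p, if_pos rfl, integral_pow_four_gaussianReal]
    · intro q _ hq
      simp [hp q, hq]
    · simp
  have htwo (p q : Fin n) (hpq : p ≠ q) (hp : ∀ r, e r = if r = p then 2 else if r = q then 2 else 0) :
      ∏ p, ∫ x, x ^ e p ∂gaussianReal 0 1 = 1 := by
    refine Finset.prod_eq_one fun r _ => ?_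
    rw [hp r]
    split_ifs <;> simp [integral_pow_two_gaussianReal]
  have hev (p : Fin n) : e p = (if p = i then 1 else 0) + (if p = j then 1 else 0)
      + ((if p = k then 1 else 0) + (if p = l then 1 else 0)) := by
    simp [he, Pi.single_apply]
  by_cases hij : i = j
  · by_cases hkl : k = l
    · subst hij hkl
      by_cases hik : i = k
      · subst hik
        rw [hfour i fun q => by rw [hev]; split_ifs <;> rfl]
        norm_num
      · rw [htwo i k hik fun r => by rw [hev]; split_ifs <;> simp_all]
        simp [hik]
    · subst hij
      by_cases hik : i = k
      · subst hik
        rw [hone l (by rw [hev]; simp [Ne.symm hkl])]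
        simp [hkl]
      · rw [hone k (by rw [hev]; simp [Ne.symm hik, hkl])]
        simp [hik, hkl]
  · by_cases hik : i = k
    · subst hik
      by_cases hjl : j = l
      · subst hjl
        rw [htwo i j hij fun r => by rw [hev]; split_ifs <;> simp_all]
        simp [hij]
      · rw [hone j (by rw [hev]; simp [Ne.symm hij, hjl])]
        simp [hij, hjl, Ne.symm hij]
    · by_cases hil : i = l
      · subst hil
        by_cases hjk : j = k
        · subst hjk
          rw [htwo i j hij fun r => by rw [hev]; split_ifs <;> simp_all]
          simp [hij]
        · rw [hone j (by rw [hev]; simp [Ne.symm hij, hjk])]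
          simp [hij, hjk, hik]
      · rw [hone i (by rw [hev]; simp [hij, hik, hil])]
        simp [hij, hik, hil]

lemma integral_dotProduct (w : Fin n → ℝ) : ∫ g, w ⬝ᵥ g ∂stdGauss n = 0 := by
  simp only [dotProduct]
  rw [integral_finsetSum _ fun i _ => ((hasMoments_stdGauss i).const_mul _).integrable]
  simp [integral_const_mul, integral_stdGauss_apply]

lemma integral_dotProduct_mul_dotProduct (w w' : Fin n → ℝ) :
    ∫ g, (w ⬝ᵥ g) * (w' ⬝ᵥ g) ∂stdGauss n = w ⬝ᵥ w' := by
  have he (g : Fin n → ℝ) : (w ⬝ᵥ g) * (w' ⬝ᵥ g)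
      = ∑ i, ∑ j, w i * w' j * (g i * g j) := by
    simp only [dotProduct, Finset.sum_mul_sum]
    refine Finset.sum_congr rfl fun i _ => Finset.sum_congr rfl fun j _ => ?_
    ring
  have hm (i j : Fin n) : HasMoments (fun g : Fin n → ℝ => w i * w' j * (g i * g j)) (stdGauss n) :=
    ((hasMoments_stdGauss i).mul (hasMoments_stdGauss j)).const_mul _
  simp only [he]
  rw [integral_finsetSum _ fun i _ => (HasMoments.sum _ fun j _ => hm i j).integrable]
  simp only [integral_finsetSum _ fun j _ => (hm _ j).integrable, integral_const_mul,
    integral_stdGauss_mul_apply, dotProduct]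
  simp

lemma integral_quadratic (A : Matrix (Fin n) (Fin n) ℝ) :
    ∫ g, g ⬝ᵥ (A *ᵥ g) ∂stdGauss n = A.trace := by
  have he (g : Fin n → ℝ) : g ⬝ᵥ (A *ᵥ g) = ∑ i, ∑ j, A i j * (g i * g j) := by
    simp only [dotProduct, Matrix.mulVec, Finset.mul_sum]
    refine Finset.sum_congr rfl fun i _ => Finset.sum_congr rfl fun j _ => ?_
    ring
  have hm (i j : Fin n) : HasMoments (fun g : Fin n → ℝ => A i j * (g i * g j)) (stdGauss n) :=
    ((hasMoments_stdGauss i).mul (hasMoments_stdGauss j)).const_mul _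
  simp only [he]
  rw [integral_finsetSum _ fun i _ => (HasMoments.sum _ fun j _ => hm i j).integrable]
  simp only [integral_finsetSum _ fun j _ => (hm _ j).integrable, integral_const_mul,
    integral_stdGauss_mul_apply, Matrix.trace, Matrix.diag]
  simp

/-- The three pairings in Wick's formula give `Tr A Tr B`, `Tr (A Bᵀ)` and `Tr (A B)`. -/
lemma integral_quadratic_mul_quadratic (A B : Matrix (Fin n) (Fin n) ℝ) :
    ∫ g, (g ⬝ᵥ (A *ᵥ g)) * (g ⬝ᵥ (B *ᵥ g)) ∂stdGauss n
      = A.trace * B.trace + (A * B).trace + (A * Bᵀ).trace := by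
  have he (A : Matrix (Fin n) (Fin n) ℝ) (g : Fin n → ℝ) :
      g ⬝ᵥ (A *ᵥ g) = ∑ p : Fin n × Fin n, A p.1 p.2 * (g p.1 * g p.2) := by
    simp only [dotProduct, Matrix.mulVec, Finset.mul_sum, Fintype.sum_prod_type]
    refine Finset.sum_congr rfl fun i _ => Finset.sum_congr rfl fun j _ => ?_
    ring
  have he2 (g : Fin n → ℝ) : (g ⬝ᵥ (A *ᵥ g)) * (g ⬝ᵥ (B *ᵥ g))
      = ∑ p : Fin n × Fin n, ∑ q : Fin n × Fin n,
        A p.1 p.2 * B q.1 q.2 * (g p.1 * g p.2 * (g q.1 * g q.2)) := by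
    rw [he, he, Finset.sum_mul_sum]
    refine Finset.sum_congr rfl fun i _ => Finset.sum_congr rfl fun j _ => ?_
    ring
  have hm (p q : Fin n × Fin n) : HasMoments (fun g : Fin n → ℝ =>
      A p.1 p.2 * B q.1 q.2 * (g p.1 * g p.2 * (g q.1 * g q.2))) (stdGauss n) :=
    (((hasMoments_stdGauss _).mul (hasMoments_stdGauss _)).mul
      ((hasMoments_stdGauss _).mul (hasMoments_stdGauss _))).const_mul _
  simp only [he2]
  rw [integral_finsetSum _ fun i _ => (HasMoments.sum _ fun j _ => hm i j).integrable]
  have hw (p : Fin n × Fin n) : ∫ g, ∑ q : Fin n × Fin n,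
        A p.1 p.2 * B q.1 q.2 * (g p.1 * g p.2 * (g q.1 * g q.2)) ∂stdGauss n
      = ∑ q : Fin n × Fin n, A p.1 p.2 * B q.1 q.2
        * ((if p.1 = p.2 then 1 else 0) * (if q.1 = q.2 then 1 else 0)
        + (if p.1 = q.1 then 1 else 0) * (if p.2 = q.2 then 1 else 0)
        + (if p.1 = q.2 then 1 else 0) * (if p.2 = q.1 then 1 else 0)) := by
    rw [integral_finsetSum _ fun j _ => (hm _ j).integrable]
    refine Finset.sum_congr rfl fun q _ => ?_
    rw [integral_const_mul, integral_stdGauss_wick_four]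
  rw [Finset.sum_congr rfl fun p _ => hw p]
  simp only [mul_add, Finset.sum_add_distrib, Fintype.sum_prod_type]
  have h1 : ∑ x, ∑ y, ∑ z, ∑ w, A x y * B z w * ((if x = y then 1 else 0) * (if z = w then 1 else 0))
      = A.trace * B.trace := by
    simp [Matrix.trace, Finset.sum_mul_sum]
  have h2 : ∑ x, ∑ y, ∑ z, ∑ w, A x y * B z w * ((if x = z then 1 else 0) * (if y = w then 1 else 0))
      = (A * Bᵀ).trace := by
    simp [Matrix.trace, Matrix.mul_apply]
  have h3 : ∑ x, ∑ y, ∑ z, ∑ w, A x y * B z w * ((if x = w then 1 else 0) * (if y = z then 1 else 0))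
      = (A * B).trace := by
    simp [Matrix.trace, Matrix.mul_apply]
  rw [h1, h2, h3]
  ring

/-- The law of the three independent Gaussian blocks in the border of a matrix. -/
def borderGauss (n : ℕ) : Measure (ℝ × (Fin n → ℝ) × (Fin n → ℝ)) :=
  (gaussianReal 0 1).prod ((stdGauss n).prod (stdGauss n))

instance : IsProbabilityMeasure (borderGauss n) := by unfold borderGauss; infer_instance

lemma hasMoments_borderGauss_fst : HasMoments (fun p => p.1) (borderGauss n) :=
  hasMoments_gaussianReal.comp measurePreserving_fst

lemma hasMoments_borderGauss_snd (i : Fin n) : HasMoments (fun p => p.2.1 i) (borderGauss n) :=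
  (hasMoments_stdGauss i).comp (measurePreserving_fst.comp measurePreserving_snd)

lemma hasMoments_borderGauss_thd (i : Fin n) : HasMoments (fun p => p.2.2 i) (borderGauss n) :=
  (hasMoments_stdGauss i).comp (measurePreserving_snd.comp measurePreserving_snd)

/-- The determinant of a bordered matrix with Gaussian border, in terms of the determinant `D` and
the adjugate `A` of its inner block. -/
def borderForm (m s α β D : ℝ) (A : Matrix (Fin n) (Fin n) ℝ)
    (p : ℝ × (Fin n → ℝ) × (Fin n → ℝ)) : ℝ :=
  (m + s * p.1) * D - (α * (p.2.1 ⬝ᵥ (A *ᵥ p.2.1)) + β * (p.2.1 ⬝ᵥ (A *ᵥ p.2.2)))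

lemma hasMoments_borderForm (m s α β D : ℝ) (A : Matrix (Fin n) (Fin n) ℝ) :
    HasMoments (borderForm m s α β D A) (borderGauss n) := by
  have h1 : HasMoments (fun p => p.1) (borderGauss n) := hasMoments_borderGauss_fst
  have h2 := hasMoments_borderGauss_snd (n := n)
  have h3 := hasMoments_borderGauss_thd (n := n)
  have hA (i j : Fin n) : HasMoments (fun _ => A i j) (borderGauss n) := hasMoments_const _
  have e1 := ((hasMoments_const m).add (h1.const_mul s)).mul (hasMoments_const D)
  have e2 := (HasMoments.dotProduct h2 (HasMoments.mulVec hA h2)).const_mul α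
  have e3 := (HasMoments.dotProduct h2 (HasMoments.mulVec hA h3)).const_mul β
  exact e1.sub (e2.add e3)

/-- For fixed `u` the form is affine in the last block, whose covariance yields `u ⬝ᵥ (A₁ A₂ᵀ u)`;
the remaining quadratic forms in `u` are averaged by Wick's formula, and the scalar is averaged
last. -/
lemma integral_borderForm_mul_borderForm (m₁ m₂ s α β D₁ D₂ : ℝ)
    (A₁ A₂ : Matrix (Fin n) (Fin n) ℝ) :
    ∫ p, borderForm m₁ s α β D₁ A₁ p * borderForm m₂ s α β D₂ A₂ p ∂borderGauss n
      = (m₁ * m₂ + s ^ 2) * (D₁ * D₂) - α * (m₁ * (D₁ * A₂.trace) + m₂ * (D₂ * A₁.trace))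
        + α ^ 2 * (A₁.trace * A₂.trace + (A₁ * A₂).trace + (A₁ * A₂ᵀ).trace)
        + β ^ 2 * (A₁ * A₂ᵀ).trace := by
  have hint := ((hasMoments_borderForm m₁ s α β D₁ A₁).mul
    (hasMoments_borderForm m₂ s α β D₂ A₂)).integrable
  have hcoord := hasMoments_stdGauss (n := n)
  have hA (A : Matrix (Fin n) (Fin n) ℝ) (i j : Fin n) : HasMoments (fun _ => A i j) (stdGauss n) :=
    hasMoments_const _
  have hquad (A : Matrix (Fin n) (Fin n) ℝ) :
      HasMoments (fun u : Fin n → ℝ => u ⬝ᵥ (A *ᵥ u)) (stdGauss n) :=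
    HasMoments.dotProduct hcoord (HasMoments.mulVec (hA A) hcoord)
  have hlin (w : Fin n → ℝ) : HasMoments (fun g : Fin n → ℝ => w ⬝ᵥ g) (stdGauss n) :=
    HasMoments.dotProduct (fun i => hasMoments_const (w i)) hcoord
  -- integration over the third block
  have h3 (x : ℝ) (u : Fin n → ℝ) :
      ∫ g, borderForm m₁ s α β D₁ A₁ (x, u, g) * borderForm m₂ s α β D₂ A₂ (x, u, g) ∂stdGauss n
        = ((m₁ + s * x) * D₁ - α * (u ⬝ᵥ (A₁ *ᵥ u))) * ((m₂ + s * x) * D₂ - α * (u ⬝ᵥ (A₂ *ᵥ u)))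
          + β ^ 2 * (u ⬝ᵥ ((A₁ * A₂ᵀ) *ᵥ u)) := by
    set c₁ := (m₁ + s * x) * D₁ - α * (u ⬝ᵥ (A₁ *ᵥ u))
    set c₂ := (m₂ + s * x) * D₂ - α * (u ⬝ᵥ (A₂ *ᵥ u))
    have he (g : Fin n → ℝ) :
        borderForm m₁ s α β D₁ A₁ (x, u, g) * borderForm m₂ s α β D₂ A₂ (x, u, g)
          = c₁ * c₂ + (-(c₁ * β) * ((u ᵥ* A₂) ⬝ᵥ g) + (-(c₂ * β) * ((u ᵥ* A₁) ⬝ᵥ g)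
            + β ^ 2 * (((u ᵥ* A₁) ⬝ᵥ g) * ((u ᵥ* A₂) ⬝ᵥ g)))) := by
      simp only [borderForm, Matrix.dotProduct_mulVec, c₁, c₂]
      ring
    simp only [he]
    have i1 := ((hlin (u ᵥ* A₂)).const_mul (-(c₁ * β)))
    have i2 := ((hlin (u ᵥ* A₁)).const_mul (-(c₂ * β)))
    have i3 := (((hlin (u ᵥ* A₁)).mul (hlin (u ᵥ* A₂))).const_mul (β ^ 2))
    rw [integral_add (integrable_const _) (i1.add (i2.add i3)).integrable,
      integral_add i1.integrable (i2.add i3).integrable, integral_add i2.integrable i3.integrable, integral_const, integral_const_mul, integral_const_mul, integral_const_mul,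
      integral_dotProduct, integral_dotProduct, integral_dotProduct_mul_dotProduct]
    have hq : (u ᵥ* A₁) ⬝ᵥ (u ᵥ* A₂) = u ⬝ᵥ ((A₁ * A₂ᵀ) *ᵥ u) := by
      rw [← Matrix.mulVec_mulVec, Matrix.dotProduct_mulVec, Matrix.mulVec_transpose]
    rw [hq]
    simp
  -- integration over the second block
  have h2 (x : ℝ) :
      ∫ u, (((m₁ + s * x) * D₁ - α * (u ⬝ᵥ (A₁ *ᵥ u))) * ((m₂ + s * x) * D₂ - α * (u ⬝ᵥ (A₂ *ᵥ u)))
          + β ^ 2 * (u ⬝ᵥ ((A₁ * A₂ᵀ) *ᵥ u))) ∂stdGauss n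
        = (m₁ + s * x) * D₁ * ((m₂ + s * x) * D₂) - α * ((m₁ + s * x) * (D₁ * A₂.trace)
            + (m₂ + s * x) * (D₂ * A₁.trace))
          + α ^ 2 * (A₁.trace * A₂.trace + (A₁ * A₂).trace + (A₁ * A₂ᵀ).trace)
          + β ^ 2 * (A₁ * A₂ᵀ).trace := by
    set c₁ := (m₁ + s * x) * D₁ with hc₁
    set c₂ := (m₂ + s * x) * D₂ with hc₂
    have he (u : Fin n → ℝ) :
        (c₁ - α * (u ⬝ᵥ (A₁ *ᵥ u))) * (c₂ - α * (u ⬝ᵥ (A₂ *ᵥ u)))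
          + β ^ 2 * (u ⬝ᵥ ((A₁ * A₂ᵀ) *ᵥ u))
        = c₁ * c₂ + (-(c₁ * α) * (u ⬝ᵥ (A₂ *ᵥ u)) + (-(c₂ * α) * (u ⬝ᵥ (A₁ *ᵥ u))
          + (α ^ 2 * ((u ⬝ᵥ (A₁ *ᵥ u)) * (u ⬝ᵥ (A₂ *ᵥ u)))
            + β ^ 2 * (u ⬝ᵥ ((A₁ * A₂ᵀ) *ᵥ u))))) := by ring
    simp only [he]
    have i1 := ((hquad A₂).const_mul (-(c₁ * α)))
    have i2 := ((hquad A₁).const_mul (-(c₂ * α)))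
    have i3 := (((hquad A₁).mul (hquad A₂)).const_mul (α ^ 2))
    have i4 := ((hquad (A₁ * A₂ᵀ)).const_mul (β ^ 2))
    rw [integral_add (integrable_const _) (i1.add (i2.add (i3.add i4))).integrable,
      integral_add i1.integrable (i2.add (i3.add i4)).integrable,
      integral_add i2.integrable (i3.add i4).integrable, integral_add i3.integrable i4.integrable,
      integral_const,
      integral_const_mul, integral_const_mul, integral_const_mul, integral_const_mul,
      integral_quadratic, integral_quadratic, integral_quadratic, integral_quadratic_mul_quadratic]
    simp only [probReal_univ, smul_eq_mul, one_mul, hc₁, hc₂]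
    ring
  have hint' := hint
  rw [borderGauss] at hint' ⊢
  rw [integral_prod _ hint']
  -- Fubini's theorem provides integrability of the slices only for almost every `x`.
  have h23 : ∀ᵐ x ∂gaussianReal 0 1,
      ∫ q, borderForm m₁ s α β D₁ A₁ (x, q) * borderForm m₂ s α β D₂ A₂ (x, q)
        ∂((stdGauss n).prod (stdGauss n))
        = (m₁ + s * x) * D₁ * ((m₂ + s * x) * D₂) - α * ((m₁ + s * x) * (D₁ * A₂.trace)
            + (m₂ + s * x) * (D₂ * A₁.trace))
          + α ^ 2 * (A₁.trace * A₂.trace + (A₁ * A₂).trace + (A₁ * A₂ᵀ).trace)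
          + β ^ 2 * (A₁ * A₂ᵀ).trace := by
    filter_upwards [hint'.prod_right_ae] with x hx
    rw [integral_prod _ hx]
    simp only [h3, h2]
  rw [integral_congr_ae h23]
  set K₂ := s * (m₁ + m₂) * (D₁ * D₂) - α * s * (D₁ * A₂.trace + D₂ * A₁.trace)
  set K₃ := m₁ * m₂ * (D₁ * D₂) - α * (m₁ * (D₁ * A₂.trace) + m₂ * (D₂ * A₁.trace))
        + α ^ 2 * (A₁.trace * A₂.trace + (A₁ * A₂).trace + (A₁ * A₂ᵀ).trace)
        + β ^ 2 * (A₁ * A₂ᵀ).trace with hK₃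
  have he (x : ℝ) : (m₁ + s * x) * D₁ * ((m₂ + s * x) * D₂) - α * ((m₁ + s * x) * (D₁ * A₂.trace)
            + (m₂ + s * x) * (D₂ * A₁.trace))
          + α ^ 2 * (A₁.trace * A₂.trace + (A₁ * A₂).trace + (A₁ * A₂ᵀ).trace)
          + β ^ 2 * (A₁ * A₂ᵀ).trace = s ^ 2 * (D₁ * D₂) * x ^ 2 + (K₂ * x ^ 1 + K₃) := by
    simp only [K₂, K₃]
    ring
  simp only [he]
  have j1 := (integrable_pow_gaussianReal 2).const_mul (s ^ 2 * (D₁ * D₂))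
  have j2 := (integrable_pow_gaussianReal 1).const_mul K₂
  rw [integral_add j1 (by fun_prop), integral_add j2 (integrable_const _),
    integral_const_mul, integral_const_mul, integral_pow_two_gaussianReal,
    integral_pow_odd_gaussianReal (by decide)]
  simp only [integral_const, probReal_univ, smul_eq_mul, one_mul, hK₃]
  ring

end Gaussian

/-! ### Parametrized functions with locally uniform moments -/

section Tame

variable {Ω : Type*} [MeasurableSpace Ω] {μ : Measure Ω}

/-- A family of functions with all moments, continuous in the parameter and locally dominated by
functions with all moments. -/
structure Tame (f : ℝ → Ω → ℝ) (μ : Measure Ω) : Prop where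
  continuous : ∀ ω, Continuous fun y => f y ω
  moments : ∀ y, HasMoments (f y) μ
  bound : ∀ R : ℝ, ∃ b : Ω → ℝ, HasMoments b μ ∧ ∀ y, |y| ≤ R → ∀ ω, |f y ω| ≤ b ω

lemma HasMoments.abs {f : Ω → ℝ} (hf : HasMoments f μ) : HasMoments (fun x => |f x|) μ :=
  fun p hp => (hf p hp).abs

lemma HasMoments.tame {f : Ω → ℝ} (hf : HasMoments f μ) : Tame (fun _ => f) μ :=
  ⟨fun _ => continuous_const, fun _ => hf, fun _ => ⟨_, hf.abs, fun _ _ _ => le_rfl⟩⟩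

lemma tame_id [IsFiniteMeasure μ] : Tame (fun y (_ : Ω) => y) μ :=
  ⟨fun _ => continuous_id, fun y => hasMoments_const y,
    fun R => ⟨fun _ => R, hasMoments_const R, fun _ hy _ => hy⟩⟩

lemma tame_const [IsFiniteMeasure μ] (c : ℝ) : Tame (fun _ (_ : Ω) => c) μ :=
  (hasMoments_const c).tame

lemma Tame.add {f g : ℝ → Ω → ℝ} (hf : Tame f μ) (hg : Tame g μ) :
    Tame (fun y ω => f y ω + g y ω) μ := by
  refine ⟨fun ω => (hf.continuous ω).add (hg.continuous ω),
    fun y => (hf.moments y).add (hg.moments y), fun R => ?_⟩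
  obtain ⟨b, hb, hfb⟩ := hf.bound R
  obtain ⟨c, hc, hgc⟩ := hg.bound R
  exact ⟨_, hb.add hc, fun y hy ω =>
    (abs_add_le _ _).trans (add_le_add (hfb y hy ω) (hgc y hy ω))⟩

lemma Tame.mul {f g : ℝ → Ω → ℝ} (hf : Tame f μ) (hg : Tame g μ) :
    Tame (fun y ω => f y ω * g y ω) μ := by
  refine ⟨fun ω => (hf.continuous ω).mul (hg.continuous ω),
    fun y => (hf.moments y).mul (hg.moments y), fun R => ?_⟩
  obtain ⟨b, hb, hfb⟩ := hf.bound R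
  obtain ⟨c, hc, hgc⟩ := hg.bound R
  refine ⟨_, hb.mul hc, fun y hy ω => ?_⟩
  rw [abs_mul]
  exact mul_le_mul (hfb y hy ω) (hgc y hy ω) (abs_nonneg _) ((abs_nonneg _).trans (hfb y hy ω))

lemma Tame.const_mul [IsFiniteMeasure μ] {f : ℝ → Ω → ℝ} (hf : Tame f μ) (c : ℝ) :
    Tame (fun y ω => c * f y ω) μ := (tame_const c).mul hf

lemma Tame.sub [IsFiniteMeasure μ] {f g : ℝ → Ω → ℝ} (hf : Tame f μ) (hg : Tame g μ) :
    Tame (fun y ω => f y ω - g y ω) μ := by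
  simpa [sub_eq_add_neg] using hf.add (hg.const_mul (-1))

lemma Tame.sum [IsFiniteMeasure μ] {ι : Type*} (s : Finset ι) {f : ι → ℝ → Ω → ℝ}
    (hf : ∀ i ∈ s, Tame (f i) μ) : Tame (fun y ω => ∑ i ∈ s, f i y ω) μ := by
  classical
  induction s using Finset.induction_on with
  | empty => simpa using tame_const 0
  | insert a s ha ih =>
    simp only [Finset.sum_insert ha]
    exact (hf a (Finset.mem_insert_self a s)).add
      (ih fun i hi => hf i (Finset.mem_insert_of_mem hi))

lemma Tame.prod [IsFiniteMeasure μ] {ι : Type*} (s : Finset ι) {f : ι → ℝ → Ω → ℝ}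
    (hf : ∀ i ∈ s, Tame (f i) μ) : Tame (fun y ω => ∏ i ∈ s, f i y ω) μ := by
  classical
  induction s using Finset.induction_on with
  | empty => simpa using tame_const 1
  | insert a s ha ih =>
    simp only [Finset.prod_insert ha]
    exact (hf a (Finset.mem_insert_self a s)).mul
      (ih fun i hi => hf i (Finset.mem_insert_of_mem hi))

lemma Tame.det [IsFiniteMeasure μ] {n : ℕ} {M : ℝ → Ω → Matrix (Fin n) (Fin n) ℝ}
    (hM : ∀ i j, Tame (fun y ω => M y ω i j) μ) : Tame (fun y ω => (M y ω).det) μ := by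
  simp only [Matrix.det_apply']
  exact Tame.sum _ fun σ _ => (Tame.prod _ fun i _ => hM _ _).const_mul _

lemma Tame.adjugate [IsFiniteMeasure μ] {n : ℕ} {M : ℝ → Ω → Matrix (Fin n) (Fin n) ℝ}
    (hM : ∀ i j, Tame (fun y ω => M y ω i j) μ) (i j : Fin n) :
    Tame (fun y ω => (M y ω).adjugate i j) μ := by
  simp only [Matrix.adjugate_apply]
  refine Tame.det fun k l => ?_
  by_cases h : k = j
  · subst h
    simpa using tame_const _
  · simpa [Matrix.updateRow_ne h] using hM k l

lemma Tame.trace [IsFiniteMeasure μ] {n : ℕ} {M : ℝ → Ω → Matrix (Fin n) (Fin n) ℝ}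
    (hM : ∀ i j, Tame (fun y ω => M y ω i j) μ) : Tame (fun y ω => (M y ω).trace) μ := by
  simp only [Matrix.trace, Matrix.diag]
  exact Tame.sum _ fun i _ => hM i i

lemma Tame.trace_mul [IsFiniteMeasure μ] {n : ℕ} {M M' : ℝ → Ω → Matrix (Fin n) (Fin n) ℝ}
    (hM : ∀ i j, Tame (fun y ω => M y ω i j) μ) (hM' : ∀ i j, Tame (fun y ω => M' y ω i j) μ) :
    Tame (fun y ω => (M y ω * M' y ω).trace) μ := by
  simp only [Matrix.trace, Matrix.diag, Matrix.mul_apply]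
  exact Tame.sum _ fun i _ => Tame.sum _ fun j _ => (hM i j).mul (hM' j i)

lemma Tame.continuous_integral {f : ℝ → Ω → ℝ} (hf : Tame f μ) :
    Continuous fun y => ∫ ω, f y ω ∂μ := by
  refine continuous_iff_continuousAt.2 fun y₀ => ?_
  obtain ⟨b, hb, hfb⟩ := hf.bound (|y₀| + 1)
  refine continuousAt_of_dominated (bound := b)
    (Eventually.of_forall fun y => (hf.moments y).integrable.aestronglyMeasurable) ?_
    hb.integrable (ae_of_all _ fun ω => (hf.continuous ω).continuousAt)
  have : ∀ᶠ y in 𝓝 y₀, |y| ≤ |y₀| + 1 :=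
    (continuous_abs.tendsto y₀).eventually_le_const (by linarith)
  filter_upwards [this] with y hy using ae_of_all _ (hfb y hy)

lemma Tame.hasDerivAt_integral {f f' : ℝ → Ω → ℝ} (hf : Tame f μ) (hf' : Tame f' μ)
    (h : ∀ y ω, HasDerivAt (fun y => f y ω) (f' y ω) y) (y₀ : ℝ) :
    HasDerivAt (fun y => ∫ ω, f y ω ∂μ) (∫ ω, f' y₀ ω ∂μ) y₀ := by
  obtain ⟨b, hb, hfb⟩ := hf'.bound (|y₀| + 1)
  refine (hasDerivAt_integral_of_dominated_loc_of_deriv_le (bound := b)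
    (s := Metric.ball y₀ 1) (Metric.ball_mem_nhds y₀ one_pos)
    (Eventually.of_forall fun y => (hf.moments y).integrable.aestronglyMeasurable)
    (hf.moments y₀).integrable (hf'.moments y₀).integrable.aestronglyMeasurable
    (ae_of_all _ fun ω y hy => ?_) hb.integrable (ae_of_all _ fun ω y _ => h y ω)).2
  refine hfb y ?_ ω
  have h1 : |y - y₀| < 1 := by simpa [Real.dist_eq] using hy
  calc |y| = |y₀ + (y - y₀)| := by ring_nf
    _ ≤ |y₀| + |y - y₀| := abs_add_le _ _
    _ ≤ |y₀| + 1 := by linarith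

end Tame

/-! ### Recursions for the averages of characteristic polynomials -/

section Averages

variable {n : ℕ} {τ : ℝ}

/-- `det (x - X)`. -/
def shiftDet (x : ℝ) (X : Fin n → Fin n → ℝ) : ℝ := (Matrix.scalar (Fin n) x - Matrix.of X).det

/-- The adjugate of `x - X`. -/
def shiftAdj (x : ℝ) (X : Fin n → Fin n → ℝ) : Matrix (Fin n) (Fin n) ℝ :=
  (Matrix.scalar (Fin n) x - Matrix.of X).adjugate

/-- The block map as a function of the border and of the inner block. -/
def borderMap (τ : ℝ) (p : (ℝ × (Fin n → ℝ) × (Fin n → ℝ)) × (Fin n → Fin n → ℝ)) :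
    Fin (n + 1) → Fin (n + 1) → ℝ := blockMap τ (p.1.1, p.1.2.1, p.1.2.2, p.2)

lemma measurePreserving_borderMap (hτ₀ : 0 ≤ τ) (hτ₁ : τ < 1) (n : ℕ) :
    MeasurePreserving (borderMap (n := n) τ) ((borderGauss n).prod (ensemble τ n))
      (ensemble τ (n + 1)) := by
  have := isProbabilityMeasure_ensemble hτ₀ hτ₁ n
  have h1 := measurePreserving_prodAssoc (gaussianReal 0 1) ((stdGauss n).prod (stdGauss n))
    (ensemble τ n)
  have h2 := (MeasurePreserving.id (gaussianReal 0 1)).prod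
    (measurePreserving_prodAssoc (stdGauss n) (stdGauss n) (ensemble τ n))
  exact (measurePreserving_blockMap hτ₀ hτ₁ n).comp (h2.comp h1)

lemma hasMoments_ensemble (hτ₀ : 0 ≤ τ) (hτ₁ : τ < 1) (n : ℕ) (i j : Fin n) :
    HasMoments (fun X => X i j) (ensemble τ n) := by
  induction n with
  | zero => exact i.elim0
  | succ n ih =>
    have := isProbabilityMeasure_ensemble hτ₀ hτ₁ n
    have hfst : MeasurePreserving Prod.fst ((borderGauss n).prod (ensemble τ n)) (borderGauss n) :=
      measurePreserving_fst
    have hsnd : MeasurePreserving Prod.snd ((borderGauss n).prod (ensemble τ n)) (ensemble τ n) :=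
      measurePreserving_snd
    refine HasMoments.of_map (measurePreserving_borderMap hτ₀ hτ₁ n) ?_ (by fun_prop)
    refine Fin.cases ?_ (fun i => ?_) i <;> refine Fin.cases ?_ (fun j => ?_) j
    · exact (hasMoments_borderGauss_fst.comp hfst).const_mul _
    · exact (hasMoments_borderGauss_snd j).comp hfst
    · exact (((hasMoments_borderGauss_snd i).comp hfst).const_mul τ).add
        (((hasMoments_borderGauss_thd i).comp hfst).const_mul _)
    · exact (ih i j).comp hsnd

lemma tame_scalar_sub (hτ₀ : 0 ≤ τ) (hτ₁ : τ < 1) (i j : Fin n) :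
    Tame (fun y X => (Matrix.scalar (Fin n) y - Matrix.of X) i j) (ensemble τ n) := by
  have := isProbabilityMeasure_ensemble hτ₀ hτ₁ n
  by_cases h : i = j
  · subst h
    simpa using tame_id.sub (hasMoments_ensemble hτ₀ hτ₁ n i i).tame
  · simpa [h] using (hasMoments_ensemble hτ₀ hτ₁ n i j).tame.const_mul (-1)

lemma tame_shiftDet (hτ₀ : 0 ≤ τ) (hτ₁ : τ < 1) : Tame (shiftDet (n := n)) (ensemble τ n) := by
  have := isProbabilityMeasure_ensemble hτ₀ hτ₁ n
  exact Tame.det (tame_scalar_sub hτ₀ hτ₁)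

lemma tame_shiftAdj (hτ₀ : 0 ≤ τ) (hτ₁ : τ < 1) (i j : Fin n) :
    Tame (fun y X => shiftAdj y X i j) (ensemble τ n) := by
  have := isProbabilityMeasure_ensemble hτ₀ hτ₁ n
  exact Tame.adjugate (tame_scalar_sub hτ₀ hτ₁) i j

lemma tame_trace_shiftAdj (hτ₀ : 0 ≤ τ) (hτ₁ : τ < 1) :
    Tame (fun y X => (shiftAdj y X).trace) (ensemble τ n) := by
  have := isProbabilityMeasure_ensemble hτ₀ hτ₁ n
  exact Tame.trace (tame_shiftAdj hτ₀ hτ₁)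

lemma hasMoments_trace_mul (hτ₀ : 0 ≤ τ) (hτ₁ : τ < 1) (x y : ℝ) :
    HasMoments (fun X => (shiftAdj x X * shiftAdj y X).trace) (ensemble τ n) :=
  HasMoments.trace_mul (fun i j => (tame_shiftAdj hτ₀ hτ₁ i j).moments x)
    fun i j => (tame_shiftAdj hτ₀ hτ₁ i j).moments y

lemma hasMoments_trace_mul_transpose (hτ₀ : 0 ≤ τ) (hτ₁ : τ < 1) (x y : ℝ) :
    HasMoments (fun X => (shiftAdj x X * (shiftAdj y X)ᵀ).trace) (ensemble τ n) :=
  HasMoments.trace_mul (fun i j => (tame_shiftAdj hτ₀ hτ₁ i j).moments x)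
    fun i j => (tame_shiftAdj hτ₀ hτ₁ j i).moments y

/-- `⟨det (x - X) det (y - X)⟩`. -/
def avgDetDet (τ : ℝ) (n : ℕ) (x y : ℝ) : ℝ :=
  ∫ X, shiftDet x X * shiftDet y X ∂ensemble τ n

/-- `⟨det (x - X) Tr adj (y - X)⟩`. -/
def avgDetTrace (τ : ℝ) (n : ℕ) (x y : ℝ) : ℝ :=
  ∫ X, shiftDet x X * (shiftAdj y X).trace ∂ensemble τ n

/-- `⟨Tr adj (x - X) Tr adj (y - X)⟩`. -/
def avgTraceTrace (τ : ℝ) (n : ℕ) (x y : ℝ) : ℝ :=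
  ∫ X, (shiftAdj x X).trace * (shiftAdj y X).trace ∂ensemble τ n

/-- `⟨Tr (adj (x - X) adj (y - X))⟩`. -/
def avgTraceMul (τ : ℝ) (n : ℕ) (x y : ℝ) : ℝ :=
  ∫ X, (shiftAdj x X * shiftAdj y X).trace ∂ensemble τ n

/-- `⟨Tr (adj (x - X) adj (y - X)ᵀ)⟩`. -/
def avgTraceMulTranspose (τ : ℝ) (n : ℕ) (x y : ℝ) : ℝ :=
  ∫ X, (shiftAdj x X * (shiftAdj y X)ᵀ).trace ∂ensemble τ n

lemma integral_ensemble_succ (hτ₀ : 0 ≤ τ) (hτ₁ : τ < 1)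
    {F : (Fin (n + 1) → Fin (n + 1) → ℝ) → ℝ} (hF : Integrable F (ensemble τ (n + 1))) :
    ∫ X, F X ∂ensemble τ (n + 1)
      = ∫ B, ∫ p, F (borderMap τ (p, B)) ∂borderGauss n ∂ensemble τ n := by
  have := isProbabilityMeasure_ensemble hτ₀ hτ₁ n
  have h := measurePreserving_borderMap hτ₀ hτ₁ n
  have hF' : Integrable (fun p => F (borderMap τ p)) ((borderGauss n).prod (ensemble τ n)) :=
    h.integrable_comp_of_integrable hF
  rw [← h.map_eq, integral_map h.aemeasurable, integral_prod_symm _ hF']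
  rw [h.map_eq]
  exact hF.aestronglyMeasurable

lemma shiftDet_borderedArray (x a : ℝ) (u v : Fin n → ℝ) (B : Fin n → Fin n → ℝ) :
    shiftDet x (borderedArray (a, u, v, B))
      = (x - a) * shiftDet x B - u ⬝ᵥ (shiftAdj x B *ᵥ v) := by
  rw [shiftDet, of_borderedArray, scalar_sub_bordered, det_bordered]
  simp [shiftDet, shiftAdj, Matrix.mulVec_neg]

lemma shiftDet_borderMap (τ x : ℝ) (p : ℝ × (Fin n → ℝ) × (Fin n → ℝ)) (B : Fin n → Fin n → ℝ) :
    shiftDet x (borderMap τ (p, B))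
      = borderForm x (-√(1 + τ)) τ (√(1 - τ ^ 2)) (shiftDet x B) (shiftAdj x B) p := by
  rw [borderMap, blockMap, shiftDet_borderedArray, borderForm]
  simp only [Matrix.mulVec_add, Matrix.mulVec_smul, dotProduct_add, dotProduct_smul, smul_eq_mul]
  ring

/-- The determinant of the bordered matrix is a `borderForm` in its Gaussian border. The
contributions `τ²` and `1 - τ²` to the transposed trace add up to the coefficient `1`. -/
lemma avgDetDet_succ (hτ₀ : 0 ≤ τ) (hτ₁ : τ < 1) (n : ℕ) (x y : ℝ) :
    avgDetDet τ (n + 1) x y = (x * y + (1 + τ)) * avgDetDet τ n x y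
      - τ * (x * avgDetTrace τ n x y + y * avgDetTrace τ n y x)
      + τ ^ 2 * (avgTraceTrace τ n x y + avgTraceMul τ n x y)
      + avgTraceMulTranspose τ n x y := by
  have hprob := isProbabilityMeasure_ensemble hτ₀ hτ₁ n
  have h1 : 0 ≤ 1 - τ ^ 2 := by nlinarith
  have hD := fun x => (tame_shiftDet (n := n) hτ₀ hτ₁).moments x
  have hT := fun x => (tame_trace_shiftAdj (n := n) hτ₀ hτ₁).moments x
  have hint := (((tame_shiftDet (n := n + 1) hτ₀ hτ₁).moments x).mul
    ((tame_shiftDet hτ₀ hτ₁).moments y)).integrable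
  rw [avgDetDet, integral_ensemble_succ hτ₀ hτ₁ hint]
  simp only [shiftDet_borderMap, integral_borderForm_mul_borderForm, neg_sq,
    Real.sq_sqrt (by linarith : 0 ≤ 1 + τ), Real.sq_sqrt h1]
  have k1 := ((hD x).mul (hD y)).const_mul (x * y + (1 + τ))
  have k2 := ((hD x).mul (hT y)).const_mul (-(τ * x))
  have k3 := ((hD y).mul (hT x)).const_mul (-(τ * y))
  have k4 := ((hT x).mul (hT y)).const_mul (τ ^ 2)
  have k5 := (hasMoments_trace_mul (n := n) hτ₀ hτ₁ x y).const_mul (τ ^ 2)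
  have k6 := hasMoments_trace_mul_transpose (n := n) hτ₀ hτ₁ x y
  have he (B : Fin n → Fin n → ℝ) :
      (x * y + (1 + τ)) * (shiftDet x B * shiftDet y B)
        - τ * (x * (shiftDet x B * (shiftAdj y B).trace) + y * (shiftDet y B * (shiftAdj x B).trace))
        + τ ^ 2 * ((shiftAdj x B).trace * (shiftAdj y B).trace + (shiftAdj x B * shiftAdj y B).trace
          + (shiftAdj x B * (shiftAdj y B)ᵀ).trace)
        + (1 - τ ^ 2) * (shiftAdj x B * (shiftAdj y B)ᵀ).trace
      = (x * y + (1 + τ)) * (shiftDet x B * shiftDet y B)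
        + (-(τ * x) * (shiftDet x B * (shiftAdj y B).trace)
        + (-(τ * y) * (shiftDet y B * (shiftAdj x B).trace)
        + (τ ^ 2 * ((shiftAdj x B).trace * (shiftAdj y B).trace)
        + (τ ^ 2 * (shiftAdj x B * shiftAdj y B).trace
        + (shiftAdj x B * (shiftAdj y B)ᵀ).trace)))) := by ring
  simp only [he]
  rw [integral_add k1.integrable (k2.add (k3.add (k4.add (k5.add k6)))).integrable,
    integral_add k2.integrable (k3.add (k4.add (k5.add k6))).integrable,
    integral_add k3.integrable (k4.add (k5.add k6)).integrable,
    integral_add k4.integrable (k5.add k6).integrable, integral_add k5.integrable k6.integrable]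
  simp only [integral_const_mul, avgDetDet, avgDetTrace, avgTraceTrace, avgTraceMul,
    avgTraceMulTranspose]
  ring

lemma integral_borderGauss_snd (f : (Fin n → ℝ) → ℝ) (hf : Measurable f) :
    ∫ p, f p.2.1 ∂borderGauss n = ∫ u, f u ∂stdGauss n := by
  have h : MeasurePreserving (fun p : ℝ × (Fin n → ℝ) × (Fin n → ℝ) => p.2.1) (borderGauss n)
      (stdGauss n) := measurePreserving_fst.comp measurePreserving_snd
  rw [← h.map_eq, integral_map h.aemeasurable hf.aestronglyMeasurable]

lemma measurePreserving_permute (hτ₀ : 0 ≤ τ) (hτ₁ : τ < 1) (σ : Equiv.Perm (Fin n)) :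
    MeasurePreserving (fun (X : Fin n → Fin n → ℝ) i j => X (σ i) (σ j))
      (ensemble τ n) (ensemble τ n) := by
  set Q : Matrix (Fin n) (Fin n) ℝ := (1 : Matrix (Fin n) (Fin n) ℝ).submatrix σ id with hQ
  have hQQ : Qᵀ * Q = 1 := by
    refine mul_eq_one_comm.1 ?_
    ext i j
    simp [hQ, Matrix.mul_apply, Matrix.one_apply]
  convert measurePreserving_orthogonal_conj hτ₀ hτ₁ hQQ using 1
  funext X i j
  simp [hQ, Matrix.mul_apply, Matrix.one_apply]

/-- The trace is the sum over rows of inner products of adjugate rows. By permutation invariance all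
`n + 1` rows have the same mean, and row `0` of the adjugate of the bordered matrix is explicit:
`(det, uᵀ adj)`, built from the inner block. -/
lemma avgTraceMulTranspose_succ (hτ₀ : 0 ≤ τ) (hτ₁ : τ < 1) (n : ℕ) (x y : ℝ) :
    avgTraceMulTranspose τ (n + 1) x y
      = (n + 1) * (avgDetDet τ n x y + avgTraceMulTranspose τ n x y) := by
  have hprob := isProbabilityMeasure_ensemble hτ₀ hτ₁ n
  have hA := fun i j => (tame_shiftAdj (n := n + 1) hτ₀ hτ₁ i j).moments
  have hrow (i : Fin (n + 1)) :
      HasMoments (fun X => ∑ j, shiftAdj x X i j * shiftAdj y X i j) (ensemble τ (n + 1)) :=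
    HasMoments.sum _ fun j _ => (hA i j x).mul (hA i j y)
  have htr (X : Fin (n + 1) → Fin (n + 1) → ℝ) : (shiftAdj x X * (shiftAdj y X)ᵀ).trace
      = ∑ i, ∑ j, shiftAdj x X i j * shiftAdj y X i j := by
    simp [Matrix.trace, Matrix.mul_apply]
  have hsymm (i : Fin (n + 1)) :
      ∫ X, ∑ j, shiftAdj x X i j * shiftAdj y X i j ∂ensemble τ (n + 1)
        = ∫ X, ∑ j, shiftAdj x X 0 j * shiftAdj y X 0 j ∂ensemble τ (n + 1) := by
    set σ := Equiv.swap 0 i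
    have h := measurePreserving_permute (n := n + 1) hτ₀ hτ₁ σ
    have hadj (z : ℝ) (X : Fin (n + 1) → Fin (n + 1) → ℝ) :
        shiftAdj z (fun i j => X (σ i) (σ j)) = (shiftAdj z X).submatrix σ σ := by
      rw [shiftAdj, shiftAdj, ← Matrix.adjugate_submatrix_equiv_self]
      congr 1
      ext i j
      simp [Matrix.diagonal_apply]
    conv_rhs => rw [← h.map_eq, integral_map h.aemeasurable
      (by rw [h.map_eq]; exact (hrow 0).integrable.aestronglyMeasurable)]
    simp only [hadj, Matrix.submatrix_apply]
    congr 1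
    funext X
    rw [Equiv.sum_comp σ (fun j => shiftAdj x X (σ 0) j * shiftAdj y X (σ 0) j)]
    simp [σ]
  have hzero : ∫ X, ∑ j, shiftAdj x X 0 j * shiftAdj y X 0 j ∂ensemble τ (n + 1)
      = avgDetDet τ n x y + avgTraceMulTranspose τ n x y := by
    rw [integral_ensemble_succ hτ₀ hτ₁ (hrow 0).integrable]
    have h0 (z : ℝ) (p : ℝ × (Fin n → ℝ) × (Fin n → ℝ)) (B : Fin n → Fin n → ℝ) :
        shiftAdj z (borderMap τ (p, B)) 0 0 = shiftDet z B := by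
      rw [shiftAdj, borderMap, blockMap, of_borderedArray, scalar_sub_bordered,
        adjugate_bordered_zero_zero]
      rfl
    have hs (z : ℝ) (p : ℝ × (Fin n → ℝ) × (Fin n → ℝ)) (B : Fin n → Fin n → ℝ) (j : Fin n) :
        shiftAdj z (borderMap τ (p, B)) 0 j.succ = (p.2.1 ᵥ* shiftAdj z B) j := by
      rw [shiftAdj, borderMap, blockMap, of_borderedArray, scalar_sub_bordered,
        adjugate_bordered_zero_succ, Matrix.neg_vecMul]
      simp [shiftAdj]
    have he (B : Fin n → Fin n → ℝ) (p : ℝ × (Fin n → ℝ) × (Fin n → ℝ)) :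
        ∑ j, shiftAdj x (borderMap τ (p, B)) 0 j * shiftAdj y (borderMap τ (p, B)) 0 j
          = shiftDet x B * shiftDet y B
            + p.2.1 ⬝ᵥ ((shiftAdj x B * (shiftAdj y B)ᵀ) *ᵥ p.2.1) := by
      rw [Fin.sum_univ_succ]
      simp only [h0, hs]
      rw [← Matrix.mulVec_mulVec, Matrix.dotProduct_mulVec, Matrix.mulVec_transpose]
      rfl
    have hin (B : Fin n → Fin n → ℝ) : ∫ p, (shiftDet x B * shiftDet y B
          + p.2.1 ⬝ᵥ ((shiftAdj x B * (shiftAdj y B)ᵀ) *ᵥ p.2.1)) ∂borderGauss n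
        = shiftDet x B * shiftDet y B + (shiftAdj x B * (shiftAdj y B)ᵀ).trace := by
      have hq : HasMoments (fun p : ℝ × (Fin n → ℝ) × (Fin n → ℝ) =>
          p.2.1 ⬝ᵥ ((shiftAdj x B * (shiftAdj y B)ᵀ) *ᵥ p.2.1)) (borderGauss n) :=
        HasMoments.dotProduct hasMoments_borderGauss_snd
          (HasMoments.mulVec (fun i j => hasMoments_const _) hasMoments_borderGauss_snd)
      rw [integral_add (integrable_const _) hq.integrable,
        integral_borderGauss_snd (fun u => u ⬝ᵥ ((shiftAdj x B * (shiftAdj y B)ᵀ) *ᵥ u)),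
        integral_quadratic]
      · simp
      · simp only [dotProduct, Matrix.mulVec]
        fun_prop
    simp only [he, hin]
    rw [integral_add (((tame_shiftDet hτ₀ hτ₁).moments x).mul
      ((tame_shiftDet hτ₀ hτ₁).moments y)).integrable
      (hasMoments_trace_mul_transpose hτ₀ hτ₁ x y).integrable]
    rfl
  rw [avgTraceMulTranspose]
  simp only [htr]
  rw [integral_finsetSum _ fun i _ => (hrow i).integrable]
  simp only [hsymm, hzero]
  simp
  ring

lemma hasDerivAt_shiftDet (y : ℝ) (X : Fin n → Fin n → ℝ) :
    HasDerivAt (fun y => shiftDet y X) ((shiftAdj y X).trace) y :=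
  hasDerivAt_det_scalar_sub _ _

lemma hasDerivAt_avgDetDet (hτ₀ : 0 ≤ τ) (hτ₁ : τ < 1) (x y : ℝ) :
    HasDerivAt (fun y => avgDetDet τ n x y) (avgDetTrace τ n x y) y := by
  have := isProbabilityMeasure_ensemble hτ₀ hτ₁ n
  have hx := ((tame_shiftDet (n := n) hτ₀ hτ₁).moments x).tame
  exact (hx.mul (tame_shiftDet hτ₀ hτ₁)).hasDerivAt_integral (hx.mul (tame_trace_shiftAdj hτ₀ hτ₁))
    (fun y X => (hasDerivAt_shiftDet y X).const_mul _) y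

lemma hasDerivAt_avgDetTrace (hτ₀ : 0 ≤ τ) (hτ₁ : τ < 1) (x y : ℝ) :
    HasDerivAt (fun x => avgDetTrace τ n x y) (avgTraceTrace τ n x y) x := by
  have := isProbabilityMeasure_ensemble hτ₀ hτ₁ n
  have hy := ((tame_trace_shiftAdj (n := n) hτ₀ hτ₁).moments y).tame
  exact ((tame_shiftDet hτ₀ hτ₁).mul hy).hasDerivAt_integral ((tame_trace_shiftAdj hτ₀ hτ₁).mul hy)
    (fun x X => (hasDerivAt_shiftDet x X).mul_const _) x

/-- The trace of the resolvent identity. It determines `avgTraceMul` through `avgDetTrace` only off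
the diagonal `x = y`. -/
lemma sub_mul_avgTraceMul (hτ₀ : 0 ≤ τ) (hτ₁ : τ < 1) (x y : ℝ) :
    (y - x) * avgTraceMul τ n x y = avgDetTrace τ n y x - avgDetTrace τ n x y := by
  rw [avgTraceMul, avgDetTrace, avgDetTrace, ← integral_const_mul, ← integral_sub
    (((tame_shiftDet hτ₀ hτ₁).moments y).mul ((tame_trace_shiftAdj hτ₀ hτ₁).moments x)).integrable
    (((tame_shiftDet hτ₀ hτ₁).moments x).mul ((tame_trace_shiftAdj hτ₀ hτ₁).moments y)).integrable]
  congr 1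
  funext X
  have h := congrArg Matrix.trace (sub_smul_adjugate_mul_adjugate (Matrix.of X) x y)
  simpa only [Matrix.trace_sub, Matrix.trace_smul, smul_eq_mul, shiftDet, shiftAdj] using h

lemma continuous_avgDetDet (hτ₀ : 0 ≤ τ) (hτ₁ : τ < 1) (x : ℝ) :
    Continuous fun y => avgDetDet τ n x y :=
  continuous_iff_continuousAt.2 fun y => (hasDerivAt_avgDetDet hτ₀ hτ₁ x y).continuousAt

end Averages

/-! ### Scaled Hermite polynomials and their kernels -/

section Hermite

open Nat

variable {τ : ℝ}

/-- The Hermite polynomials with parameter `τ`: monic, with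
`C_{k+2}(x) = x C_{k+1}(x) - τ (k+1) C_k(x)`. -/
def scaledHermite (τ : ℝ) : ℕ → ℝ → ℝ
  | 0, _ => 1
  | 1, x => x
  | k + 2, x => x * scaledHermite τ (k + 1) x - τ * (k + 1) * scaledHermite τ k x

/-- The derivative of `scaledHermite`. -/
def scaledHermiteDeriv (τ : ℝ) (k : ℕ) (x : ℝ) : ℝ := k * scaledHermite τ (k - 1) x

lemma scaledHermite_succ (k : ℕ) (x : ℝ) :
    scaledHermite τ (k + 1) x = x * scaledHermite τ k x - τ * scaledHermiteDeriv τ k x := by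
  cases k with
  | zero => simp [scaledHermite, scaledHermiteDeriv]
  | succ k => simp only [scaledHermite, scaledHermiteDeriv, Nat.add_sub_cancel]; push_cast; ring

lemma scaledHermiteDeriv_succ (k : ℕ) (x : ℝ) :
    scaledHermiteDeriv τ (k + 1) x = (k + 1) * scaledHermite τ k x := by
  simp [scaledHermiteDeriv]

lemma hasDerivAt_scaledHermite (k : ℕ) (x : ℝ) :
    HasDerivAt (scaledHermite τ k) (scaledHermiteDeriv τ k x) x := by
  induction k using Nat.twoStepInduction with
  | zero => simpa [scaledHermite, scaledHermiteDeriv] using hasDerivAt_const x (1 : ℝ)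
  | one => simpa [scaledHermite, scaledHermiteDeriv] using hasDerivAt_id' x
  | more k h0 h1 =>
    have h := ((hasDerivAt_id x).mul h1).sub (h0.const_mul (τ * (k + 1)))
    refine (h.congr_deriv ?_ : _)
    simp only [scaledHermiteDeriv_succ, scaledHermite_succ, id]
    push_cast
    ring

/-- `W_0 = a_0`, `W_{k+1} = τ W_k + a_{k+1}`. -/
def accum (τ : ℝ) (a : ℕ → ℝ) : ℕ → ℝ
  | 0 => a 0
  | k + 1 => τ * accum τ a k + a (k + 1)

/-- The sum of `accum τ a k` over `k ≤ m`. -/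
def kernelSum (τ : ℝ) (a : ℕ → ℝ) : ℕ → ℝ
  | 0 => a 0
  | m + 1 => kernelSum τ a m + accum τ a (m + 1)

lemma accum_add (a b : ℕ → ℝ) (k : ℕ) :
    accum τ (fun i => a i + b i) k = accum τ a k + accum τ b k := by
  induction k with
  | zero => rfl
  | succ k ih => simp only [accum, ih]; ring

lemma accum_const_mul (c : ℝ) (a : ℕ → ℝ) (k : ℕ) :
    accum τ (fun i => c * a i) k = c * accum τ a k := by
  induction k with
  | zero => rfl
  | succ k ih => simp only [accum, ih]; ring

lemma kernelSum_add (a b : ℕ → ℝ) (k : ℕ) :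
    kernelSum τ (fun i => a i + b i) k = kernelSum τ a k + kernelSum τ b k := by
  induction k with
  | zero => rfl
  | succ k ih => simp only [kernelSum, ih, accum_add]; ring

lemma kernelSum_const_mul (c : ℝ) (a : ℕ → ℝ) (k : ℕ) :
    kernelSum τ (fun i => c * a i) k = c * kernelSum τ a k := by
  induction k with
  | zero => rfl
  | succ k ih => simp only [kernelSum, ih, accum_const_mul]; ring

lemma accum_nonneg (hτ : 0 ≤ τ) {a : ℕ → ℝ} (ha : ∀ k, 0 ≤ a k) (k : ℕ) : 0 ≤ accum τ a k := by
  induction k with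
  | zero => exact ha 0
  | succ k ih => exact add_nonneg (mul_nonneg hτ ih) (ha _)

lemma hasDerivAt_accum {a a' : ℕ → ℝ → ℝ} {y : ℝ}
    (h : ∀ k, HasDerivAt (a k) (a' k y) y) (k : ℕ) :
    HasDerivAt (fun y => accum τ (fun i => a i y) k) (accum τ (fun i => a' i y) k) y := by
  induction k with
  | zero => exact h 0
  | succ k ih => exact (ih.const_mul τ).add (h _)

lemma hasDerivAt_kernelSum {a a' : ℕ → ℝ → ℝ} {y : ℝ}
    (h : ∀ k, HasDerivAt (a k) (a' k y) y) (k : ℕ) :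
    HasDerivAt (fun y => kernelSum τ (fun i => a i y) k) (kernelSum τ (fun i => a' i y) k) y := by
  induction k with
  | zero => exact h 0
  | succ k ih => exact ih.add (hasDerivAt_accum h _)

/-- `C_k(x) C_k(y) / k!`. -/
def hermiteTerm (τ x y : ℝ) (k : ℕ) : ℝ := scaledHermite τ k x * scaledHermite τ k y / k !

/-- The derivative in `y` of `hermiteTerm`. -/
def hermiteTermDeriv (τ x y : ℝ) (k : ℕ) : ℝ :=
  scaledHermite τ k x * scaledHermiteDeriv τ k y / k !

/-- The mixed derivative of `hermiteTerm`. -/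
def hermiteTermDerivDeriv (τ x y : ℝ) (k : ℕ) : ℝ :=
  scaledHermiteDeriv τ k x * scaledHermiteDeriv τ k y / k !

lemma hasDerivAt_hermiteTerm (x y : ℝ) (k : ℕ) :
    HasDerivAt (fun y => hermiteTerm τ x y k) (hermiteTermDeriv τ x y k) y :=
  ((hasDerivAt_scaledHermite k y).const_mul _).div_const _

lemma hasDerivAt_hermiteTermDeriv (x y : ℝ) (k : ℕ) :
    HasDerivAt (fun x => hermiteTermDeriv τ x y k) (hermiteTermDerivDeriv τ x y k) x :=
  ((hasDerivAt_scaledHermite k x).mul_const _).div_const _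

/-- The left side is the expansion of `(x C_k(x) - τ C_k'(x)) (y C_k(y) - τ C_k'(y)) / k!`, and each
factor is `C_{k+1}`. The four terms mirror those in the recursion of `avgDetDet`. -/
lemma hermiteTerm_succ (x y : ℝ) (k : ℕ) :
    x * y * hermiteTerm τ x y k + (-(τ * x) * hermiteTermDeriv τ x y k
      + (-(τ * y) * hermiteTermDeriv τ y x k + τ ^ 2 * hermiteTermDerivDeriv τ x y k))
      = (k + 1) * hermiteTerm τ x y (k + 1) := by
  have : (k ! : ℝ) ≠ 0 := by exact_mod_cast k.factorial_ne_zero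
  simp only [hermiteTerm, hermiteTermDeriv, hermiteTermDerivDeriv, Nat.factorial_succ,
    scaledHermite_succ]
  push_cast
  field_simp
  ring

/-- The three-term recurrence contributes `τ (k + 1)` times the identity at the previous index. This
is why the kernel is the geometrically weighted sum `accum` and not a plain sum. -/
lemma christoffel_darboux (x y : ℝ) (k : ℕ) :
    scaledHermite τ k x * scaledHermite τ (k + 1) y - scaledHermite τ (k + 1) x * scaledHermite τ k y
      = (y - x) * (k ! * accum τ (hermiteTerm τ x y) k) := by
  induction k with
  | zero => simp [scaledHermite, accum, hermiteTerm]
  | succ k ih =>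
    have : (k ! : ℝ) ≠ 0 := by exact_mod_cast k.factorial_ne_zero
    have h1 : ((k + 1) ! : ℝ) * hermiteTerm τ x y (k + 1)
        = scaledHermite τ (k + 1) x * scaledHermite τ (k + 1) y := by
      rw [hermiteTerm]
      field_simp
    rw [accum, mul_add, h1, Nat.factorial_succ]
    simp only [scaledHermite]
    push_cast
    linear_combination τ * (k + 1) * ih

/-- The divided difference kernel: `J_0 = 0`, `J_{k+1} = τ J_k + W_k`. -/
def accumDiff (τ : ℝ) (a : ℕ → ℝ) : ℕ → ℝ
  | 0 => 0
  | k + 1 => τ * accumDiff τ a k + accum τ a k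

/-- The sum of `accumDiff τ a k` over `k ≤ m`. -/
def kernelDiff (τ : ℝ) (a : ℕ → ℝ) : ℕ → ℝ
  | 0 => 0
  | m + 1 => kernelDiff τ a m + accumDiff τ a (m + 1)

/-- Since `C_{k+1}' = (k + 1) C_k`, the difference is the left side of the Christoffel–Darboux
identity divided by `k!`. -/
lemma hermiteTermDeriv_sub (x y : ℝ) (k : ℕ) :
    hermiteTermDeriv τ y x (k + 1) - hermiteTermDeriv τ x y (k + 1)
      = (y - x) * accum τ (hermiteTerm τ x y) k := by
  have : (k ! : ℝ) ≠ 0 := by exact_mod_cast k.factorial_ne_zero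
  have h := christoffel_darboux (τ := τ) x y k
  simp only [hermiteTermDeriv, scaledHermiteDeriv_succ, Nat.factorial_succ]
  push_cast
  field_simp
  linear_combination h

lemma accum_deriv_sub (x y : ℝ) (k : ℕ) :
    accum τ (hermiteTermDeriv τ y x) k - accum τ (hermiteTermDeriv τ x y) k
      = (y - x) * accumDiff τ (hermiteTerm τ x y) k := by
  induction k with
  | zero => simp [accum, accumDiff, hermiteTermDeriv, scaledHermiteDeriv]
  | succ k ih =>
    simp only [accum, accumDiff]
    linear_combination τ * ih + hermiteTermDeriv_sub (τ := τ) x y k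

lemma kernelSum_deriv_sub (x y : ℝ) (k : ℕ) :
    kernelSum τ (hermiteTermDeriv τ y x) k - kernelSum τ (hermiteTermDeriv τ x y) k
      = (y - x) * kernelDiff τ (hermiteTerm τ x y) k := by
  induction k with
  | zero => simp [kernelSum, kernelDiff, hermiteTermDeriv, scaledHermiteDeriv]
  | succ k ih =>
    simp only [kernelSum, kernelDiff]
    linear_combination ih + accum_deriv_sub (τ := τ) x y (k + 1)

/-- In `accum τ a (k + 1) = ∑ τ^(k+1-i) a_i` the factor `k + 1` splits as `i + (k + 1 - i)`. The
part `i` shifts the sequence; the part `k + 1 - i` gives the other two terms, because `accumDiff τ a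
k = ∑ (k - i) τ^(k-1-i) a_i`. -/
lemma succ_mul_accum (a : ℕ → ℝ) (k : ℕ) :
    (k + 1) * accum τ a (k + 1) = accum τ (fun i => (i + 1) * a (i + 1)) k
      + τ * accum τ a k + τ ^ 2 * accumDiff τ a k := by
  induction k with
  | zero => simp [accum, accumDiff]; ring
  | succ k ih =>
    simp only [accum, accumDiff] at ih ⊢
    push_cast at ih ⊢
    linear_combination τ * ih

/-- The same splitting one level up, `m + 1 = k + (m + 1 - k)` in the sum of `accum τ a k`: the
first part is governed by `succ_mul_accum`, and the second is the sum of the lower kernels. -/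
lemma succ_mul_kernelSum (a : ℕ → ℝ) (m : ℕ) :
    (m + 1) * kernelSum τ a (m + 1) = kernelSum τ (fun i => (i + 1) * a (i + 1)) m
      + (1 + τ) * kernelSum τ a m + τ ^ 2 * kernelDiff τ a m
      + ∑ j ∈ Finset.range m, kernelSum τ a j := by
  induction m with
  | zero => simp [kernelSum, accum, kernelDiff]; ring
  | succ m ih =>
    have h := succ_mul_accum (τ := τ) a (m + 1)
    rw [Finset.sum_range_succ]
    simp only [kernelSum, kernelDiff] at ih ⊢
    push_cast at ih h ⊢
    linear_combination ih + h

/-- This is the recursion of `avgDetDet_succ` divided by `m!`: `kernelDiff` stands for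
`avgTraceMul`, and the sum over `j` for `avgTraceMulTranspose`. -/
lemma succ_mul_kernelSum_hermiteTerm (x y : ℝ) (m : ℕ) :
    (m + 1) * kernelSum τ (hermiteTerm τ x y) (m + 1)
      = (x * y + (1 + τ)) * kernelSum τ (hermiteTerm τ x y) m
        - τ * (x * kernelSum τ (hermiteTermDeriv τ x y) m
          + y * kernelSum τ (hermiteTermDeriv τ y x) m)
        + τ ^ 2 * (kernelSum τ (hermiteTermDerivDeriv τ x y) m
          + kernelDiff τ (hermiteTerm τ x y) m)
        + ∑ j ∈ Finset.range m, kernelSum τ (hermiteTerm τ x y) j := by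
  rw [succ_mul_kernelSum]
  simp only [← hermiteTerm_succ]
  rw [kernelSum_add, kernelSum_add, kernelSum_add]
  simp only [kernelSum_const_mul]
  ring

lemma hermiteTerm_self_nonneg (x : ℝ) (k : ℕ) : 0 ≤ hermiteTerm τ x x k :=
  div_nonneg (mul_self_nonneg _) (by positivity)

lemma hermiteTermDerivDeriv_succ (x : ℝ) (k : ℕ) :
    hermiteTermDerivDeriv τ x x (k + 1) = (k + 1) * hermiteTerm τ x x k := by
  have : (k ! : ℝ) ≠ 0 := by exact_mod_cast k.factorial_ne_zero
  simp only [hermiteTermDerivDeriv, hermiteTerm, scaledHermiteDeriv_succ, Nat.factorial_succ]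
  push_cast
  field_simp

/-- Differentiating in both variables lowers the Hermite index and multiplies the term of index `i`
by `i + 1`, which is at most `k + 1` for the terms involved. -/
lemma accum_derivDeriv_le (hτ : 0 ≤ τ) (x : ℝ) (k : ℕ) :
    accum τ (hermiteTermDerivDeriv τ x x) (k + 1) ≤ (k + 1) * accum τ (hermiteTerm τ x x) k := by
  have h0 : hermiteTermDerivDeriv τ x x 0 = 0 := by
    simp [hermiteTermDerivDeriv, scaledHermiteDeriv]
  induction k with
  | zero => simp [accum, hermiteTermDerivDeriv_succ, h0]
  | succ k ih =>
    have h1 := mul_le_mul_of_nonneg_left ih hτ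
    have h2 := mul_nonneg hτ (accum_nonneg hτ (hermiteTerm_self_nonneg (τ := τ) x) k)
    rw [accum, hermiteTermDerivDeriv_succ]
    conv_rhs => rw [accum]
    push_cast
    nlinarith

lemma kernelSum_derivDeriv_le (hτ : 0 ≤ τ) (x : ℝ) (m : ℕ) :
    kernelSum τ (hermiteTermDerivDeriv τ x x) (m + 1)
      ≤ (m + 1) * kernelSum τ (hermiteTerm τ x x) m := by
  have h0 : hermiteTermDerivDeriv τ x x 0 = 0 := by
    simp [hermiteTermDerivDeriv, scaledHermiteDeriv]
  induction m with
  | zero => simp [kernelSum, accum, hermiteTermDerivDeriv_succ, h0]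
  | succ m ih =>
    have h1 := accum_derivDeriv_le hτ x (m + 1)
    have h2 : 0 ≤ kernelSum τ (hermiteTerm τ x x) m := by
      clear ih h1
      induction m with
      | zero => exact hermiteTerm_self_nonneg x 0
      | succ m ih => exact add_nonneg ih (accum_nonneg hτ (hermiteTerm_self_nonneg x) _)
    rw [kernelSum]
    conv_rhs => rw [kernelSum]
    push_cast at *
    nlinarith

end Hermite

/-! ### Closed form of the averages -/

section ClosedForm

open Nat

variable {τ : ℝ}

/-- Differentiation in `y`, under the expectation on one side (Jacobi's formula) and term by term on
the other; derivatives are unique. -/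
lemma avgDetTrace_of_avgDetDet (hτ₀ : 0 ≤ τ) (hτ₁ : τ < 1) {m : ℕ}
    (h : ∀ x y, avgDetDet τ m x y = m ! * kernelSum τ (hermiteTerm τ x y) m) (x y : ℝ) :
    avgDetTrace τ m x y = m ! * kernelSum τ (hermiteTermDeriv τ x y) m := by
  have h1 := hasDerivAt_avgDetDet (n := m) hτ₀ hτ₁ x y
  simp only [h] at h1
  exact h1.unique ((hasDerivAt_kernelSum (a := fun k y => hermiteTerm τ x y k)
    (a' := fun k y => hermiteTermDeriv τ x y k)
    (fun k => hasDerivAt_hermiteTerm x y k) m).const_mul _)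

lemma avgTraceTrace_of_avgDetDet (hτ₀ : 0 ≤ τ) (hτ₁ : τ < 1) {m : ℕ}
    (h : ∀ x y, avgDetDet τ m x y = m ! * kernelSum τ (hermiteTerm τ x y) m) (x y : ℝ) :
    avgTraceTrace τ m x y = m ! * kernelSum τ (hermiteTermDerivDeriv τ x y) m := by
  have h1 := hasDerivAt_avgDetTrace (n := m) hτ₀ hτ₁ x y
  simp only [avgDetTrace_of_avgDetDet hτ₀ hτ₁ h] at h1
  exact h1.unique ((hasDerivAt_kernelSum (a := fun k x => hermiteTermDeriv τ x y k)
    (a' := fun k x => hermiteTermDerivDeriv τ x y k)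
    (fun k => hasDerivAt_hermiteTermDeriv x y k) m).const_mul _)

/-- The two formulas are proved together because the recursion of the first involves the second. The
other averages of size `m` come from the first formula for the same `m`, by differentiation and by
the resolvent identity. -/
lemma avgDetDet_eq_and (hτ₀ : 0 ≤ τ) (hτ₁ : τ < 1) (m : ℕ) :
    (∀ x y, avgDetDet τ m x y = m ! * kernelSum τ (hermiteTerm τ x y) m) ∧
    (∀ x y, avgTraceMulTranspose τ m x y
      = m ! * ∑ j ∈ Finset.range m, kernelSum τ (hermiteTerm τ x y) j) := by
  induction m with
  | zero =>
    have := isProbabilityMeasure_ensemble hτ₀ hτ₁ 0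
    refine ⟨fun x y => ?_, fun x y => ?_⟩
    · simp [avgDetDet, shiftDet, kernelSum, hermiteTerm, scaledHermite]
    · simp [avgTraceMulTranspose]
  | succ m ih =>
    obtain ⟨ih0, ih3⟩ := ih
    have h3 (x y : ℝ) : avgTraceMulTranspose τ (m + 1) x y
        = (m + 1)! * ∑ j ∈ Finset.range (m + 1), kernelSum τ (hermiteTerm τ x y) j := by
      rw [avgTraceMulTranspose_succ hτ₀ hτ₁, ih0, ih3, Finset.sum_range_succ, Nat.factorial_succ]
      push_cast
      ring
    refine ⟨fun x => ?_, h3⟩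
    -- The resolvent identity requires division by `y - x`; the diagonal value is recovered below by
    -- continuity, the complement of a point being dense.
    have hne (y : ℝ) (hxy : y ≠ x) :
        avgDetDet τ (m + 1) x y = (m + 1)! * kernelSum τ (hermiteTerm τ x y) (m + 1) := by
      have hd := avgDetTrace_of_avgDetDet hτ₀ hτ₁ ih0
      have h4 : avgTraceMul τ m x y = m ! * kernelDiff τ (hermiteTerm τ x y) m := by
        refine mul_left_cancel₀ (sub_ne_zero.2 hxy) ?_
        rw [sub_mul_avgTraceMul hτ₀ hτ₁, hd, hd]
        linear_combination (m ! : ℝ) * kernelSum_deriv_sub (τ := τ) x y m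
      rw [avgDetDet_succ hτ₀ hτ₁, ih0, hd, hd, avgTraceTrace_of_avgDetDet hτ₀ hτ₁ ih0, h4, ih3,
        Nat.factorial_succ]
      push_cast
      linear_combination -(m ! : ℝ) * succ_mul_kernelSum_hermiteTerm (τ := τ) x y m
    have hcont : Continuous fun y => ((m + 1)! : ℝ) * kernelSum τ (hermiteTerm τ x y) (m + 1) :=
      continuous_iff_continuousAt.2 fun y =>
        ((hasDerivAt_kernelSum (a := fun k y => hermiteTerm τ x y k)
          (a' := fun k y => hermiteTermDeriv τ x y k)
          (fun k => hasDerivAt_hermiteTerm x y k) (m + 1)).const_mul _).continuousAt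
    exact congrFun (Continuous.ext_on (dense_compl_singleton x) (continuous_avgDetDet hτ₀ hτ₁ x)
      hcont fun y hy => hne y hy)

lemma avgDetDet_eq (hτ₀ : 0 ≤ τ) (hτ₁ : τ < 1) (m : ℕ) (x y : ℝ) :
    avgDetDet τ m x y = m ! * kernelSum τ (hermiteTerm τ x y) m :=
  (avgDetDet_eq_and hτ₀ hτ₁ m).1 x y

lemma avgTraceMulTranspose_eq (hτ₀ : 0 ≤ τ) (hτ₁ : τ < 1) (m : ℕ) (x y : ℝ) :
    avgTraceMulTranspose τ m x y
      = m ! * ∑ j ∈ Finset.range m, kernelSum τ (hermiteTerm τ x y) j :=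
  (avgDetDet_eq_and hτ₀ hτ₁ m).2 x y

lemma avgTraceTrace_succ_le (hτ₀ : 0 ≤ τ) (hτ₁ : τ < 1) (m : ℕ) (x : ℝ) :
    avgTraceTrace τ (m + 1) x x
      ≤ (m + 1)! * ((m + 1) * kernelSum τ (hermiteTerm τ x x) m) := by
  rw [avgTraceTrace_of_avgDetDet hτ₀ hτ₁ (avgDetDet_eq hτ₀ hτ₁ _)]
  exact mul_le_mul_of_nonneg_left (kernelSum_derivDeriv_le hτ₀ x m) (by positivity)

end ClosedForm

/-! ### The average of a squared determinant with a Gaussian tilt in the first row -/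

section Tilt

/-- Completion of the square: the tilted Gaussian of variance `c` is again Gaussian, with precision
`1 / c + s` and mean `s z / (1 / c + s)`; the prefactor is its mass. -/
lemma lintegral_gaussian_tilt {F : ℝ → ℝ≥0∞} (hF : Measurable F) {c s : ℝ} (hc : 0 < c)
    (hs : 0 ≤ s) (z : ℝ) :
    ∫⁻ g, F (√c * g) * ENNReal.ofReal (Real.exp (-s * (z - √c * g) ^ 2 / 2)) ∂gaussianReal 0 1
      = ENNReal.ofReal ((√(1 + s * c))⁻¹ * Real.exp (-(s * z ^ 2 / (2 * (1 + s * c)))))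
        * ∫⁻ g, F (c / (1 + s * c) * (s * z) + √(c / (1 + s * c)) * g) ∂gaussianReal 0 1 := by
  have hd : 0 < 1 + s * c := by positivity
  have hq : 0 < c / (1 + s * c) := by positivity
  have hG : Measurable fun a => F a * ENNReal.ofReal (Real.exp (-s * (z - a) ^ 2 / 2)) := by fun_prop
  have h1 := lintegral_gaussian_shift_scale hG 0 hc
  have h2 := lintegral_gaussian_shift_scale hF (c / (1 + s * c) * (s * z)) hq
  have hpt (a : ℝ) : F a * ENNReal.ofReal (Real.exp (-s * (z - a) ^ 2 / 2))
      * ENNReal.ofReal (Real.exp (-(a - 0) ^ 2 / (2 * c)))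
      = ENNReal.ofReal (Real.exp (-(s * z ^ 2 / (2 * (1 + s * c)))))
        * (F a * ENNReal.ofReal
          (Real.exp (-(a - c / (1 + s * c) * (s * z)) ^ 2 / (2 * (c / (1 + s * c)))))) := by
    rw [mul_assoc, ← ENNReal.ofReal_mul (by positivity), ← Real.exp_add, mul_left_comm,
      ← ENNReal.ofReal_mul (by positivity), ← Real.exp_add]
    congr 3
    field_simp
    ring
  simp only [hpt] at h1
  rw [lintegral_const_mul _ (by fun_prop), h2] at h1
  simp only [zero_add] at h1
  have hpos : 0 < √(2 * Real.pi * c) := by positivity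
  have h3 : √(2 * Real.pi * (c / (1 + s * c))) = √(2 * Real.pi * c) * (√(1 + s * c))⁻¹ := by
    rw [← mul_div_assoc, Real.sqrt_div (by positivity), div_eq_mul_inv]
  rw [h3, ENNReal.ofReal_mul hpos.le, mul_assoc, mul_left_comm, ENNReal.mul_right_inj
    (by simpa using hpos) ENNReal.ofReal_ne_top] at h1
  rw [← h1, ENNReal.ofReal_mul (by positivity)]
  ring

lemma lintegral_stdGauss_tilt {n : ℕ} {F : (Fin n → ℝ) → ℝ≥0∞} (hF : Measurable F) {s : ℝ}
    (hs : 0 ≤ s) :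
    ∫⁻ u, F u * ENNReal.ofReal (Real.exp (-s * (u ⬝ᵥ u) / 2)) ∂stdGauss n
      = ENNReal.ofReal ((√(1 + s))⁻¹ ^ n) * ∫⁻ u, F (√(1 / (1 + s)) • u) ∂stdGauss n := by
  have hd : 0 < 1 + s := by positivity
  have hdot : Measurable fun u : Fin n → ℝ => u ⬝ᵥ u := by
    simp only [dotProduct]; fun_prop
  have hG : Measurable fun u => F u * ENNReal.ofReal (Real.exp (-s * (u ⬝ᵥ u) / 2)) := by fun_prop
  have h1 := lintegral_gaussian_vector hG one_pos
  have h2 := lintegral_gaussian_vector hF (c := 1 / (1 + s)) (by positivity)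
  have hpt (u : Fin n → ℝ) : F u * ENNReal.ofReal (Real.exp (-s * (u ⬝ᵥ u) / 2))
      * ENNReal.ofReal (Real.exp (-(u ⬝ᵥ u) / (2 * 1)))
      = F u * ENNReal.ofReal (Real.exp (-(u ⬝ᵥ u) / (2 * (1 / (1 + s))))) := by
    rw [mul_assoc, ← ENNReal.ofReal_mul (by positivity), ← Real.exp_add]
    congr 3
    field_simp
    ring
  simp only [hpt] at h1
  rw [h2] at h1
  simp only [Real.sqrt_one, one_smul] at h1
  have h3 : √(2 * Real.pi * (1 / (1 + s))) ^ n = √(2 * Real.pi * 1) ^ n * (√(1 + s))⁻¹ ^ n := by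
    rw [← mul_pow, ← mul_div_assoc, Real.sqrt_div (by positivity), div_eq_mul_inv]
  have hpos : 0 < √(2 * Real.pi * 1) ^ n := by positivity
  rw [h3, ENNReal.ofReal_mul hpos.le, mul_assoc, ENNReal.mul_right_inj
    (ENNReal.ofReal_pos.2 hpos).ne' ENNReal.ofReal_ne_top] at h1
  exact h1.symm

variable {τ : ℝ} {n : ℕ}

/-- The average of the square of `(μ + √q g₀) det (x - X) - √a uᵀ adj (x - X) (τ √a u + √(1-τ²) g)`
over standard Gaussian `g₀`, `u`, `g` and `X` from the ensemble. -/
def tiltAverage (τ : ℝ) (n : ℕ) (μ q a x : ℝ) : ℝ :=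
  (μ ^ 2 + q) * avgDetDet τ n x x - 2 * (a * τ) * (μ * avgDetTrace τ n x x)
    + (a * τ) ^ 2 * (avgTraceTrace τ n x x + avgTraceMul τ n x x + avgTraceMulTranspose τ n x x)
    + a * (1 - τ ^ 2) * avgTraceMulTranspose τ n x x

lemma integral_borderForm_sq (hτ₀ : 0 ≤ τ) (hτ₁ : τ < 1) (μ x : ℝ) {q a : ℝ} (hq : 0 ≤ q)
    (ha : 0 ≤ a) :
    Integrable (fun B => ∫ p, borderForm μ (-√q) (a * τ) (√a * √(1 - τ ^ 2)) (shiftDet x B)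
        (shiftAdj x B) p ^ 2 ∂borderGauss n) (ensemble τ n) ∧
    ∫ B, ∫ p, borderForm μ (-√q) (a * τ) (√a * √(1 - τ ^ 2)) (shiftDet x B)
        (shiftAdj x B) p ^ 2 ∂borderGauss n ∂ensemble τ n = tiltAverage τ n μ q a x := by
  have hprob := isProbabilityMeasure_ensemble hτ₀ hτ₁ n
  have h1 : 0 ≤ 1 - τ ^ 2 := by nlinarith
  have hD := (tame_shiftDet (n := n) hτ₀ hτ₁).moments x
  have hT := (tame_trace_shiftAdj (n := n) hτ₀ hτ₁).moments x
  have hfe (B : Fin n → Fin n → ℝ) : ∫ p, borderForm μ (-√q) (a * τ) (√a * √(1 - τ ^ 2))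
        (shiftDet x B) (shiftAdj x B) p ^ 2 ∂borderGauss n
      = (μ ^ 2 + q) * (shiftDet x B * shiftDet x B)
        + (-(2 * (a * τ) * μ) * (shiftDet x B * (shiftAdj x B).trace)
        + ((a * τ) ^ 2 * ((shiftAdj x B).trace * (shiftAdj x B).trace)
        + ((a * τ) ^ 2 * (shiftAdj x B * shiftAdj x B).trace
        + ((a * τ) ^ 2 + a * (1 - τ ^ 2)) * (shiftAdj x B * (shiftAdj x B)ᵀ).trace))) := by
    simp only [pow_two (borderForm _ _ _ _ _ _ _), integral_borderForm_mul_borderForm, neg_sq,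
      mul_pow (√a), Real.sq_sqrt hq, Real.sq_sqrt ha, Real.sq_sqrt h1]
    ring
  have k1 := (hD.mul hD).const_mul (μ ^ 2 + q)
  have k2 := (hD.mul hT).const_mul (-(2 * (a * τ) * μ))
  have k3 := (hT.mul hT).const_mul ((a * τ) ^ 2)
  have k4 := (hasMoments_trace_mul (n := n) hτ₀ hτ₁ x x).const_mul ((a * τ) ^ 2)
  have k5 := (hasMoments_trace_mul_transpose (n := n) hτ₀ hτ₁ x x).const_mul
    ((a * τ) ^ 2 + a * (1 - τ ^ 2))
  simp only [hfe]
  refine ⟨(k1.add (k2.add (k3.add (k4.add k5)))).integrable, ?_⟩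
  rw [integral_add k1.integrable (k2.add (k3.add (k4.add k5))).integrable,
    integral_add k2.integrable (k3.add (k4.add k5)).integrable,
    integral_add k3.integrable (k4.add k5).integrable, integral_add k4.integrable k5.integrable]
  simp only [integral_const_mul, tiltAverage, avgDetDet, avgDetTrace, avgTraceTrace, avgTraceMul,
    avgTraceMulTranspose]
  ring

lemma tiltAverage_nonneg (hτ₀ : 0 ≤ τ) (hτ₁ : τ < 1) (μ x : ℝ) {q a : ℝ} (hq : 0 ≤ q)
    (ha : 0 ≤ a) : 0 ≤ tiltAverage τ n μ q a x := by
  rw [← (integral_borderForm_sq hτ₀ hτ₁ μ x hq ha).2]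
  exact integral_nonneg fun B => integral_nonneg fun p => sq_nonneg _

lemma lintegral_borderForm_sq (hτ₀ : 0 ≤ τ) (hτ₁ : τ < 1) (μ x : ℝ) {q a : ℝ} (hq : 0 ≤ q)
    (ha : 0 ≤ a) :
    ∫⁻ B, ∫⁻ p, ENNReal.ofReal (borderForm μ (-√q) (a * τ) (√a * √(1 - τ ^ 2)) (shiftDet x B)
        (shiftAdj x B) p ^ 2) ∂borderGauss n ∂ensemble τ n
      = ENNReal.ofReal (tiltAverage τ n μ q a x) := by
  obtain ⟨hint, hval⟩ := integral_borderForm_sq (n := n) hτ₀ hτ₁ μ x hq ha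
  rw [← hval, ofReal_integral_eq_lintegral_ofReal hint
    (ae_of_all _ fun B => integral_nonneg fun p => sq_nonneg _)]
  refine lintegral_congr fun B => ?_
  have hm := hasMoments_borderForm μ (-√q) (a * τ) (√a * √(1 - τ ^ 2)) (shiftDet x B)
    (shiftAdj x B)
  rw [ofReal_integral_eq_lintegral_ofReal _ (ae_of_all _ fun p => sq_nonneg _)]
  simpa only [pow_two] using (hm.mul hm).integrable

lemma measurable_shiftDet (x : ℝ) : Measurable (shiftDet (n := n) x) := by
  have : Continuous (shiftDet (n := n) x) := by
    refine Continuous.matrix_det (continuous_const.sub ?_)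
    exact continuous_id
  exact this.measurable

lemma shiftDet_borderedArray_smul (τ x m q g₀ : ℝ) {a : ℝ} (ha : 0 ≤ a) (u g : Fin n → ℝ)
    (B : Fin n → Fin n → ℝ) :
    shiftDet x (borderedArray (m + √q * g₀, √a • u, τ • √a • u + √(1 - τ ^ 2) • g, B))
      = borderForm (x - m) (-√q) (a * τ) (√a * √(1 - τ ^ 2)) (shiftDet x B) (shiftAdj x B)
          (g₀, u, g) := by
  rw [shiftDet_borderedArray, borderForm]
  simp only [Matrix.mulVec_add, Matrix.mulVec_smul, dotProduct_add, dotProduct_smul,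
    smul_dotProduct, smul_eq_mul]
  have := Real.mul_self_sqrt ha
  linear_combination (-τ * (u ⬝ᵥ shiftAdj x B *ᵥ u)) * this

/-- The corner and the rest of the row are tilted independently, each with its own mass. Tonelli's
theorem then puts the inner block outermost, so that the border can be averaged first. -/
lemma lintegral_iterated_tilt {β : Type*} [MeasurableSpace β] (ν : Measure β) [SFinite ν]
    {G : ℝ × (Fin n → ℝ) × (Fin n → ℝ) × β → ℝ≥0∞} (hG : Measurable G) {c s : ℝ} (hc : 0 < c)
    (hs : 0 ≤ s) (x : ℝ) :
    ∫⁻ a, ∫⁻ u, ∫⁻ g, ∫⁻ B, G (√c * a, u, g, B)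
        * ENNReal.ofReal (Real.exp (-s * (u ⬝ᵥ u) / 2))
        * ENNReal.ofReal (Real.exp (-s * (x - √c * a) ^ 2 / 2))
        ∂ν ∂stdGauss n ∂stdGauss n ∂gaussianReal 0 1
      = ENNReal.ofReal ((√(1 + s * c))⁻¹ * Real.exp (-(s * x ^ 2 / (2 * (1 + s * c))))
          * (√(1 + s))⁻¹ ^ n)
        * ∫⁻ B, ∫⁻ p, G (c / (1 + s * c) * (s * x) + √(c / (1 + s * c)) * p.1,
            √(1 / (1 + s)) • p.2.1, p.2.2, B) ∂borderGauss n ∂ν := by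
  set H : ℝ × (Fin n → ℝ) → ℝ≥0∞ := fun r => ∫⁻ g, ∫⁻ B, G (r.1, r.2, g, B) ∂ν ∂stdGauss n with hH
  have hHm : Measurable H := by
    refine Measurable.lintegral_prod_right'
      (f := fun r : (ℝ × (Fin n → ℝ)) × (Fin n → ℝ) => ∫⁻ B, G (r.1.1, r.1.2, r.2, B) ∂ν) ?_
    refine Measurable.lintegral_prod_right'
      (f := fun r : ((ℝ × (Fin n → ℝ)) × (Fin n → ℝ)) × β => G (r.1.1.1, r.1.1.2, r.1.2, r.2)) ?_
    exact hG.comp (by fun_prop)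
  have hfact (a : ℝ) (u : Fin n → ℝ) :
      ∫⁻ g, ∫⁻ B, G (√c * a, u, g, B) * ENNReal.ofReal (Real.exp (-s * (u ⬝ᵥ u) / 2))
        * ENNReal.ofReal (Real.exp (-s * (x - √c * a) ^ 2 / 2)) ∂ν ∂stdGauss n
      = H (√c * a, u) * ENNReal.ofReal (Real.exp (-s * (u ⬝ᵥ u) / 2))
        * ENNReal.ofReal (Real.exp (-s * (x - √c * a) ^ 2 / 2)) := by
    simp only [hH, mul_assoc]
    rw [← lintegral_mul_const' _ _ (by finiteness)]
    refine lintegral_congr fun g => ?_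
    rw [← lintegral_mul_const' _ _ (by finiteness)]
  simp only [hfact]
  have hdot : Measurable fun u : Fin n → ℝ => u ⬝ᵥ u := by
    simp only [dotProduct]; fun_prop
  have hu (a : ℝ) : ∫⁻ u, H (√c * a, u) * ENNReal.ofReal (Real.exp (-s * (u ⬝ᵥ u) / 2))
        * ENNReal.ofReal (Real.exp (-s * (x - √c * a) ^ 2 / 2)) ∂stdGauss n
      = ENNReal.ofReal ((√(1 + s))⁻¹ ^ n) * ((∫⁻ u, H (√c * a, √(1 / (1 + s)) • u) ∂stdGauss n)
        * ENNReal.ofReal (Real.exp (-s * (x - √c * a) ^ 2 / 2))) := by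
    rw [lintegral_mul_const' _ _ (by finiteness), ← mul_assoc,
      ← lintegral_stdGauss_tilt (F := fun u => H (√c * a, u)) (by fun_prop) hs]
  simp only [hu]
  rw [lintegral_const_mul' _ _ (by finiteness),
    lintegral_gaussian_tilt (F := fun b => ∫⁻ u, H (b, √(1 / (1 + s)) • u) ∂stdGauss n) _ hc hs x]
  · rw [← mul_assoc, ← ENNReal.ofReal_mul (by positivity), mul_comm ((√(1 + s))⁻¹ ^ n)]
    congr 1
    symm
    rw [lintegral_lintegral_swap]
    · rw [borderGauss, lintegral_prod]
      · refine lintegral_congr fun a => ?_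
        rw [lintegral_prod]
        refine Measurable.aemeasurable ?_
        refine Measurable.lintegral_prod_right' (f := fun r : ((Fin n → ℝ) × (Fin n → ℝ)) × β =>
          G (c / (1 + s * c) * (s * x) + √(c / (1 + s * c)) * a, √(1 / (1 + s)) • r.1.1, r.1.2,
            r.2)) ?_
        exact hG.comp (by fun_prop)
      · refine Measurable.aemeasurable ?_
        refine Measurable.lintegral_prod_right'
          (f := fun r : (ℝ × (Fin n → ℝ) × (Fin n → ℝ)) × β =>
          G (c / (1 + s * c) * (s * x) + √(c / (1 + s * c)) * r.1.1, √(1 / (1 + s)) • r.1.2.1,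
            r.1.2.2, r.2)) ?_
        exact hG.comp (by fun_prop)
    · exact (hG.comp (g := G) (f := fun r : β × (ℝ × (Fin n → ℝ) × (Fin n → ℝ)) =>
        (c / (1 + s * c) * (s * x) + √(c / (1 + s * c)) * r.2.1, √(1 / (1 + s)) • r.2.2.1,
            r.2.2.2, r.1)) (by fun_prop)).aemeasurable
  · exact Measurable.lintegral_prod_right'
      (f := fun r : ℝ × (Fin n → ℝ) => H (r.1, √(1 / (1 + s)) • r.2)) (hHm.comp (by fun_prop))

/-- The average of `det (x - X)²` with the tilt `exp (-s |row₀ (x - X)|² / 2)`. -/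
lemma lintegral_tilted (hτ₀ : 0 ≤ τ) (hτ₁ : τ < 1) {s : ℝ} (hs : 0 ≤ s) (x : ℝ) :
    ∫⁻ X, ENNReal.ofReal (shiftDet x X ^ 2
        * Real.exp (-s * ((x - X 0 0) ^ 2 + ∑ j : Fin n, X 0 j.succ ^ 2) / 2)) ∂ensemble τ (n + 1)
      = ENNReal.ofReal ((√(1 + s * (1 + τ)))⁻¹
          * Real.exp (-(s * x ^ 2 / (2 * (1 + s * (1 + τ))))) * (√(1 + s))⁻¹ ^ n
          * tiltAverage τ n (x / (1 + s * (1 + τ))) ((1 + τ) / (1 + s * (1 + τ))) (1 / (1 + s)) x) := by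
  have hprob := isProbabilityMeasure_ensemble hτ₀ hτ₁ n
  have hd : 0 < 1 + s * (1 + τ) := by positivity
  have hmd := measurable_shiftDet (n := n + 1) x
  have hms : Measurable fun X : Fin (n + 1) → Fin (n + 1) → ℝ => ENNReal.ofReal (shiftDet x X ^ 2
        * Real.exp (-s * ((x - X 0 0) ^ 2 + ∑ j : Fin n, X 0 j.succ ^ 2) / 2)) := by fun_prop
  rw [lintegral_ensemble_succ hτ₀ hτ₁ hms]
  have hb := measurable_borderedArray (n := n)
  have hG : Measurable fun r : ℝ × (Fin n → ℝ) × (Fin n → ℝ) × (Fin n → Fin n → ℝ) =>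
      ENNReal.ofReal (shiftDet x (borderedArray
        (r.1, r.2.1, τ • r.2.1 + √(1 - τ ^ 2) • r.2.2.1, r.2.2.2)) ^ 2) :=
    ((hmd.comp (hb.comp (by fun_prop))).pow_const 2).ennreal_ofReal
  have h := lintegral_iterated_tilt (ensemble τ n) hG (by linarith : 0 < 1 + τ) hs x
  rw [ENNReal.ofReal_mul (by positivity)]
  -- The determinant contains the corner only through `x - a`, so the tilted mean of `a` leaves `x /
  -- (1 + s (1 + τ))`.
  have hm : x - (1 + τ) / (1 + s * (1 + τ)) * (s * x) = x / (1 + s * (1 + τ)) := by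
    field_simp
    ring
  have ha : 0 ≤ 1 / (1 + s) := by positivity
  simp only [shiftDet_borderedArray_smul τ x _ _ _ ha, hm] at h
  rw [← lintegral_borderForm_sq hτ₀ hτ₁ _ x (by positivity) ha]
  refine Eq.trans ?_ h
  refine lintegral_congr fun b => lintegral_congr fun u => lintegral_congr fun g =>
    lintegral_congr fun B => ?_
  have h0 (p : ℝ × (Fin n → ℝ) × (Fin n → ℝ) × (Fin n → Fin n → ℝ)) :
      borderedArray p 0 0 = p.1 := rfl
  have h1 (p : ℝ × (Fin n → ℝ) × (Fin n → ℝ) × (Fin n → Fin n → ℝ)) (j : Fin n) :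
      borderedArray p 0 j.succ = p.2.1 j := rfl
  simp only [h0, h1]
  rw [← ENNReal.ofReal_mul (sq_nonneg _), ← ENNReal.ofReal_mul (by positivity), mul_assoc,
    ← Real.exp_add]
  congr 3
  simp only [dotProduct, ← pow_two]
  ring

end Tilt

/-! ### The area formula for maps which are not injective -/

section Area

variable {E : Type*} [NormedAddCommGroup E] [NormedSpace ℝ E] [FiniteDimensional ℝ E]
  [MeasurableSpace E] [BorelSpace E]

/-- On a set where `f` is injective the fiber sum has at most one term. `Function.extend` records it
as a function of `y` which is measurable when the restriction is a measurable embedding. -/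
lemma tsum_indicator_fiber_of_injOn {α β : Type*} {f : α → β} {s : Set α} (hf : Set.InjOn f s)
    (h : α → ℝ≥0∞) (y : β) :
    ∑' p, (s ∩ f ⁻¹' {y}).indicator h p
      = Function.extend (s.domRestrict f) (fun p => h p) 0 y := by
  by_cases hy : ∃ p : s, s.domRestrict f p = y
  · obtain ⟨p, rfl⟩ := hy
    rw [hf.injective.extend_apply, tsum_eq_single p.1]
    · exact Set.indicator_of_mem (s := s ∩ f ⁻¹' {f p}) ⟨p.2, rfl⟩ h
    · intro p' hp'
      refine Set.indicator_of_notMem (fun hmem => hp' (hf hmem.1 p.2 hmem.2)) h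
  · rw [Function.extend_apply' _ _ _ hy]
    refine ENNReal.tsum_eq_zero.2 fun p => Set.indicator_of_notMem (fun hmem => hy ?_) h
    exact ⟨⟨p, hmem.1⟩, hmem.2⟩

/-- A quantitative inverse function theorem: on countably many measurable pieces `f` is so close to
an invertible linear map that it is injective there. -/
lemma exists_partition_injOn [Nontrivial E] {f : E → E} {f' : E → E →L[ℝ] E} {s : Set E}
    (hf : ∀ x ∈ s, HasFDerivAt f (f' x) x) (hdet : ∀ x ∈ s, (f' x).det ≠ 0) :
    ∃ t : ℕ → Set E, Pairwise (Function.onFun Disjoint t) ∧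
      (∀ n, MeasurableSet (t n)) ∧
      s ⊆ ⋃ n, t n ∧ ∀ n, Set.InjOn f (s ∩ t n) := by
  classical
  let r : (E →L[ℝ] E) → NNReal := fun A => if h : A.det ≠ 0 then
    ‖((A.toContinuousLinearEquivOfDetNeZero h).symm : E →L[ℝ] E)‖₊⁻¹ / 2 else 1
  have hpos (e : E ≃L[ℝ] E) : 0 < ‖(e.symm : E →L[ℝ] E)‖₊⁻¹ :=
    inv_pos.2 e.nnnorm_symm_pos
  obtain ⟨t, A, hd, hm, hst, happ, hA⟩ :=
    exists_partition_approximatesLinearOn_of_hasFDerivWithinAt f s f'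
      (fun x hx => (hf x hx).hasFDerivWithinAt) r (fun A => by
        by_cases h : A.det ≠ 0
        · simp only [r, dif_pos h]
          exact (half_pos (hpos _)).ne'
        · simp only [r, dif_neg h]
          exact one_ne_zero)
  refine ⟨t, hd, hm, hst, fun n => ?_⟩
  rcases s.eq_empty_or_nonempty with rfl | hs
  · simp
  obtain ⟨y, hy, hAy⟩ := hA hs n
  have hne : (A n).det ≠ 0 := hAy ▸ hdet y hy
  have h1 := happ n
  have hc : ((A n).toContinuousLinearEquivOfDetNeZero hne : E →L[ℝ] E) = A n := by
    ext x; simp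
  rw [← hc] at h1
  refine h1.injOn (Or.inr ?_)
  have h2 : r (A n) = ‖(((A n).toContinuousLinearEquivOfDetNeZero hne).symm : E →L[ℝ] E)‖₊⁻¹ / 2 := by
    simp only [r, dif_pos hne]
  rw [hc, h2]
  exact half_lt_self (hpos _)

variable (μ : Measure E) [μ.IsAddHaarMeasure]

/-- The change of variables formula holds on each piece of injectivity, and summation over the
pieces counts the preimages of `y`. -/
lemma lintegral_tsum_indicator_fiber [Nontrivial E] {f : E → E} {f' : E → E →L[ℝ] E} {s : Set E}
    (hs : MeasurableSet s) (hf : ∀ x ∈ s, HasFDerivAt f (f' x) x)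
    (hdet : ∀ x ∈ s, (f' x).det ≠ 0) {h : E → ℝ≥0∞} (hh : Measurable h) :
    ∫⁻ y, ∑' p, (s ∩ f ⁻¹' {y}).indicator h p ∂μ
      = ∫⁻ p in s, ENNReal.ofReal |(f' p).det| * h p ∂μ := by
  obtain ⟨t, hd, hm, hst, hinj⟩ := exists_partition_injOn hf hdet
  have hm' (n : ℕ) : MeasurableSet (s ∩ t n) := hs.inter (hm n)
  have hf' (n : ℕ) : ∀ x ∈ s ∩ t n, HasFDerivWithinAt f (f' x) (s ∩ t n) x :=
    fun x hx => (hf x hx.1).hasFDerivWithinAt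
  have hemb (n : ℕ) := measurableEmbedding_of_fderivWithin (hm' n) (hf' n) (hinj n)
  have hunion : s = ⋃ n, s ∩ t n := by rw [← Set.inter_iUnion, Set.inter_eq_left.2 hst]
  have hdisj : Pairwise (Function.onFun Disjoint fun n => s ∩ t n) :=
    fun i j hij => (hd hij).mono Set.inter_subset_right Set.inter_subset_right
  have hind (y p : E) : (s ∩ f ⁻¹' {y}).indicator h p
      = ∑' n, ((s ∩ t n) ∩ f ⁻¹' {y}).indicator h p := by
    have h1 : s ∩ f ⁻¹' {y} = ⋃ n, (s ∩ t n) ∩ f ⁻¹' {y} := by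
      rw [← Set.iUnion_inter, ← hunion]
    conv_lhs => rw [h1]
    have hdj : Pairwise (Function.onFun Disjoint fun n => (s ∩ t n) ∩ f ⁻¹' {y}) :=
      fun i j hij => (hdisj hij).mono Set.inter_subset_left Set.inter_subset_left
    by_cases hp : p ∈ ⋃ n, (s ∩ t n) ∩ f ⁻¹' {y}
    · obtain ⟨k, hk⟩ := Set.mem_iUnion.1 hp
      rw [Set.indicator_of_mem hp, tsum_eq_single k, Set.indicator_of_mem hk]
      intro j hj
      exact Set.indicator_of_notMem (fun hmem => Set.disjoint_left.1 (hdj hj) hmem hk) h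
    · rw [Set.indicator_of_notMem hp]
      symm
      refine ENNReal.tsum_eq_zero.2 fun n => Set.indicator_of_notMem (fun hmem => hp ?_) h
      exact Set.mem_iUnion.2 ⟨n, hmem⟩
  simp only [hind]
  have hswap (y : E) : ∑' p, ∑' n, ((s ∩ t n) ∩ f ⁻¹' {y}).indicator h p
      = ∑' n, Function.extend ((s ∩ t n).domRestrict f) (fun p => h p) 0 y := by
    rw [ENNReal.tsum_comm]
    exact tsum_congr fun n => tsum_indicator_fiber_of_injOn (hinj n) h y
  simp only [hswap]
  have hmeas (n : ℕ) : Measurable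
      (Function.extend ((s ∩ t n).domRestrict f) (fun p => h p) (0 : E → ℝ≥0∞)) :=
    (hemb n).measurable_extend (hh.comp measurable_subtype_coe) measurable_zero
  rw [lintegral_tsum fun n => (hmeas n).aemeasurable]
  conv_rhs => rw [hunion, lintegral_iUnion hm' hdisj]
  refine tsum_congr fun n => ?_
  set g := Function.extend ((s ∩ t n).domRestrict f) (fun p => h p) (0 : E → ℝ≥0∞) with hg
  have hsupp : ∀ y, y ∉ f '' (s ∩ t n) → g y = 0 := by
    intro y hy
    refine Function.extend_apply' _ _ _ ?_
    rintro ⟨p, rfl⟩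
    exact hy ⟨p, p.2, rfl⟩
  have himg : MeasurableSet (f '' (s ∩ t n)) :=
    measurable_image_of_fderivWithin (hm' n) (hf' n) (hinj n)
  have h1 : ∫⁻ y, g y ∂μ = ∫⁻ y in f '' (s ∩ t n), g y ∂μ := by
    rw [← lintegral_indicator himg]
    refine lintegral_congr fun y => ?_
    by_cases hy : y ∈ f '' (s ∩ t n)
    · rw [Set.indicator_of_mem hy]
    · rw [Set.indicator_of_notMem hy, hsupp y hy]
  rw [h1, lintegral_image_eq_lintegral_abs_det_fderiv_mul μ (hm' n) (hf' n) (hinj n)]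
  refine setLIntegral_congr_fun (hm' n) fun p hp => ?_
  have : g (f p) = h p := (hinj n).injective.extend_apply (fun p => h p) 0 ⟨p, hp⟩
  simp only [this]

end Area

/-! ### Parametrization of matrices by an eigenvalue and an eigenvector -/

section Param

variable {n : ℕ}

/-- Blocks of a bordered matrix: first column, and rest of the first row with the inner block. -/
abbrev Blocks (n : ℕ) : Type := (ℝ × (Fin n → ℝ)) × ((Fin n → ℝ) × (Fin n → Fin n → ℝ))

/-- The bordered array with given blocks. -/
def blockArray (y : Blocks n) : Fin (n + 1) → Fin (n + 1) → ℝ :=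
  borderedArray (y.1.1, y.2.1, y.1.2, y.2.2)

/-- The map `((x, q), (u, B)) ↦ ((x - u ⬝ᵥ q, x q - B q), (u, B))`, which gives the blocks of
`eigenMatrix x q u B`. -/
def eigenParam (p : Blocks n) : Blocks n :=
  ((p.1.1 - p.2.1 ⬝ᵥ p.1.2, p.1.1 • p.1.2 - Matrix.of p.2.2 *ᵥ p.1.2), p.2)

lemma of_blockArray_eigenParam (p : Blocks n) :
    Matrix.of (blockArray (eigenParam p)) = eigenMatrix p.1.1 p.1.2 p.2.1 (Matrix.of p.2.2) := rfl

lemma measurePreserving_blockArray : MeasurePreserving (blockArray (n := n)) volume volume := by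
  have e1 : MeasurePreserving (fun y : Blocks n => (y.1.1, (y.1.2, y.2))) volume volume :=
    volume_preserving_prodAssoc
  have e2 : MeasurePreserving (fun y : (Fin n → ℝ) × ((Fin n → ℝ) × (Fin n → Fin n → ℝ)) =>
      (y.2.1, (y.1, y.2.2))) volume volume := by
    have h1 : MeasurePreserving (fun y : (Fin n → ℝ) × ((Fin n → ℝ) × (Fin n → Fin n → ℝ)) =>
        ((y.1, y.2.1), y.2.2)) volume volume := volume_preserving_prodAssoc.symm
    have h2 : MeasurePreserving (fun y : ((Fin n → ℝ) × (Fin n → ℝ)) × (Fin n → Fin n → ℝ) =>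
        (y.1.swap, y.2)) volume volume :=
      (Measure.measurePreserving_swap (μ := (volume : Measure (Fin n → ℝ)))
        (ν := (volume : Measure (Fin n → ℝ)))).prod (MeasurePreserving.id _)
    have h3 : MeasurePreserving (fun y : ((Fin n → ℝ) × (Fin n → ℝ)) × (Fin n → Fin n → ℝ) =>
        (y.1.1, (y.1.2, y.2))) volume volume := volume_preserving_prodAssoc
    exact h3.comp (h2.comp h1)
  have e3 : MeasurePreserving (fun y : ℝ × ((Fin n → ℝ) × ((Fin n → ℝ) × (Fin n → Fin n → ℝ))) =>
      (y.1, (y.2.2.1, (y.2.1, y.2.2.2)))) volume volume := (MeasurePreserving.id _).prod e2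
  exact measurePreserving_borderedArray.comp (e3.comp e1)

lemma continuous_blockArray : Continuous (blockArray (n := n)) := by
  refine continuous_pi fun i => continuous_pi fun j => ?_
  refine Fin.cases ?_ (fun i => ?_) i <;> refine Fin.cases ?_ (fun j => ?_) j <;>
    simp only [blockArray, borderedArray, Matrix.of_symm_apply, bordered_zero_zero,
      bordered_zero_succ, bordered_succ_zero, bordered_succ_succ, Matrix.of_apply] <;> fun_prop

lemma blockArray_injective : Function.Injective (blockArray (n := n)) := by
  rintro ⟨⟨a, v⟩, u, B⟩ ⟨⟨a', v'⟩, u', B'⟩ h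
  have h0 := congrFun (congrFun h 0) 0
  have h1 (j : Fin n) := congrFun (congrFun h 0) j.succ
  have h2 (j : Fin n) := congrFun (congrFun h j.succ) 0
  have h3 (i j : Fin n) := congrFun (congrFun h i.succ) j.succ
  simp only [blockArray, borderedArray, Matrix.of_symm_apply, bordered_zero_zero,
      bordered_zero_succ, bordered_succ_zero, bordered_succ_succ, Matrix.of_apply] at h0 h1 h2 h3
  simp only [Prod.mk.injEq]
  exact ⟨⟨h0, funext h2⟩, funext h1, funext fun i => funext fun j => h3 i j⟩

lemma measurableEmbedding_blockArray : MeasurableEmbedding (blockArray (n := n)) :=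
  continuous_blockArray.measurableEmbedding blockArray_injective

lemma lintegral_blockArray (F : (Fin (n + 1) → Fin (n + 1) → ℝ) → ℝ≥0∞) :
    ∫⁻ X, F X = ∫⁻ y, F (blockArray (n := n) y) :=
  (measurePreserving_blockArray.lintegral_comp_emb measurableEmbedding_blockArray F).symm

/-- The derivative of `eigenParam`. -/
def eigenParamDeriv (p : Blocks n) : Blocks n →ₗ[ℝ] Blocks n where
  toFun d := ((d.1.1 - (p.2.1 ⬝ᵥ d.1.2 + d.2.1 ⬝ᵥ p.1.2),
    p.1.1 • d.1.2 + d.1.1 • p.1.2 - (Matrix.of p.2.2 *ᵥ d.1.2 + Matrix.of d.2.2 *ᵥ p.1.2)), d.2)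
  map_add' d e := by
    ext <;> simp [Matrix.mulVec_add, Matrix.add_mulVec, dotProduct_add, add_dotProduct,
      ← Matrix.of_add_of] <;> ring
  map_smul' c d := by
    ext <;> simp [Matrix.mulVec_smul, Matrix.smul_mulVec, ← Matrix.smul_of] <;> ring

lemma hasFDerivAt_eigenParam (p : Blocks n) :
    HasFDerivAt (eigenParam (n := n)) (LinearMap.toContinuousLinearMap (eigenParamDeriv p)) p := by
  have hx := (hasFDerivAt_id (𝕜 := ℝ) p).fst.fst
  have hq (i : Fin n) := hasFDerivAt_pi'.1 (hasFDerivAt_id (𝕜 := ℝ) p).fst.snd i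
  have hu (i : Fin n) := hasFDerivAt_pi'.1 (hasFDerivAt_id (𝕜 := ℝ) p).snd.fst i
  have hB (i j : Fin n) := hasFDerivAt_pi'.1 (hasFDerivAt_pi'.1
    (hasFDerivAt_id (𝕜 := ℝ) p).snd.snd i) j
  have h2 := (hasFDerivAt_id (𝕜 := ℝ) p).snd
  have ha := hx.sub (HasFDerivAt.fun_sum (u := Finset.univ) fun i _ => (hu i).mul (hq i))
  have hv := hasFDerivAt_pi.2 fun i => ((hx.mul (hq i)).sub
    (HasFDerivAt.fun_sum (u := Finset.univ) fun j _ => (hB i j).mul (hq j)))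
  refine HasFDerivAt.congr_fderiv ((ha.prodMk hv).prodMk h2) ?_
  ext d <;> simp [eigenParamDeriv, dotProduct, Matrix.mulVec, Finset.sum_add_distrib] <;>
    exact Finset.sum_congr rfl fun _ _ => mul_comm _ _

/-- In a product basis the matrix is block triangular with the identity as second diagonal block. -/
lemma det_prod_of_snd_eq {E F : Type*} [AddCommGroup E] [Module ℝ E] [AddCommGroup F] [Module ℝ F]
    [FiniteDimensional ℝ E] [FiniteDimensional ℝ F] (L : E × F →ₗ[ℝ] E × F)
    (hL : ∀ x, (L x).2 = x.2) :
    LinearMap.det L = LinearMap.det (LinearMap.fst ℝ E F ∘ₗ L ∘ₗ LinearMap.inl ℝ E F) := by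
  classical
  set b := Module.finBasis ℝ E
  set c := Module.finBasis ℝ F
  rw [← LinearMap.det_toMatrix (b.prod c) L, ← LinearMap.det_toMatrix b,
    ← Matrix.fromBlocks_toBlocks (LinearMap.toMatrix (b.prod c) (b.prod c) L)]
  have h21 : (LinearMap.toMatrix (b.prod c) (b.prod c) L).toBlocks₂₁ = 0 := by
    ext i j
    simp [Matrix.toBlocks₂₁, LinearMap.toMatrix_apply, hL]
  have h22 : (LinearMap.toMatrix (b.prod c) (b.prod c) L).toBlocks₂₂ = 1 := by
    ext i j
    simp [Matrix.toBlocks₂₂, LinearMap.toMatrix_apply, hL, Matrix.one_apply, Finsupp.single_apply,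
      eq_comm]
  rw [h21, h22, Matrix.det_fromBlocks_zero₂₁, Matrix.det_one, mul_one]
  congr 1
  ext i j
  simp [Matrix.toBlocks₁₁, LinearMap.toMatrix_apply]

/-- Since `(u, B)` is left fixed, only the block `[[1, -uᵀ], [q, x - B]]` in the variables `(x, q)`
counts. Its Schur complement is `x - B + q uᵀ = x - deflated q u B`. -/
lemma det_eigenParamDeriv (p : Blocks n) :
    LinearMap.det (eigenParamDeriv p) = (Matrix.scalar (Fin n) p.1.1
      - deflated p.1.2 p.2.1 (Matrix.of p.2.2)).det := by
  rw [det_prod_of_snd_eq _ fun _ => rfl]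
  set b := (Module.Basis.singleton Unit ℝ).prod (Pi.basisFun ℝ (Fin n))
  rw [← LinearMap.det_toMatrix b]
  have : LinearMap.toMatrix b b (LinearMap.fst ℝ _ _ ∘ₗ eigenParamDeriv p ∘ₗ LinearMap.inl ℝ _ _)
      = Matrix.fromBlocks 1 (-(Matrix.replicateRow Unit p.2.1)) (Matrix.replicateCol Unit p.1.2)
        (Matrix.scalar (Fin n) p.1.1 - Matrix.of p.2.2) := by
    ext i j
    rcases i with i | i <;> rcases j with j | j <;>
      simp [b, LinearMap.toMatrix_apply, eigenParamDeriv, Matrix.diagonal_apply, Pi.single_apply]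
  rw [this, Matrix.det_fromBlocks_one₁₁]
  congr 1
  ext i j
  simp [deflated, Matrix.mul_apply, Matrix.vecMulVec_apply]
  ring

end Param

/-! ### Generic matrices -/

section Generic

variable {n : ℕ}

/-- The matrix with rows `e₀ᵀ Xᵏ`. -/
def krylov {R : Type*} [CommRing R] (X : Matrix (Fin (n + 1)) (Fin (n + 1)) R) :
    Matrix (Fin (n + 1)) (Fin (n + 1)) R :=
  Matrix.of fun i j => (X ^ (i : ℕ)) 0 j

/-- Row `k` of the Krylov matrix maps `r` to `x^k r_0 = 0`, so `r` lies in its kernel. -/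
lemma krylov_det_eq_zero {X : Matrix (Fin (n + 1)) (Fin (n + 1)) ℝ} {x : ℝ} {r : Fin (n + 1) → ℝ}
    (hr : X *ᵥ r = x • r) (hr0 : r ≠ 0) (h0 : r 0 = 0) : (krylov X).det = 0 := by
  have hpow (k : ℕ) : X ^ k *ᵥ r = x ^ k • r := by
    induction k with
    | zero => simp
    | succ k ih =>
      rw [pow_succ, ← Matrix.mulVec_mulVec, hr, Matrix.mulVec_smul, ih, smul_smul, pow_succ']
  refine Matrix.exists_mulVec_eq_zero_iff.1 ⟨r, hr0, ?_⟩
  funext i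
  have := congrFun (hpow i) 0
  rw [Pi.smul_apply, h0, smul_zero] at this
  exact this

lemma krylov_smul (c : ℝ) (X : Matrix (Fin (n + 1)) (Fin (n + 1)) ℝ) :
    (krylov (c • X)).det = (∏ i : Fin (n + 1), c ^ (i : ℕ)) * (krylov X).det := by
  have : krylov (c • X) = Matrix.of fun (i j : Fin (n + 1)) => (c ^ (i : ℕ)) * krylov X i j := by
    ext i j
    simp [krylov, smul_pow]
  rw [this]
  exact Matrix.det_mul_column _ _

/-- The matrix of the shift `e₀ᵀ ↦ e₁ᵀ ↦ …`. -/
def shiftMatrix (n : ℕ) : Matrix (Fin (n + 1)) (Fin (n + 1)) ℝ :=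
  Matrix.of fun i j => if (i : ℕ) + 1 = j then 1 else 0

lemma krylov_shiftMatrix (n : ℕ) : krylov (shiftMatrix n) = 1 := by
  have h (k : ℕ) (hk : k < n + 1) (j : Fin (n + 1)) :
      (shiftMatrix n ^ k) 0 j = if k = (j : ℕ) then 1 else 0 := by
    induction k generalizing j with
    | zero => simp [Matrix.one_apply, Fin.ext_iff]
    | succ k ih =>
      have ih := ih (by omega)
      rw [pow_succ, Matrix.mul_apply, Finset.sum_eq_single ⟨k, by omega⟩]
      · rw [ih]
        simp [shiftMatrix]
      · intro i _ hi
        rw [ih, if_neg (fun h => hi (Fin.ext h.symm)), zero_mul]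
      · simp
  ext i j
  simp only [krylov, Matrix.of_apply, Matrix.one_apply, Fin.ext_iff]
  exact h i i.2 j

lemma continuous_det_krylov :
    Continuous fun X : Fin (n + 1) → Fin (n + 1) → ℝ => (krylov (Matrix.of X)).det := by
  refine Continuous.matrix_det (continuous_matrix fun i j => ?_)
  have h : Continuous fun X : Fin (n + 1) → Fin (n + 1) → ℝ => (Matrix.of X) ^ (i : ℕ) :=
    Continuous.pow (M := Matrix (Fin (n + 1)) (Fin (n + 1)) ℝ) continuous_id _
  exact h.matrix_elem 0 j

/-- The determinant is a polynomial in `ε`, equal to `1` at `ε = 0` because the Krylov matrix of the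
shift is the identity. -/
lemma finite_krylov_det_eq_zero (X : Matrix (Fin (n + 1)) (Fin (n + 1)) ℝ) :
    {ε : ℝ | (krylov (ε • X + shiftMatrix n)).det = 0}.Finite := by
  set M : Matrix (Fin (n + 1)) (Fin (n + 1)) (Polynomial ℝ) :=
    (Polynomial.X : Polynomial ℝ) • X.map Polynomial.C + (shiftMatrix n).map Polynomial.C with hM
  have hev (ε : ℝ) : (krylov M).det.eval ε = (krylov (ε • X + shiftMatrix n)).det := by
    have h1 : (Polynomial.evalRingHom ε).mapMatrix M = ε • X + shiftMatrix n := by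
      ext i j
      simp [hM]
      ring
    rw [← Polynomial.coe_evalRingHom, RingHom.map_det]
    congr 1
    ext i j
    rw [← h1]
    simp only [krylov, Matrix.of_apply, RingHom.mapMatrix_apply, Matrix.map_apply]
    rw [← RingHom.mapMatrix_apply, ← map_pow]
    rfl
  have hne : (krylov M).det ≠ 0 := by
    intro h
    have := hev 0
    rw [h] at this
    simp [krylov_shiftMatrix] at this
  refine (Polynomial.finite_setOfPred_isRoot hne).subset fun ε hε => ?_
  simpa [Polynomial.IsRoot, hev] using hε

/-- Every line in the direction of the shift matrix meets the zero set in finitely many points, so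
the zero set is null by Fubini's theorem. -/
lemma ae_krylov_det_ne_zero :
    ∀ᵐ X : Fin (n + 1) → Fin (n + 1) → ℝ, (krylov (Matrix.of X)).det ≠ 0 := by
  have hs : MeasurableSet {X : Fin (n + 1) → Fin (n + 1) → ℝ | (krylov (Matrix.of X)).det ≠ 0} :=
    (continuous_det_krylov.measurable (measurableSet_singleton 0)).compl
  refine ae_mem_of_ae_add_linearMap_mem
    (LinearMap.toSpanSingleton ℝ (Fin (n + 1) → Fin (n + 1) → ℝ) (Matrix.of.symm (shiftMatrix n)))
    volume volume hs fun X => ?_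
  have hfin := (finite_krylov_det_eq_zero (Matrix.of X)).image fun ε : ℝ => ε⁻¹
  have hnull : volume ({0} ∪ (fun ε : ℝ => ε⁻¹) ''
      {ε : ℝ | (krylov (ε • Matrix.of X + shiftMatrix n)).det = 0}) = 0 :=
    ((Set.finite_singleton 0).union hfin).measure_zero _
  filter_upwards [measure_eq_zero_iff_ae_notMem.1 hnull] with s hs
  simp only [Set.mem_union, Set.mem_singleton_iff, not_or] at hs
  intro h
  refine hs.2 ⟨s⁻¹, ?_, inv_inv s⟩
  -- The line `X + s S` is rescaled by `1 / s`, which by homogeneity does not affect the vanishing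
  -- of the Krylov determinant.
  have he : s⁻¹ • Matrix.of X + shiftMatrix n = s⁻¹ • (Matrix.of
      (X + LinearMap.toSpanSingleton ℝ (Fin (n + 1) → Fin (n + 1) → ℝ)
        (Matrix.of.symm (shiftMatrix n)) s)) := by
    ext i j
    simp [mul_add, hs.1]
  rw [Set.mem_ofPred_eq, he, krylov_smul, h, mul_zero]

instance isAddHaarMeasure_volume_blocks : (volume : Measure (Blocks n)).IsAddHaarMeasure := by
  have h1 : (volume : Measure (Fin n → Fin n → ℝ)).IsAddHaarMeasure :=
    Measure.pi.isAddHaarMeasure _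
  have h2 : (volume : Measure (ℝ × (Fin n → ℝ))).IsAddHaarMeasure :=
    Measure.prod.instIsAddHaarMeasure _ _
  have h3 : (volume : Measure ((Fin n → ℝ) × (Fin n → Fin n → ℝ))).IsAddHaarMeasure :=
    Measure.prod.instIsAddHaarMeasure _ _
  exact Measure.prod.instIsAddHaarMeasure _ _

/-- The parameters at which `eigenParam` is a local diffeomorphism. -/
def regularSet (n : ℕ) : Set (Blocks n) :=
  {p | (Matrix.scalar (Fin n) p.1.1 - deflated p.1.2 p.2.1 (Matrix.of p.2.2)).det ≠ 0}

lemma continuous_deflation : Continuous fun p : Blocks n =>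
    (Matrix.scalar (Fin n) p.1.1 - deflated p.1.2 p.2.1 (Matrix.of p.2.2)) := by
  refine continuous_matrix fun i j => ?_
  simp only [deflated, Matrix.sub_apply, Matrix.scalar_apply, Matrix.diagonal_apply,
    Matrix.vecMulVec_apply, Matrix.of_apply]
  split_ifs <;> fun_prop

lemma measurableSet_regularSet : MeasurableSet (regularSet n) :=
  (continuous_deflation.matrix_det.measurable (measurableSet_singleton 0)).compl

/-- Sard's lemma in equal dimensions: the image of the points where the Jacobian vanishes is a null
set. -/
lemma ae_fiber_subset_regularSet :
    ∀ᵐ y : Blocks n, ∀ p, eigenParam p = y → p ∈ regularSet n := by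
  have h : volume (eigenParam '' (regularSet n)ᶜ) = 0 := by
    refine addHaar_image_eq_zero_of_det_fderivWithin_eq_zero volume
      (fun p _ => (hasFDerivAt_eigenParam p).hasFDerivWithinAt) fun p hp => ?_
    have hp' : (Matrix.scalar (Fin n) p.1.1 - deflated p.1.2 p.2.1 (Matrix.of p.2.2)).det = 0 := by
      simpa [regularSet] using hp
    rw [← hp', ← det_eigenParamDeriv]
    rfl
  filter_upwards [measure_eq_zero_iff_ae_notMem.1 h] with y hy p hp
  by_contra hn
  exact hy ⟨p, hn, hp⟩

lemma ae_krylov_blockArray :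
    ∀ᵐ y : Blocks n, (krylov (Matrix.of (blockArray y))).det ≠ 0 :=
  measurePreserving_blockArray.quasiMeasurePreserving.ae ae_krylov_det_ne_zero

end Generic

/-! ### The sum over the eigenvalues as a sum over a fiber -/

section Fiber

variable {n : ℕ}

/-- The function of `((x, q), (u, B))` which equals `f (x, O - 1)`, `O` being the overlap of the
eigenvalue `x` of `eigenMatrix x q u B`. -/
def overlapTest (f : ℝ × ℝ → ℝ≥0∞) (p : Blocks n) : ℝ≥0∞ :=
  f (p.1.1, ((1 - p.1.2 ⬝ᵥ leftTail p.1.1 p.1.2 p.2.1 (Matrix.of p.2.2)) ^ 2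
    + leftTail p.1.1 p.1.2 p.2.1 (Matrix.of p.2.2) ⬝ᵥ leftTail p.1.1 p.1.2 p.2.1 (Matrix.of p.2.2))
    * (1 + p.1.2 ⬝ᵥ p.1.2) - 1)

lemma overlapTest_eq (f : ℝ × ℝ → ℝ≥0∞) {p : Blocks n} (hp : p ∈ regularSet n) :
    overlapTest f p
      = f (p.1.1, overlap (Matrix.of (blockArray (eigenParam p))) p.1.1 - 1) := by
  rw [of_blockArray_eigenParam, overlap_eigenMatrix _ _ _ _ hp]
  rfl

lemma measurable_leftTail :
    Measurable fun p : Blocks n => leftTail p.1.1 p.1.2 p.2.1 (Matrix.of p.2.2) := by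
  -- Cramer's rule, valid also for a singular matrix because both conventions then give the value
  -- zero.
  have h (p : Blocks n) : leftTail p.1.1 p.1.2 p.2.1 (Matrix.of p.2.2)
      = ((Matrix.scalar (Fin n) p.1.1 - deflated p.1.2 p.2.1 (Matrix.of p.2.2)).det)⁻¹
        • ((Matrix.scalar (Fin n) p.1.1
          - deflated p.1.2 p.2.1 (Matrix.of p.2.2)).adjugateᵀ *ᵥ p.2.1) := by
    rw [leftTail, Matrix.inv_def, Ring.inverse_eq_inv', Matrix.det_transpose,
      Matrix.adjugate_transpose, Matrix.smul_mulVec]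
  simp only [h]
  have h1 : Continuous fun p : Blocks n => (Matrix.scalar (Fin n) p.1.1
      - deflated p.1.2 p.2.1 (Matrix.of p.2.2)).adjugateᵀ *ᵥ p.2.1 :=
    continuous_deflation.matrix_adjugate.matrix_transpose.matrix_mulVec (by fun_prop)
  exact continuous_deflation.matrix_det.measurable.inv.smul h1.measurable

lemma measurable_overlapTest {f : ℝ × ℝ → ℝ≥0∞} (hf : Measurable f) :
    Measurable (overlapTest (n := n) f) := by
  have h1 := measurable_leftTail (n := n)
  have h2 (i : Fin n) := measurable_pi_iff.1 h1 i
  refine hf.comp ?_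
  simp only [dotProduct]
  fun_prop

/-- A root `x` comes from parameters with `charpoly = (X - x) * charpoly (deflated q u B)`.
Regularity says that `x` is not a root of the second factor, so its multiplicity is one. -/
lemma roots_charpoly_nodup {y : Blocks n} (hreg : ∀ p, eigenParam p = y → p ∈ regularSet n)
    (hroot : ∀ x ∈ (Matrix.of (blockArray y)).charpoly.roots, ∃ p, eigenParam p = y ∧ p.1.1 = x) :
    (Matrix.of (blockArray y)).charpoly.roots.Nodup := by
  classical
  refine Multiset.nodup_iff_count_le_one.2 fun x => ?_
  by_cases hx : x ∈ (Matrix.of (blockArray y)).charpoly.roots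
  · obtain ⟨p, rfl, rfl⟩ := hroot x hx
    have hne : (Matrix.of (blockArray (eigenParam p))).charpoly ≠ 0 :=
      (Matrix.charpoly_monic _).ne_zero
    rw [of_blockArray_eigenParam, charpoly_eigenMatrix] at hne ⊢
    rw [Polynomial.roots_mul hne, Polynomial.roots_X_sub_C, Multiset.count_add,
      Multiset.count_singleton_self]
    have h0 : Multiset.count p.1.1
        (deflated p.1.2 p.2.1 (Matrix.of p.2.2)).charpoly.roots = 0 := by
      refine Multiset.count_eq_zero.2 fun hmem => ?_
      have h1 := (Polynomial.mem_roots'.1 hmem).2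
      have h2 := hreg p rfl
      rw [Polynomial.IsRoot, Matrix.eval_charpoly] at h1
      exact h2 h1
    rw [h0]
  · rw [Multiset.count_eq_zero.2 hx]
    exact zero_le_one

/-- The Krylov condition allows every eigenvector to be scaled to first coordinate `1`. -/
lemma exists_eigenParam_eq {y : Blocks n} (hk : (krylov (Matrix.of (blockArray y))).det ≠ 0)
    {x : ℝ} (hx : x ∈ (Matrix.of (blockArray y)).charpoly.roots) :
    ∃ p, eigenParam p = y ∧ p.1.1 = x := by
  have h1 := (Polynomial.mem_roots'.1 hx).2
  obtain ⟨r, hr0, hr⟩ := (isRoot_charpoly_iff _ _).1 h1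
  have hr1 : r 0 ≠ 0 := fun h => hk (krylov_det_eq_zero hr hr0 h)
  have h2 : (Matrix.of (blockArray y)) *ᵥ (Fin.cons 1 (fun i => (r 0)⁻¹ * r i.succ) :
      Fin (n + 1) → ℝ) = x • (Fin.cons 1 (fun i => (r 0)⁻¹ * r i.succ) : Fin (n + 1) → ℝ) := by
    have h3 : (Fin.cons 1 (fun i => (r 0)⁻¹ * r i.succ) : Fin (n + 1) → ℝ) = (r 0)⁻¹ • r := by
      funext i
      refine Fin.cases ?_ (fun i => ?_) i <;> simp [hr1]
    rw [h3, Matrix.mulVec_smul, hr, smul_comm]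
  have h4 := eq_eigenMatrix_of_mulVec _ x _ h2
  refine ⟨((x, fun i => (r 0)⁻¹ * r i.succ), y.2), blockArray_injective ?_, rfl⟩
  refine Matrix.of.injective (Eq.trans ?_ h4.symm)
  rw [of_blockArray_eigenParam]
  rfl

/-- Two eigenvectors `(1, q)` and `(1, q')` for the same eigenvalue differ by one with vanishing
first coordinate, which the Krylov condition excludes. -/
lemma eigenParam_injOn {y p p' : Blocks n}
    (hk : (krylov (Matrix.of (blockArray y))).det ≠ 0) (hp : eigenParam p = y)
    (hp' : eigenParam p' = y) (h : p.1.1 = p'.1.1) : p = p' := by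
  have h2 : p.2 = p'.2 := by
    have h3 : (eigenParam p).2 = (eigenParam p').2 := by rw [hp, hp']
    exact h3
  have e1 := eigenMatrix_mulVec p.1.1 p.1.2 p.2.1 (Matrix.of p.2.2)
  have e2 := eigenMatrix_mulVec p'.1.1 p'.1.2 p'.2.1 (Matrix.of p'.2.2)
  rw [← of_blockArray_eigenParam, hp] at e1
  rw [← of_blockArray_eigenParam, hp', ← h] at e2
  have hq : p.1.2 = p'.1.2 := by
    by_contra hne
    refine hk (krylov_det_eq_zero (x := p.1.1)
      (r := (Fin.cons 1 p.1.2 : Fin (n + 1) → ℝ) - (Fin.cons 1 p'.1.2 : Fin (n + 1) → ℝ)) ?_ ?_ ?_)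
    · rw [Matrix.mulVec_sub, e1, e2, smul_sub]
    · intro h0
      refine hne (funext fun i => ?_)
      have := congrFun h0 i.succ
      simpa [sub_eq_zero] using this
    · simp
  exact Prod.ext (Prod.ext h hq) h2

/-- For a generic matrix the eigenvalue coordinate is a bijection from the fiber onto the set of
roots, and simplicity of the roots turns the multiset sum into a sum over that set. -/
lemma eigenSum_eq_tsum {f : ℝ × ℝ → ℝ≥0∞} {y : Blocks n}
    (hreg : ∀ p, eigenParam p = y → p ∈ regularSet n)
    (hk : (krylov (Matrix.of (blockArray y))).det ≠ 0) :
    eigenSum (Matrix.of (blockArray y)) f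
      = ∑' p, (regularSet n ∩ eigenParam ⁻¹' {y}).indicator (overlapTest f) p := by
  classical
  set X := Matrix.of (blockArray y) with hX
  set F : ℝ → ℝ≥0∞ := fun x => f (x, overlap X x - 1) with hF
  have hnd := roots_charpoly_nodup hreg fun x hx => exists_eigenParam_eq hk hx
  have hroot (p : Blocks n) (hp : eigenParam p = y) : p.1.1 ∈ X.charpoly.roots := by
    rw [Polynomial.mem_roots (Matrix.charpoly_monic _).ne_zero, hX, ← hp,
      of_blockArray_eigenParam, charpoly_eigenMatrix]
    simp
  have h1 : eigenSum X f = ∑ x ∈ X.charpoly.roots.toFinset, F x := by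
    rw [eigenSum, Finset.sum_eq_multiset_sum, Multiset.toFinset_val, hnd.dedup]
  have h2 : ∑' p, (regularSet n ∩ eigenParam ⁻¹' {y}).indicator (overlapTest f) p
      = ∑' p : (regularSet n ∩ eigenParam ⁻¹' {y} : Set (Blocks n)), F p.1.1.1 := by
    rw [← tsum_subtype]
    refine tsum_congr fun p => ?_
    have hp : eigenParam p.1 = y := p.2.2
    rw [overlapTest_eq f p.2.1, hF, hX, hp]
  let e : (regularSet n ∩ eigenParam ⁻¹' {y} : Set (Blocks n)) ≃ X.charpoly.roots.toFinset :=
    Equiv.ofBijective (fun p => ⟨p.1.1.1, Multiset.mem_toFinset.2 (hroot p.1 p.2.2)⟩) <| by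
      refine ⟨fun p p' h => Subtype.ext (eigenParam_injOn hk p.2.2 p'.2.2 ?_), fun x => ?_⟩
      · exact congrArg (fun z => z.1) h
      · obtain ⟨p, hp, hpx⟩ := exists_eigenParam_eq hk (Multiset.mem_toFinset.1 x.2)
        exact ⟨⟨p, hreg p hp, hp⟩, Subtype.ext hpx⟩
  rw [h1, h2, ← Finset.tsum_subtype, ← e.tsum_eq]
  rfl

end Fiber

/-! ### Radial integrals -/

section Radial

lemma lintegral_fun_norm {E : Type*} [NormedAddCommGroup E] [NormedSpace ℝ E]
    [FiniteDimensional ℝ E] [Nontrivial E] [MeasurableSpace E] [BorelSpace E] (μ : Measure E)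
    [μ.IsAddHaarMeasure] {f : ℝ → ℝ≥0∞} (hf : Measurable f) :
    ∫⁻ x, f ‖x‖ ∂μ = Module.finrank ℝ E * μ (Metric.ball 0 1)
      * ∫⁻ y in Set.Ioi (0 : ℝ), ENNReal.ofReal (y ^ (Module.finrank ℝ E - 1)) * f y := by
  calc
    ∫⁻ x, f ‖x‖ ∂μ = ∫⁻ x : ({(0)}ᶜ : Set E), f ‖x.1‖ ∂(μ.comap (↑)) := by
      rw [lintegral_subtype_comap (measurableSet_singleton _).compl fun x => f ‖x‖,
        restrict_compl_singleton]
    _ = ∫⁻ x, f x.2 ∂μ.toSphere.prod (.volumeIoiPow (Module.finrank ℝ E - 1)) := by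
      rw [← μ.measurePreserving_homeomorphUnitSphereProd.lintegral_comp_emb
        (Homeomorph.measurableEmbedding _)]
      simp
    _ = μ.toSphere Set.univ
        * ∫⁻ x : Set.Ioi (0 : ℝ), f x ∂.volumeIoiPow (Module.finrank ℝ E - 1) := by
      rw [lintegral_prod _ (by fun_prop)]
      simp only
      rw [lintegral_const, mul_comm]
    _ = _ := by
      rw [Measure.volumeIoiPow, lintegral_withDensity_eq_lintegral_mul _ (by fun_prop)
        (by fun_prop), Measure.toSphere_apply_univ]
      congr 1
      exact lintegral_subtype_comap measurableSet_Ioi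
        fun a => ENNReal.ofReal (a ^ (Module.finrank ℝ E - 1)) * f a

lemma lintegral_sq_Ioi (G : ℝ → ℝ≥0∞) :
    ∫⁻ t in Set.Ioi (0 : ℝ), G t = ∫⁻ y in Set.Ioi (0 : ℝ), ENNReal.ofReal (2 * y) * G (y ^ 2) := by
  have himg : (fun y : ℝ => y ^ 2) '' Set.Ioi 0 = Set.Ioi 0 := by
    ext t
    refine ⟨?_, fun ht => ⟨√t, Real.sqrt_pos.2 ht, Real.sq_sqrt (le_of_lt ht)⟩⟩
    rintro ⟨y, hy, rfl⟩
    exact pow_pos (Set.mem_Ioi.1 hy) 2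
  have hinj : Set.InjOn (fun y : ℝ => y ^ 2) (Set.Ioi 0) := fun a ha b hb h =>
    (pow_left_inj₀ (le_of_lt ha) (le_of_lt hb) two_ne_zero).1 h
  conv_lhs => rw [← himg]
  rw [lintegral_image_eq_lintegral_abs_deriv_mul measurableSet_Ioi
    (f' := fun y => 2 * y) (fun y _ => ?_) hinj]
  · refine setLIntegral_congr_fun measurableSet_Ioi fun y hy => ?_
    have hy : (0 : ℝ) < y := hy
    simp only [abs_of_pos (by positivity : 0 < 2 * y)]
  · simpa using (hasDerivAt_pow 2 y).hasDerivWithinAt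

/-- The constant in the radial integration formula in dimension `n`. -/
def radialConst (n : ℕ) : ℝ := √Real.pi ^ n / Real.Gamma (n / 2)

lemma radialConst_pos (m : ℕ) : 0 < radialConst (m + 1) :=
  div_pos (by positivity) (Real.Gamma_pos_of_pos (by positivity))

/-- Polar coordinates with `t = |w|²`; the Jacobian of the square root makes the constant half the
area of the unit sphere. -/
lemma lintegral_dotProduct_self (m : ℕ) {g : ℝ → ℝ≥0∞} (hg : Measurable g) :
    ∫⁻ w : Fin (m + 1) → ℝ, g (w ⬝ᵥ w)
      = ENNReal.ofReal (radialConst (m + 1))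
        * ∫⁻ t in Set.Ioi (0 : ℝ), g t * ENNReal.ofReal (t ^ (((m + 1 : ℕ) : ℝ) / 2 - 1)) := by
  have h1 : ∫⁻ w : Fin (m + 1) → ℝ, g (w ⬝ᵥ w)
      = ∫⁻ x : EuclideanSpace ℝ (Fin (m + 1)), g (‖x‖ ^ 2) := by
    rw [← (PiLp.volume_preserving_ofLp (Fin (m + 1))).lintegral_comp_emb
      (MeasurableEquiv.toLp 2 (Fin (m + 1) → ℝ)).symm.measurableEmbedding]
    refine lintegral_congr fun x => ?_
    rw [EuclideanSpace.real_norm_sq_eq]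
    simp [dotProduct, pow_two]
  have h2 := lintegral_fun_norm (volume : Measure (EuclideanSpace ℝ (Fin (m + 1))))
    (f := fun y => g (y ^ 2)) (by fun_prop)
  rw [h1, h2, lintegral_sq_Ioi (fun t => g t * _), EuclideanSpace.volume_ball]
  simp only [finrank_euclideanSpace, Fintype.card_fin, Nat.add_sub_cancel, ENNReal.ofReal_one,
    one_pow, one_mul]
  have h3 : ∀ y ∈ Set.Ioi (0 : ℝ),
      ENNReal.ofReal (2 * y) * (g (y ^ 2) * ENNReal.ofReal ((y ^ 2) ^ (((m + 1 : ℕ) : ℝ) / 2 - 1)))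
        = ENNReal.ofReal 2 * (ENNReal.ofReal (y ^ m) * g (y ^ 2)) := by
    intro y hy
    have hy : (0 : ℝ) < y := hy
    have e1 : (2 * y) * (y ^ 2) ^ (((m + 1 : ℕ) : ℝ) / 2 - 1) = 2 * y ^ m := by
      rw [← Real.rpow_natCast y 2, ← Real.rpow_mul hy.le, ← Real.rpow_natCast y m, mul_assoc]
      have e2 := Real.rpow_add hy 1 ((2 : ℕ) * (((m + 1 : ℕ) : ℝ) / 2 - 1))
      rw [Real.rpow_one] at e2
      rw [← e2]
      congr 2
      push_cast
      ring
    rw [mul_left_comm, ← ENNReal.ofReal_mul (by positivity), e1, ENNReal.ofReal_mul (by norm_num)]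
    ring
  rw [setLIntegral_congr_fun measurableSet_Ioi h3, lintegral_const_mul' _ _ (by finiteness),
    ← mul_assoc, ← ENNReal.ofReal_mul (radialConst_pos m).le]
  congr 1
  have h4 : Real.Gamma (((m + 1 : ℕ) : ℝ) / 2 + 1)
      = ((m + 1 : ℕ) : ℝ) / 2 * Real.Gamma (((m + 1 : ℕ) : ℝ) / 2) :=
    Real.Gamma_add_one (by positivity)
  have h5 : 0 < Real.Gamma (((m + 1 : ℕ) : ℝ) / 2) := Real.Gamma_pos_of_pos (by positivity)
  rw [← ENNReal.ofReal_natCast (m + 1), ← ENNReal.ofReal_mul (by positivity), radialConst, h4]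
  congr 1
  have : ((m + 1 : ℕ) : ℝ) ≠ 0 := by positivity
  field_simp

lemma lintegral_rpow_mul_exp_neg_mul {a r : ℝ} (ha : 0 < a) (hr : 0 < r) :
    ∫⁻ s in Set.Ioi (0 : ℝ), ENNReal.ofReal (s ^ (a - 1) * Real.exp (-(r * s)))
      = ENNReal.ofReal ((1 / r) ^ a * Real.Gamma a) := by
  have hpos : 0 < (1 / r) ^ a * Real.Gamma a :=
    mul_pos (by positivity) (Real.Gamma_pos_of_pos ha)
  rw [← Real.integral_rpow_mul_exp_neg_mul_Ioi ha hr, ofReal_integral_eq_lintegral_ofReal]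
  -- The integral of a non-integrable function is zero by convention, so the known positive value
  -- certifies integrability.
  · by_contra h
    have := integral_undef h
    rw [Real.integral_rpow_mul_exp_neg_mul_Ioi ha hr] at this
    exact hpos.ne' this
  · refine (ae_restrict_iff' measurableSet_Ioi).2 (ae_of_all _ fun s hs => ?_)
    have hs : (0 : ℝ) < s := hs
    show 0 ≤ s ^ (a - 1) * Real.exp (-(r * s))
    positivity

/-- With `a = (n + 1) / 2`, the power `(1 + |q|²)^(-a)` is a Gamma integral in `s`. The Gaussian
integral over `q` then gives `(π / s)^(n/2)`, and the remaining integral in `s` is `Γ(1/2) = √π`. -/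
lemma lintegral_one_add_dotProduct (n : ℕ) :
    ∫⁻ q : Fin n → ℝ, ENNReal.ofReal ((√(1 + q ⬝ᵥ q) ^ (n + 1))⁻¹)
      = ENNReal.ofReal (radialConst (n + 1)) := by
  set a : ℝ := ((n + 1 : ℕ) : ℝ) / 2 with ha
  have ha0 : 0 < a := by positivity
  have hG : 0 < Real.Gamma a := Real.Gamma_pos_of_pos ha0
  have hdot : Measurable fun q : Fin n → ℝ => q ⬝ᵥ q := by
    simp only [dotProduct]; fun_prop
  have hnn (q : Fin n → ℝ) : 0 < 1 + q ⬝ᵥ q := by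
    have : 0 ≤ q ⬝ᵥ q := Finset.sum_nonneg fun i _ => mul_self_nonneg _
    linarith
  have h1 (q : Fin n → ℝ) : ENNReal.ofReal (Real.Gamma a)
        * ENNReal.ofReal ((√(1 + q ⬝ᵥ q) ^ (n + 1))⁻¹)
      = ∫⁻ s in Set.Ioi (0 : ℝ), ENNReal.ofReal (s ^ (a - 1) * Real.exp (-((1 + q ⬝ᵥ q) * s))) := by
    rw [lintegral_rpow_mul_exp_neg_mul ha0 (hnn q), ← ENNReal.ofReal_mul hG.le]
    congr 1
    rw [one_div, Real.inv_rpow (hnn q).le, Real.sqrt_eq_rpow, ← Real.rpow_natCast,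
      ← Real.rpow_mul (hnn q).le, mul_comm]
    congr 3
    rw [ha]; ring
  have h2 (s : ℝ) (hs : 0 < s) :
      ∫⁻ q : Fin n → ℝ, ENNReal.ofReal (s ^ (a - 1) * Real.exp (-((1 + q ⬝ᵥ q) * s)))
      = ENNReal.ofReal (√Real.pi ^ n)
        * ENNReal.ofReal (s ^ ((1 / 2 : ℝ) - 1) * Real.exp (-(1 * s))) := by
    have h := lintegral_gaussian_vector (n := n) (F := fun _ => 1) measurable_const
      (c := 1 / (2 * s)) (by positivity)
    simp only [one_mul, lintegral_const, measure_univ, mul_one] at h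
    have e1 (q : Fin n → ℝ) : ENNReal.ofReal (s ^ (a - 1) * Real.exp (-((1 + q ⬝ᵥ q) * s)))
        = ENNReal.ofReal (s ^ (a - 1) * Real.exp (-s))
          * ENNReal.ofReal (Real.exp (-(q ⬝ᵥ q) / (2 * (1 / (2 * s))))) := by
      rw [← ENNReal.ofReal_mul (by positivity), mul_assoc, ← Real.exp_add]
      congr 3
      field_simp
      ring
    simp only [e1]
    rw [lintegral_const_mul' _ _ (by finiteness), h, ← ENNReal.ofReal_mul (by positivity),
      ← ENNReal.ofReal_mul (by positivity)]
    congr 1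
    have e2 : 2 * Real.pi * (1 / (2 * s)) = Real.pi * s⁻¹ := by field_simp
    have e3 : √(s⁻¹) ^ n = s ^ (-(n : ℝ) / 2) := by
      rw [Real.sqrt_eq_rpow, ← Real.rpow_natCast, ← Real.rpow_mul (by positivity),
        Real.inv_rpow hs.le, ← Real.rpow_neg hs.le]
      congr 1
      ring
    rw [e2, Real.sqrt_mul Real.pi_pos.le, mul_pow, e3, one_mul]
    have e4 : s ^ (a - 1) * s ^ (-(n : ℝ) / 2) = s ^ ((1 / 2 : ℝ) - 1) := by
      rw [← Real.rpow_add hs, ha]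
      congr 1
      push_cast
      ring
    linear_combination √Real.pi ^ n * Real.exp (-s) * e4
  have hmul : ENNReal.ofReal (Real.Gamma a)
        * ∫⁻ q : Fin n → ℝ, ENNReal.ofReal ((√(1 + q ⬝ᵥ q) ^ (n + 1))⁻¹)
      = ENNReal.ofReal (√Real.pi ^ n) * ENNReal.ofReal √Real.pi := by
    rw [← lintegral_const_mul' _ _ (by finiteness)]
    simp only [h1]
    rw [lintegral_lintegral_swap, setLIntegral_congr_fun measurableSet_Ioi h2,
      lintegral_const_mul' _ _ (by finiteness),
      lintegral_rpow_mul_exp_neg_mul (by norm_num) one_pos, Real.Gamma_one_half_eq]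
    · norm_num
    · refine Measurable.aemeasurable ?_
      simp only [Function.uncurry_def]
      fun_prop
  rw [← ENNReal.ofReal_mul (by positivity), ← pow_succ] at hmul
  rw [radialConst, ENNReal.ofReal_div_of_pos hG, ← hmul]
  rw [mul_comm, ENNReal.mul_div_cancel_right (by simpa using hG) (by finiteness)]

end Radial

/-! ### Reduction of the eigenvalue sum to upper triangular blocks -/

section Reduction

variable {n : ℕ} {τ : ℝ}

/-- The integrand in the parameters `((x, q), (u, B))` of the expected sum over the eigenvalues. -/
def eigenIntegrand (τ : ℝ) (f : ℝ × ℝ → ℝ≥0∞) (p : Blocks n) : ℝ≥0∞ :=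
  ENNReal.ofReal |(Matrix.scalar (Fin n) p.1.1 - deflated p.1.2 p.2.1 (Matrix.of p.2.2)).det|
    * (overlapTest f p
      * ENNReal.ofReal (weight τ (eigenMatrix p.1.1 p.1.2 p.2.1 (Matrix.of p.2.2))))

lemma continuous_eigenParam : Continuous (eigenParam (n := n)) :=
  continuous_iff_continuousAt.2 fun p => (hasFDerivAt_eigenParam p).continuousAt

lemma measurable_weight_eigenMatrix (τ : ℝ) : Measurable fun p : Blocks n =>
    ENNReal.ofReal (weight τ (eigenMatrix p.1.1 p.1.2 p.2.1 (Matrix.of p.2.2))) := by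
  simp only [← of_blockArray_eigenParam]
  exact ((measurable_weight τ).comp
    (continuous_blockArray.comp continuous_eigenParam).measurable).ennreal_ofReal

lemma measurable_eigenIntegrand (τ : ℝ) {f : ℝ × ℝ → ℝ≥0∞} (hf : Measurable f) :
    Measurable (eigenIntegrand (n := n) τ f) := by
  have h1 := continuous_deflation (n := n).matrix_det.measurable.abs.ennreal_ofReal
  exact h1.mul ((measurable_overlapTest hf).mul (measurable_weight_eigenMatrix τ))

/-- The eigenvalue sum of almost every matrix is a sum over the fiber of `eigenParam`, to which the
area formula applies. -/
lemma lintegral_eigenSum (hτ₀ : 0 ≤ τ) (hτ₁ : τ < 1) {f : ℝ × ℝ → ℝ≥0∞} (hf : Measurable f) :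
    ∫⁻ X, eigenSum (Matrix.of X) f ∂ensemble τ (n + 1)
      = ENNReal.ofReal (normConst τ (n + 1))⁻¹ * ∫⁻ p : Blocks n, eigenIntegrand τ f p := by
  rw [lintegral_ensemble hτ₀ hτ₁, lintegral_blockArray]
  congr 1
  set h : Blocks n → ℝ≥0∞ := fun p => overlapTest f p
      * ENNReal.ofReal (weight τ (eigenMatrix p.1.1 p.1.2 p.2.1 (Matrix.of p.2.2))) with hh
  have hm : Measurable h := (measurable_overlapTest hf).mul (measurable_weight_eigenMatrix τ)
  have hdet (p : Blocks n) : (LinearMap.toContinuousLinearMap (eigenParamDeriv p)).det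
      = (Matrix.scalar (Fin n) p.1.1 - deflated p.1.2 p.2.1 (Matrix.of p.2.2)).det :=
    det_eigenParamDeriv p
  have harea := lintegral_tsum_indicator_fiber (volume : Measure (Blocks n))
    measurableSet_regularSet (fun p _ => hasFDerivAt_eigenParam p)
    (fun p hp => by rw [hdet]; exact hp) hm
  have h1 : ∫⁻ y : Blocks n, eigenSum (Matrix.of (blockArray y)) f
        * ENNReal.ofReal (weight τ (Matrix.of (blockArray y)))
      = ∫⁻ y, ∑' p, (regularSet n ∩ eigenParam ⁻¹' {y}).indicator h p := by
    refine lintegral_congr_ae ?_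
    filter_upwards [ae_fiber_subset_regularSet (n := n), ae_krylov_blockArray (n := n)]
      with y hreg hk
    rw [eigenSum_eq_tsum hreg hk, ← ENNReal.tsum_mul_right]
    refine tsum_congr fun p => ?_
    by_cases hp : p ∈ regularSet n ∩ eigenParam ⁻¹' {y}
    · have hpy : eigenParam p = y := hp.2
      rw [Set.indicator_of_mem hp, Set.indicator_of_mem hp, hh, ← hpy, of_blockArray_eigenParam]
    · rw [Set.indicator_of_notMem hp, Set.indicator_of_notMem hp, zero_mul]
  rw [h1, harea, ← lintegral_indicator measurableSet_regularSet]
  refine lintegral_congr fun p => ?_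
  by_cases hp : p ∈ regularSet n
  · rw [Set.indicator_of_mem hp, hdet]
    rfl
  -- Critical parameters contribute nothing, since the Jacobian factor of the integrand vanishes
  -- there.
  · rw [Set.indicator_of_notMem hp, eigenIntegrand]
    have : (Matrix.scalar (Fin n) p.1.1 - deflated p.1.2 p.2.1 (Matrix.of p.2.2)).det = 0 := by
      simpa [regularSet] using hp
    rw [this, abs_zero, ENNReal.ofReal_zero, zero_mul]

/-- The Householder reflection along `w - x` exchanges two vectors of equal length. -/
lemma exists_orthogonal_mulVec_eq {x w : Fin n → ℝ} (h : x ⬝ᵥ x = w ⬝ᵥ w) :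
    ∃ Q : Matrix (Fin n) (Fin n) ℝ, Qᵀ * Q = 1 ∧ Q *ᵥ x = w := by
  by_cases hd : w - x = 0
  · exact ⟨1, by simp, by rw [Matrix.one_mulVec]; exact (sub_eq_zero.1 hd).symm⟩
  set d := w - x with hdd
  have hd0 : d ⬝ᵥ d ≠ 0 := fun h0 => hd (dotProduct_self_eq_zero.1 h0)
  set c := 2 / (d ⬝ᵥ d) with hc
  have hcd : c * (d ⬝ᵥ d) = 2 := div_mul_cancel₀ _ hd0
  have hdx : d ⬝ᵥ d = -2 * (d ⬝ᵥ x) := by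
    rw [hdd, sub_dotProduct, dotProduct_sub, dotProduct_sub, sub_dotProduct, dotProduct_comm x w]
    linarith
  refine ⟨1 - c • Matrix.vecMulVec d d, ?_, ?_⟩
  · rw [Matrix.transpose_sub, Matrix.transpose_one, Matrix.transpose_smul,
      Matrix.transpose_vecMulVec, sub_mul, mul_sub, mul_sub]
    simp only [Matrix.one_mul, Matrix.mul_one, Matrix.smul_mul, Matrix.mul_smul,
      Matrix.vecMulVec_mul_vecMulVec, Matrix.vecMulVec_smul, smul_smul]
    rw [hcd, mul_two, add_smul]
    abel
  · rw [Matrix.sub_mulVec, Matrix.one_mulVec, Matrix.smul_mulVec, Matrix.vecMulVec_mulVec]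
    have : c * (d ⬝ᵥ x) = -1 := by linarith [hcd, congrArg (c * ·) hdx]
    funext i
    simp only [Pi.sub_apply, Pi.smul_apply, smul_eq_mul, MulOpposite.smul_eq_mul_unop,
      MulOpposite.unop_op, hdd] at this ⊢
    linear_combination (-(w i - x i)) * this

/-- The pair `(u, B)` for which `eigenMatrix x q u B = x + Z [-q, 1]`. -/
def shiftedRows (x : ℝ) (Z : Fin (n + 1) → Fin n → ℝ) : (Fin n → ℝ) × (Fin n → Fin n → ℝ) :=
  (Z 0, fun i j => Z i.succ j + if i = j then x else 0)

lemma measurePreserving_shiftedRows (x : ℝ) :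
    MeasurePreserving (shiftedRows (n := n) x) volume volume := by
  have h1 : MeasurePreserving (fun Z : Fin (n + 1) → Fin n → ℝ => (Z 0, fun i : Fin n => Z i.succ))
      volume volume := by
    have h := measurePreserving_piFinSuccAbove
      (fun _ : Fin (n + 1) => (volume : Measure (Fin n → ℝ))) 0
    exact h
  have : (volume : Measure (Fin n → Fin n → ℝ)).IsAddHaarMeasure := Measure.pi.isAddHaarMeasure _
  have h2 := measurePreserving_add_right (volume : Measure (Fin n → Fin n → ℝ))
    (fun i j => if i = j then x else 0)
  exact ((MeasurePreserving.id (volume : Measure (Fin n → ℝ))).prod h2).comp h1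

/-- The matrix `[-q, 1]`. -/
def quotientMatrix (q : Fin n → ℝ) : Matrix (Fin n) (Fin (n + 1)) ℝ :=
  Matrix.of fun i => Fin.cons (-q i) ((1 : Matrix (Fin n) (Fin n) ℝ) i)

/-- The rows of `[-q, 1]` annihilate `(1, q)`. With `x` and `q` fixed, the matrix is thus affine in
a free `(n + 1) × n` array `Z`, on which multiplication from either side acts linearly. -/
lemma eigenMatrix_shiftedRows (x : ℝ) (q : Fin n → ℝ) (Z : Fin (n + 1) → Fin n → ℝ) :
    eigenMatrix x q (shiftedRows x Z).1 (Matrix.of (shiftedRows x Z).2)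
      = Matrix.scalar (Fin (n + 1)) x + Matrix.of Z * quotientMatrix q := by
  ext i j
  refine Fin.cases ?_ (fun i => ?_) i <;> refine Fin.cases ?_ (fun j => ?_) j
  · simp [eigenMatrix, shiftedRows, quotientMatrix, Matrix.mul_apply, dotProduct, sub_eq_add_neg]
  · simp [eigenMatrix, shiftedRows, quotientMatrix, Matrix.mul_apply, Matrix.one_apply,
      (Fin.succ_ne_zero j).symm]
  · simp [eigenMatrix, shiftedRows, quotientMatrix, Matrix.mul_apply, Matrix.mulVec, dotProduct,
      add_mul, Finset.sum_add_distrib]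
  · simp [eigenMatrix, shiftedRows, quotientMatrix, Matrix.mul_apply, Matrix.one_apply,
      Matrix.diagonal_apply, add_comm]

lemma quotientMatrix_mulVec (q : Fin n → ℝ) :
    quotientMatrix q *ᵥ (Fin.cons 1 q : Fin (n + 1) → ℝ) = 0 := by
  funext i
  simp [quotientMatrix, Matrix.mulVec, dotProduct, Fin.sum_univ_succ, Matrix.one_apply]

lemma quotientMatrix_mul_transpose (q : Fin n → ℝ) :
    quotientMatrix q * (quotientMatrix q)ᵀ = 1 + Matrix.vecMulVec q q := by
  ext i j
  simp [quotientMatrix, Matrix.mul_apply, Fin.sum_univ_succ, Matrix.one_apply,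
    Matrix.vecMulVec_apply, add_comm]

/-- Where the Jacobian does not vanish, the integrand is a function of `x`, the characteristic
polynomial, the overlap and the weight, all invariant under orthogonal conjugation. -/
lemma eigenIntegrand_eq_of_orthogonal {f : ℝ × ℝ → ℝ≥0∞} {p p' : Blocks n}
    {Q : Matrix (Fin (n + 1)) (Fin (n + 1)) ℝ} (hQ : Qᵀ * Q = 1) (hx : p.1.1 = p'.1.1)
    (h : eigenMatrix p.1.1 p.1.2 p.2.1 (Matrix.of p.2.2)
      = Q * eigenMatrix p'.1.1 p'.1.2 p'.2.1 (Matrix.of p'.2.2) * Qᵀ) :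
    eigenIntegrand τ f p = eigenIntegrand τ f p' := by
  have hQ' : Q * Qᵀ = 1 := mul_eq_one_comm.1 hQ
  have hch : (deflated p.1.2 p.2.1 (Matrix.of p.2.2)).charpoly
      = (deflated p'.1.2 p'.2.1 (Matrix.of p'.2.2)).charpoly := by
    let S : (Matrix (Fin (n + 1)) (Fin (n + 1)) ℝ)ˣ := ⟨Q, Qᵀ, hQ', hQ⟩
    have h1 := Matrix.charpoly_units_conj S (eigenMatrix p'.1.1 p'.1.2 p'.2.1 (Matrix.of p'.2.2))
    rw [← Matrix.coe_units_inv] at h1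
    have h2 : (eigenMatrix p.1.1 p.1.2 p.2.1 (Matrix.of p.2.2)).charpoly
        = (eigenMatrix p'.1.1 p'.1.2 p'.2.1 (Matrix.of p'.2.2)).charpoly := by
      rw [h, ← h1]; rfl
    rw [charpoly_eigenMatrix, charpoly_eigenMatrix, hx] at h2
    exact mul_left_cancel₀ (Polynomial.X_sub_C_ne_zero _) h2
  have hdet : (Matrix.scalar (Fin n) p.1.1 - deflated p.1.2 p.2.1 (Matrix.of p.2.2)).det
      = (Matrix.scalar (Fin n) p'.1.1 - deflated p'.1.2 p'.2.1 (Matrix.of p'.2.2)).det := by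
    rw [← Matrix.eval_charpoly, ← Matrix.eval_charpoly, hch, hx]
  -- The formula identifying `overlapTest` with the true overlap needs a nonzero determinant; in the
  -- other case both integrands vanish.
  by_cases h0 : (Matrix.scalar (Fin n) p'.1.1 - deflated p'.1.2 p'.2.1 (Matrix.of p'.2.2)).det = 0
  · rw [eigenIntegrand, eigenIntegrand, hdet, h0]
    simp
  · have hp' : p' ∈ regularSet n := h0
    have hp : p ∈ regularSet n := by
      have : (Matrix.scalar (Fin n) p.1.1 - deflated p.1.2 p.2.1 (Matrix.of p.2.2)).det ≠ 0 := by
        rwa [hdet]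
      exact this
    rw [eigenIntegrand, eigenIntegrand, hdet, overlapTest_eq f hp, overlapTest_eq f hp',
      of_blockArray_eigenParam, of_blockArray_eigenParam, h, weight_orthogonal_conj τ hQ,
      overlap_orthogonal_conj _ _ hQ, hx]

/-- Let `Q` be orthogonal with `Q (√(1 + |q|²) e_0) = (1, q)`. Then `[-q, 1] Q = K₀ [0, 1]` with `K₀
K₀ᵀ = 1 + q qᵀ`, so `|det K₀| = √(1 + |q|²)`. Replacing `Z` by `Q Z K₀⁻¹` turns the matrix into the
conjugate by `Q` of one with `q = 0`; as `Z` has `n + 1` rows, the Jacobian is `|det K₀|^(-(n+1))`.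
-/
lemma lintegral_eigenIntegrand_rotate {f : ℝ × ℝ → ℝ≥0∞} (hf : Measurable f) (x : ℝ)
    (q : Fin n → ℝ) :
    ∫⁻ z, eigenIntegrand τ f ((x, q), z)
      = ENNReal.ofReal ((√(1 + q ⬝ᵥ q) ^ (n + 1))⁻¹) * ∫⁻ z, eigenIntegrand τ f ((x, (0 : Fin n → ℝ)), z) := by
  have hnn : 0 < 1 + q ⬝ᵥ q := by
    have : 0 ≤ q ⬝ᵥ q := Finset.sum_nonneg fun i _ => mul_self_nonneg _
    linarith
  have hm := measurable_eigenIntegrand (n := n) τ hf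
  have hZ (q : Fin n → ℝ) : ∫⁻ z, eigenIntegrand τ f ((x, q), z)
      = ∫⁻ Z, eigenIntegrand τ f ((x, q), shiftedRows x Z) := by
    exact ((measurePreserving_shiftedRows x).lintegral_comp
      (hm.comp measurable_prodMk_left)).symm
  obtain ⟨Q, hQ, hQr⟩ := exists_orthogonal_mulVec_eq
    (x := (Fin.cons √(1 + q ⬝ᵥ q) 0 : Fin (n + 1) → ℝ)) (w := Fin.cons 1 q) (by
      simp only [dotProduct, Fin.sum_univ_succ, Fin.cons_zero, Fin.cons_succ, Pi.zero_apply,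
        mul_zero, Finset.sum_const_zero, add_zero, mul_one]
      exact Real.mul_self_sqrt hnn.le)
  have hQ' : Q * Qᵀ = 1 := mul_eq_one_comm.1 hQ
  set P := quotientMatrix q with hP
  set K₀ : Matrix (Fin n) (Fin n) ℝ := (P * Q).submatrix id Fin.succ with hK₀
  -- The first column of `P Q` vanishes because `Q e_0` is proportional to `(1, q)`, which `P`
  -- annihilates.
  have hcol (i : Fin n) : (P * Q) i 0 = 0 := by
    have h1 : (P * Q) *ᵥ (Fin.cons √(1 + q ⬝ᵥ q) 0 : Fin (n + 1) → ℝ) = 0 := by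
      rw [← Matrix.mulVec_mulVec, hQr, hP, quotientMatrix_mulVec]
    have h2 := congrFun h1 i
    simp only [Matrix.mulVec, dotProduct, Fin.sum_univ_succ, Fin.cons_zero, Fin.cons_succ,
      Pi.zero_apply, mul_zero, Finset.sum_const_zero, add_zero] at h2
    exact (mul_eq_zero.1 h2).resolve_right (Real.sqrt_pos.2 hnn).ne'
  have hPQ : P * Q = K₀ * quotientMatrix (0 : Fin n → ℝ) := by
    ext i j
    refine Fin.cases ?_ (fun j => ?_) j
    · rw [hcol]
      simp [Matrix.mul_apply, quotientMatrix]
    · simp [hK₀, Matrix.mul_apply (M := (P * Q).submatrix id Fin.succ), quotientMatrix,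
        Matrix.one_apply]
  have hKK : K₀ * K₀ᵀ = 1 + Matrix.vecMulVec q q := by
    have h1 : (P * Q) * (P * Q)ᵀ = P * Pᵀ := by
      rw [Matrix.transpose_mul, Matrix.mul_assoc, ← Matrix.mul_assoc Q, hQ', Matrix.one_mul]
    rw [← quotientMatrix_mul_transpose, ← hP, ← h1, hPQ, Matrix.transpose_mul, Matrix.mul_assoc,
      ← Matrix.mul_assoc (quotientMatrix (0 : Fin n → ℝ)), quotientMatrix_mul_transpose]
    simp
  have hdetK : |K₀.det| = √(1 + q ⬝ᵥ q) := by
    have h1 := congrArg Matrix.det hKK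
    rw [Matrix.det_mul, Matrix.det_transpose, Matrix.vecMulVec_eq Unit,
      Matrix.det_one_add_replicateCol_mul_replicateRow, ← pow_two] at h1
    rw [← h1, Real.sqrt_sq_eq_abs]
  have hdet0 : K₀.det ≠ 0 := fun h => by
    rw [h, abs_zero] at hdetK
    exact (Real.sqrt_pos.2 hnn).ne' hdetK.symm
  have hinv : K₀⁻¹ * K₀ = 1 := Matrix.nonsing_inv_mul _ hdet0.isUnit
  have hdetinv : |K₀⁻¹.det| = (√(1 + q ⬝ᵥ q))⁻¹ := by
    rw [Matrix.det_nonsing_inv, Ring.inverse_eq_inv', abs_inv, hdetK]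
  have hF : Measurable fun Z : Fin (n + 1) → Fin n → ℝ =>
      eigenIntegrand τ f ((x, q), shiftedRows x Z) :=
    hm.comp (measurable_prodMk_left.comp (measurePreserving_shiftedRows x).measurable)
  rw [hZ, hZ, ← lintegral_mul_mul Q K₀⁻¹ (abs_det_of_orthogonal hQ)
    (by rw [← abs_ne_zero, hdetinv]; positivity) hF, hdetinv, inv_pow]
  congr 1
  refine lintegral_congr fun Z => eigenIntegrand_eq_of_orthogonal hQ rfl ?_
  simp only [eigenMatrix_shiftedRows, ← hP]
  rw [Equiv.apply_symm_apply, mul_add, add_mul]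
  congr 1
  · rw [Matrix.scalar_apply, ← Matrix.smul_one_eq_diagonal, Matrix.mul_smul, Matrix.mul_one,
      Matrix.smul_mul, hQ']
  · have h1 : K₀⁻¹ * P = quotientMatrix (0 : Fin n → ℝ) * Qᵀ := by
      calc K₀⁻¹ * P = K₀⁻¹ * (P * Q) * Qᵀ := by
            rw [Matrix.mul_assoc, Matrix.mul_assoc, hQ', Matrix.mul_one]
        _ = quotientMatrix (0 : Fin n → ℝ) * Qᵀ := by
            rw [hPQ, ← Matrix.mul_assoc, hinv, Matrix.one_mul]
    rw [Matrix.mul_assoc (Q * Matrix.of Z), h1]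
    simp only [Matrix.mul_assoc]

lemma lintegral_eigenIntegrand {f : ℝ × ℝ → ℝ≥0∞} (hf : Measurable f) :
    ∫⁻ p : Blocks n, eigenIntegrand τ f p
      = ENNReal.ofReal (radialConst (n + 1))
        * ∫⁻ x, ∫⁻ z, eigenIntegrand τ f ((x, (0 : Fin n → ℝ)), z) := by
  have hm := measurable_eigenIntegrand (n := n) τ hf
  have hdot : Measurable fun q : Fin n → ℝ => q ⬝ᵥ q := by
    simp only [dotProduct]; fun_prop
  rw [Measure.volume_eq_prod, lintegral_prod _ hm.aemeasurable]
  have h1 : Measurable fun y : ℝ × (Fin n → ℝ) => ∫⁻ z, eigenIntegrand τ f (y, z) :=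
    Measurable.lintegral_prod_right' hm
  rw [Measure.volume_eq_prod, lintegral_prod _ h1.aemeasurable]
  have h2 (x : ℝ) : ∫⁻ q : Fin n → ℝ, ∫⁻ z, eigenIntegrand τ f ((x, q), z)
      = ENNReal.ofReal (radialConst (n + 1))
        * ∫⁻ z, eigenIntegrand τ f ((x, (0 : Fin n → ℝ)), z) := by
    rw [lintegral_congr fun q => lintegral_eigenIntegrand_rotate hf x q,
      lintegral_mul_const _ (by fun_prop), lintegral_one_add_dotProduct]
  rw [lintegral_congr h2, lintegral_const_mul' _ _ (by finiteness)]

end Reduction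

/-! ### The joint density of an eigenvalue and its overlap -/

section Density

variable {n : ℕ} {τ : ℝ}

/-- With zero column the two Gaussian exponents in `u` add up: `1 + τ² / (1 - τ²) = 1 / (1 - τ²)`.
-/
lemma weight_bordered_zero (hτ₀ : 0 ≤ τ) (hτ₁ : τ < 1) (x : ℝ) (u : Fin n → ℝ)
    (B : Matrix (Fin n) (Fin n) ℝ) :
    weight τ (bordered x u 0 B) = Real.exp (-x ^ 2 / (2 * (1 + τ)))
      * (Real.exp (-(u ⬝ᵥ u) / (2 * (1 - τ ^ 2))) * weight τ B) := by
  have h1 : 0 < 1 - τ ^ 2 := by nlinarith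
  rw [weight_bordered hτ₀ hτ₁, ← mul_assoc (Real.exp (-(u ⬝ᵥ u) / (2 * 1))), ← Real.exp_add]
  congr 3
  · ring
  · simp only [zero_sub, neg_dotProduct, dotProduct_neg, smul_dotProduct, dotProduct_smul,
      smul_eq_mul]
    field_simp
    ring_nf

/-- The weighted square `det (x - B)² exp (-|(x - B)ᵀ w|² / (2 (1 - τ²)))`. -/
def tiltedSquare (τ x : ℝ) (w : Fin n → ℝ) (B : Fin n → Fin n → ℝ) : ℝ :=
  shiftDet x B ^ 2 * Real.exp (-(((Matrix.scalar (Fin n) x - Matrix.of B)ᵀ *ᵥ w)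
    ⬝ᵥ ((Matrix.scalar (Fin n) x - Matrix.of B)ᵀ *ᵥ w)) / (2 * (1 - τ ^ 2)))

lemma measurable_tiltedSquare (τ x : ℝ) :
    Measurable fun p : (Fin n → ℝ) × (Fin n → Fin n → ℝ) => tiltedSquare τ x p.1 p.2 := by
  have h1 : Measurable fun p : (Fin n → ℝ) × (Fin n → Fin n → ℝ) => shiftDet x p.2 :=
    (measurable_shiftDet x).comp measurable_snd
  have hB : Continuous fun p : (Fin n → ℝ) × (Fin n → Fin n → ℝ) => Matrix.of p.2 :=
    continuous_snd
  have hM : Continuous fun p : (Fin n → ℝ) × (Fin n → Fin n → ℝ) =>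
      (Matrix.scalar (Fin n) x - Matrix.of p.2)ᵀ *ᵥ p.1 :=
    ((continuous_const.sub hB).matrix_transpose).matrix_mulVec continuous_fst
  have h2 : Continuous fun p : (Fin n → ℝ) × (Fin n → Fin n → ℝ) =>
      Real.exp (-(((Matrix.scalar (Fin n) x - Matrix.of p.2)ᵀ *ᵥ p.1)
        ⬝ᵥ ((Matrix.scalar (Fin n) x - Matrix.of p.2)ᵀ *ᵥ p.1)) / (2 * (1 - τ ^ 2))) := by
    have := hM.dotProduct hM
    fun_prop
  exact (h1.pow_const 2).mul h2.measurable

/-- The substitution `u = (x - B)ᵀ w` makes the overlap minus one equal to `|w|²` and contributes a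
second factor `|det (x - B)|`. -/
lemma lintegral_eigenIntegrand_row (hτ₀ : 0 ≤ τ) (hτ₁ : τ < 1) {f : ℝ × ℝ → ℝ≥0∞}
    (hf : Measurable f) (x : ℝ) (B : Fin n → Fin n → ℝ) :
    ∫⁻ u, eigenIntegrand τ f ((x, (0 : Fin n → ℝ)), (u, B))
      = ∫⁻ w, f (x, w ⬝ᵥ w) * ENNReal.ofReal (Real.exp (-x ^ 2 / (2 * (1 + τ))))
        * (ENNReal.ofReal (tiltedSquare τ x w B) * ENNReal.ofReal (weight τ (Matrix.of B))) := by
  set M := Matrix.scalar (Fin n) x - Matrix.of B with hM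
  have hdet : shiftDet x B = M.det := rfl
  have hint (u : Fin n → ℝ) : eigenIntegrand τ f ((x, (0 : Fin n → ℝ)), (u, B))
      = ENNReal.ofReal |M.det| * (f (x, (Mᵀ⁻¹ *ᵥ u) ⬝ᵥ (Mᵀ⁻¹ *ᵥ u))
        * ENNReal.ofReal (weight τ (bordered x u 0 (Matrix.of B)))) := by
    simp only [eigenIntegrand, overlapTest, leftTail, deflated_zero, eigenMatrix_zero,
      zero_dotProduct, ← hM]
    congr 4
    ring
  simp only [hint]
  -- For singular `x - B` the substitution is unavailable, but both sides contain a vanishing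
  -- determinant.
  by_cases h0 : M.det = 0
  · simp [h0, tiltedSquare, hdet]
  have hMT : Mᵀ.det ≠ 0 := by rwa [Matrix.det_transpose]
  have hF : Measurable fun u : Fin n → ℝ => ENNReal.ofReal |M.det|
      * (f (x, (Mᵀ⁻¹ *ᵥ u) ⬝ᵥ (Mᵀ⁻¹ *ᵥ u))
        * ENNReal.ofReal (weight τ (bordered x u 0 (Matrix.of B)))) := by
    simp only [← hint]
    exact (measurable_eigenIntegrand τ hf).comp (by fun_prop)
  rw [← lintegral_matrix_mulVec hMT hF, ← lintegral_const_mul' _ _ (by finiteness)]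
  refine lintegral_congr fun w => ?_
  have hinv : Mᵀ⁻¹ *ᵥ (Mᵀ *ᵥ w) = w := by
    rw [Matrix.mulVec_mulVec, Matrix.nonsing_inv_mul _ hMT.isUnit, Matrix.one_mulVec]
  rw [hinv, weight_bordered_zero hτ₀ hτ₁, Matrix.det_transpose, tiltedSquare, hdet, ← hM,
    ENNReal.ofReal_mul (by positivity), ENNReal.ofReal_mul (by positivity),
    ENNReal.ofReal_mul (by positivity), ← sq_abs M.det, pow_two |M.det|,
    ENNReal.ofReal_mul (abs_nonneg _)]
  ring

/-- The average of `tiltedSquare` depends on `w` only through its length. -/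
lemma lintegral_tiltedSquare_rotate (hτ₀ : 0 ≤ τ) (hτ₁ : τ < 1) (x : ℝ)
    {w w' : Fin n → ℝ} (h : w' ⬝ᵥ w' = w ⬝ᵥ w) :
    ∫⁻ B, ENNReal.ofReal (tiltedSquare τ x w B) ∂ensemble τ n
      = ∫⁻ B, ENNReal.ofReal (tiltedSquare τ x w' B) ∂ensemble τ n := by
  obtain ⟨Q, hQ, hQw⟩ := exists_orthogonal_mulVec_eq h
  have hQ' : Q * Qᵀ = 1 := mul_eq_one_comm.1 hQ
  have hm : Measurable fun B => ENNReal.ofReal (tiltedSquare τ x w B) :=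
    ((measurable_tiltedSquare τ x).comp measurable_prodMk_left).ennreal_ofReal
  rw [← (measurePreserving_orthogonal_conj hτ₀ hτ₁ hQ).lintegral_comp hm]
  refine lintegral_congr fun B => ?_
  have hconj : Matrix.scalar (Fin n) x - Q * Matrix.of B * Qᵀ
      = Q * (Matrix.scalar (Fin n) x - Matrix.of B) * Qᵀ := by
    rw [mul_sub, sub_mul, Matrix.scalar_apply, ← Matrix.smul_one_eq_diagonal, Matrix.mul_smul,
      Matrix.mul_one, Matrix.smul_mul, hQ']
  have hvec : (Matrix.scalar (Fin n) x - Q * Matrix.of B * Qᵀ)ᵀ *ᵥ w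
      = Q *ᵥ ((Matrix.scalar (Fin n) x - Matrix.of B)ᵀ *ᵥ w') := by
    rw [hconj, Matrix.transpose_mul, Matrix.transpose_mul, Matrix.transpose_transpose, ← hQw,
      Matrix.mulVec_mulVec, Matrix.mulVec_mulVec, Matrix.mul_assoc, Matrix.mul_assoc, hQ,
      Matrix.mul_one]
  have hdot (a b : Fin n → ℝ) : (Q *ᵥ a) ⬝ᵥ (Q *ᵥ b) = a ⬝ᵥ b := by
    rw [Matrix.dotProduct_mulVec, Matrix.vecMul_mulVec, hQ, Matrix.vecMul_one]
  have hdet : shiftDet x (Matrix.of.symm (Q * Matrix.of B * Qᵀ)) = shiftDet x B := by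
    rw [shiftDet, Equiv.apply_symm_apply, hconj, Matrix.det_mul, Matrix.det_mul, mul_right_comm,
      ← Matrix.det_mul, hQ', Matrix.det_one, one_mul]
    rfl
  rw [tiltedSquare, tiltedSquare, Equiv.apply_symm_apply, hdet, hvec, hdot]

/-- The value of the tilted average of `det (x - X)²`, for matrices of size `m + 1`. -/
def tiltedValue (τ : ℝ) (m : ℕ) (x t : ℝ) : ℝ :=
  (√(1 + t / (1 - τ ^ 2) * (1 + τ)))⁻¹
    * Real.exp (-(t / (1 - τ ^ 2) * x ^ 2 / (2 * (1 + t / (1 - τ ^ 2) * (1 + τ)))))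
    * (√(1 + t / (1 - τ ^ 2)))⁻¹ ^ m
    * tiltAverage τ m (x / (1 + t / (1 - τ ^ 2) * (1 + τ)))
        ((1 + τ) / (1 + t / (1 - τ ^ 2) * (1 + τ))) (1 / (1 + t / (1 - τ ^ 2))) x

lemma tiltedValue_nonneg (hτ₀ : 0 ≤ τ) (hτ₁ : τ < 1) (m : ℕ) (x : ℝ) {t : ℝ} (ht : 0 ≤ t) :
    0 ≤ tiltedValue τ m x t := by
  have h1 : 0 < 1 - τ ^ 2 := by nlinarith
  refine mul_nonneg (by positivity) (tiltAverage_nonneg hτ₀ hτ₁ _ _ ?_ ?_) <;> positivity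

/-- After rotating `w` to `|w| e_0`, the vector `(x - B)ᵀ w` is `|w|` times the first row of `x -
B`; the tilt has strength `s = |w|² / (1 - τ²)`. -/
lemma lintegral_tiltedSquare (hτ₀ : 0 ≤ τ) (hτ₁ : τ < 1) (m : ℕ) (x : ℝ) (w : Fin (m + 1) → ℝ) :
    ∫⁻ B, ENNReal.ofReal (tiltedSquare τ x w B) ∂ensemble τ (m + 1)
      = ENNReal.ofReal (tiltedValue τ m x (w ⬝ᵥ w)) := by
  have h1 : 0 < 1 - τ ^ 2 := by nlinarith
  have hnn : 0 ≤ w ⬝ᵥ w := Finset.sum_nonneg fun i _ => mul_self_nonneg _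
  have hr := Real.mul_self_sqrt hnn
  set r := √(w ⬝ᵥ w)
  rw [lintegral_tiltedSquare_rotate hτ₀ hτ₁ x (w' := Fin.cons r 0), tiltedValue,
    ← lintegral_tilted hτ₀ hτ₁ (by positivity)]
  · refine lintegral_congr fun B => ?_
    have hrow (j : Fin (m + 1)) : ((Matrix.scalar (Fin (m + 1)) x - Matrix.of B)ᵀ
        *ᵥ (Fin.cons r 0 : Fin (m + 1) → ℝ)) j
        = (Matrix.scalar (Fin (m + 1)) x - Matrix.of B) 0 j * r := by
      simp only [Matrix.mulVec, dotProduct, Fin.sum_univ_succ, Fin.cons_zero, Fin.cons_succ,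
        Pi.zero_apply, mul_zero, Finset.sum_const_zero, add_zero, Matrix.transpose_apply]
    have hsum : ((Matrix.scalar (Fin (m + 1)) x - Matrix.of B)ᵀ
        *ᵥ (Fin.cons r 0 : Fin (m + 1) → ℝ)) ⬝ᵥ ((Matrix.scalar (Fin (m + 1)) x - Matrix.of B)ᵀ
        *ᵥ (Fin.cons r 0 : Fin (m + 1) → ℝ))
        = (w ⬝ᵥ w) * ((x - B 0 0) ^ 2 + ∑ j : Fin m, B 0 j.succ ^ 2) := by
      rw [dotProduct, Fin.sum_univ_succ]
      have h0 : (Matrix.scalar (Fin (m + 1)) x - Matrix.of B) 0 0 = x - B 0 0 := by simp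
      have hs (j : Fin m) : (Matrix.scalar (Fin (m + 1)) x - Matrix.of B) 0 j.succ
          = -B 0 j.succ := by
        simp [Matrix.diagonal_apply_ne _ (Fin.succ_ne_zero j).symm]
      simp only [hrow, h0, hs]
      rw [← hr, mul_add, Finset.mul_sum]
      congr 1
      · ring
      · exact Finset.sum_congr rfl fun j _ => by ring
    rw [tiltedSquare, hsum]
    congr 3
    field_simp
  · simp only [dotProduct, Fin.sum_univ_succ, Fin.cons_zero, Fin.cons_succ, Pi.zero_apply,
      mul_zero, Finset.sum_const_zero, add_zero]
    rw [hr]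
    simp [dotProduct, Fin.sum_univ_succ]

/-- The average over `B` depends on `w` only through its length, so the integral over `w` can be
taken in polar coordinates. -/
lemma lintegral_eigenIntegrand_zero (hτ₀ : 0 ≤ τ) (hτ₁ : τ < 1) {f : ℝ × ℝ → ℝ≥0∞}
    (hf : Measurable f) (m : ℕ) (x : ℝ) :
    ∫⁻ z, eigenIntegrand τ f ((x, (0 : Fin (m + 1) → ℝ)), z)
      = ENNReal.ofReal (normConst τ (m + 1) * radialConst (m + 1)
          * Real.exp (-x ^ 2 / (2 * (1 + τ))))
        * ∫⁻ t in Set.Ioi (0 : ℝ), f (x, t) * ENNReal.ofReal (tiltedValue τ m x t)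
          * ENNReal.ofReal (t ^ (((m + 1 : ℕ) : ℝ) / 2 - 1)) := by
  have hC := normConst_pos hτ₀ hτ₁ (m + 1)
  have hm := measurable_eigenIntegrand (n := m + 1) τ hf
  have hdot : Measurable fun q : Fin (m + 1) → ℝ => q ⬝ᵥ q := by
    simp only [dotProduct]; fun_prop
  rw [Measure.volume_eq_prod, lintegral_prod_symm _ (by fun_prop)]
  simp only [lintegral_eigenIntegrand_row hτ₀ hτ₁ hf]
  have hts := measurable_tiltedSquare (n := m + 1) τ x
  have hw := measurable_weight (n := m + 1) τ
  rw [lintegral_lintegral_swap]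
  · have hin (w : Fin (m + 1) → ℝ) :
        ∫⁻ B : Fin (m + 1) → Fin (m + 1) → ℝ,
          f (x, w ⬝ᵥ w) * ENNReal.ofReal (Real.exp (-x ^ 2 / (2 * (1 + τ))))
          * (ENNReal.ofReal (tiltedSquare τ x w B) * ENNReal.ofReal (weight τ (Matrix.of B)))
        = ENNReal.ofReal (Real.exp (-x ^ 2 / (2 * (1 + τ)))) * ENNReal.ofReal (normConst τ (m + 1))
          * (f (x, w ⬝ᵥ w) * ENNReal.ofReal (tiltedValue τ m x (w ⬝ᵥ w))) := by
      rw [← lintegral_tiltedSquare hτ₀ hτ₁, lintegral_ensemble hτ₀ hτ₁, lintegral_const_mul]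
      · rw [ENNReal.ofReal_inv_of_pos hC]
        have hcancel : ENNReal.ofReal (normConst τ (m + 1)) * (ENNReal.ofReal (normConst τ (m + 1)))⁻¹
            = 1 := ENNReal.mul_inv_cancel (by simpa using hC) (by finiteness)
        set S := ∫⁻ B : Fin (m + 1) → Fin (m + 1) → ℝ, ENNReal.ofReal (tiltedSquare τ x w B)
          * ENNReal.ofReal (weight τ (Matrix.of B))
        set e := ENNReal.ofReal (Real.exp (-x ^ 2 / (2 * (1 + τ))))
        set C := ENNReal.ofReal (normConst τ (m + 1))
        calc f (x, w ⬝ᵥ w) * e * S = (C * C⁻¹) * (f (x, w ⬝ᵥ w) * e * S) := by rw [hcancel, one_mul]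
          _ = _ := by ring
      · exact ((hts.comp measurable_prodMk_left).ennreal_ofReal).mul hw.ennreal_ofReal
    simp only [hin]
    have hT : Measurable fun t => tiltedValue τ m x t := by
      unfold tiltedValue tiltAverage
      fun_prop
    have hg : Measurable fun t => f (x, t) * ENNReal.ofReal (tiltedValue τ m x t) := by fun_prop
    rw [lintegral_const_mul' _ _ (by finiteness), lintegral_dotProduct_self m hg, ← mul_assoc]
    congr 1
    rw [← ENNReal.ofReal_mul (by positivity), ← ENNReal.ofReal_mul (by positivity)]
    congr 1
    ring
  · refine Measurable.aemeasurable ?_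
    have h1 := (hts.comp (measurable_swap (α := Fin (m + 1) → Fin (m + 1) → ℝ)
      (β := Fin (m + 1) → ℝ))).ennreal_ofReal
    have h2 : Measurable fun p : (Fin (m + 1) → Fin (m + 1) → ℝ) × (Fin (m + 1) → ℝ) =>
        ENNReal.ofReal (weight τ (Matrix.of p.1)) := (hw.comp measurable_fst).ennreal_ofReal
    have h3 : Measurable fun p : (Fin (m + 1) → Fin (m + 1) → ℝ) × (Fin (m + 1) → ℝ) =>
        f (x, p.2 ⬝ᵥ p.2) * ENNReal.ofReal (Real.exp (-x ^ 2 / (2 * (1 + τ)))) := by fun_prop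
    exact h3.mul (h1.mul h2)

lemma continuous_avgDetDet_self (hτ₀ : 0 ≤ τ) (hτ₁ : τ < 1) (n : ℕ) :
    Continuous fun x => avgDetDet τ n x x :=
  ((tame_shiftDet hτ₀ hτ₁).mul (tame_shiftDet hτ₀ hτ₁)).continuous_integral

lemma continuous_avgDetTrace_self (hτ₀ : 0 ≤ τ) (hτ₁ : τ < 1) (n : ℕ) :
    Continuous fun x => avgDetTrace τ n x x :=
  ((tame_shiftDet hτ₀ hτ₁).mul (tame_trace_shiftAdj hτ₀ hτ₁)).continuous_integral

lemma continuous_avgTraceTrace_self (hτ₀ : 0 ≤ τ) (hτ₁ : τ < 1) (n : ℕ) :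
    Continuous fun x => avgTraceTrace τ n x x :=
  ((tame_trace_shiftAdj hτ₀ hτ₁).mul (tame_trace_shiftAdj hτ₀ hτ₁)).continuous_integral

lemma continuous_avgTraceMul_self (hτ₀ : 0 ≤ τ) (hτ₁ : τ < 1) (n : ℕ) :
    Continuous fun x => avgTraceMul τ n x x := by
  have := isProbabilityMeasure_ensemble hτ₀ hτ₁ n
  exact (Tame.trace_mul (tame_shiftAdj hτ₀ hτ₁) (tame_shiftAdj hτ₀ hτ₁)).continuous_integral

lemma continuous_avgTraceMulTranspose_self (hτ₀ : 0 ≤ τ) (hτ₁ : τ < 1) (n : ℕ) :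
    Continuous fun x => avgTraceMulTranspose τ n x x := by
  have := isProbabilityMeasure_ensemble hτ₀ hτ₁ n
  exact (Tame.trace_mul (M' := fun x X => (shiftAdj x X)ᵀ) (tame_shiftAdj hτ₀ hτ₁)
    fun i j => tame_shiftAdj hτ₀ hτ₁ j i).continuous_integral

/-- The joint density of an eigenvalue and its overlap, for matrices of size `m + 2`. -/
def jointDensity (τ : ℝ) (m : ℕ) (x t : ℝ) : ℝ :=
  (normConst τ (m + 2))⁻¹ * radialConst (m + 2) * (normConst τ (m + 1) * radialConst (m + 1)
    * Real.exp (-x ^ 2 / (2 * (1 + τ)))) * (tiltedValue τ m x t * t ^ (((m + 1 : ℕ) : ℝ) / 2 - 1))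

/-- The tilt average is continuous in all its real arguments. -/
lemma continuous_tiltAverage (hτ₀ : 0 ≤ τ) (hτ₁ : τ < 1) (m : ℕ) :
    Continuous fun p : ℝ × ℝ × ℝ × ℝ => tiltAverage τ m p.1 p.2.1 p.2.2.1 p.2.2.2 := by
  have k1 := continuous_avgDetDet_self hτ₀ hτ₁ m
  have k2 := continuous_avgDetTrace_self hτ₀ hτ₁ m
  have k3 := continuous_avgTraceTrace_self hτ₀ hτ₁ m
  have k4 := continuous_avgTraceMul_self hτ₀ hτ₁ m
  have k5 := continuous_avgTraceMulTranspose_self hτ₀ hτ₁ m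
  obtain ⟨F₁, h₁⟩ : ∃ F : ℝ → ℝ, ∀ x, avgDetDet τ m x x = F x := ⟨_, fun _ => rfl⟩
  obtain ⟨F₂, h₂⟩ : ∃ F : ℝ → ℝ, ∀ x, avgDetTrace τ m x x = F x := ⟨_, fun _ => rfl⟩
  obtain ⟨F₃, h₃⟩ : ∃ F : ℝ → ℝ, ∀ x, avgTraceTrace τ m x x = F x := ⟨_, fun _ => rfl⟩
  obtain ⟨F₄, h₄⟩ : ∃ F : ℝ → ℝ, ∀ x, avgTraceMul τ m x x = F x := ⟨_, fun _ => rfl⟩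
  obtain ⟨F₅, h₅⟩ : ∃ F : ℝ → ℝ, ∀ x, avgTraceMulTranspose τ m x x = F x := ⟨_, fun _ => rfl⟩
  unfold tiltAverage
  simp only [h₁, h₂, h₃, h₄, h₅] at k1 k2 k3 k4 k5 ⊢
  fun_prop

lemma continuousOn_tiltedValue (hτ₀ : 0 ≤ τ) (hτ₁ : τ < 1) (m : ℕ) :
    ContinuousOn (fun y : ℝ × ℝ => tiltedValue τ m y.1 y.2) (Set.univ ×ˢ Set.Ioi 0) := by
  have h1 : 0 < 1 - τ ^ 2 := by nlinarith
  have h1' := h1.ne'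
  have k := continuous_tiltAverage hτ₀ hτ₁ m
  obtain ⟨F, hF⟩ : ∃ F : ℝ × ℝ × ℝ × ℝ → ℝ, ∀ μ q a x, tiltAverage τ m μ q a x = F (μ, q, a, x) :=
    ⟨fun p => tiltAverage τ m p.1 p.2.1 p.2.2.1 p.2.2.2, fun _ _ _ _ => rfl⟩
  simp only [hF] at k
  intro y hy
  have ht : 0 < y.2 := hy.2
  have d1 : 1 + y.2 / (1 - τ ^ 2) * (1 + τ) ≠ 0 := by positivity
  have d2 : 1 + y.2 / (1 - τ ^ 2) ≠ 0 := by positivity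
  have d3 : √(1 + y.2 / (1 - τ ^ 2) * (1 + τ)) ≠ 0 := by positivity
  have d4 : √(1 + y.2 / (1 - τ ^ 2)) ≠ 0 := by positivity
  have d5 : 2 * (1 + y.2 / (1 - τ ^ 2) * (1 + τ)) ≠ 0 := by positivity
  refine ContinuousAt.continuousWithinAt ?_
  unfold tiltedValue
  simp only [hF]
  fun_prop (disch := assumption)

lemma measurable_jointDensity (hτ₀ : 0 ≤ τ) (hτ₁ : τ < 1) (m : ℕ) :
    Measurable fun y : ℝ × ℝ => jointDensity τ m y.1 y.2 := by
  have k := (continuous_tiltAverage hτ₀ hτ₁ m).measurable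
  obtain ⟨F, hF⟩ : ∃ F : ℝ × ℝ × ℝ × ℝ → ℝ, ∀ μ q a x, tiltAverage τ m μ q a x = F (μ, q, a, x) :=
    ⟨fun p => tiltAverage τ m p.1 p.2.1 p.2.2.1 p.2.2.2, fun _ _ _ _ => rfl⟩
  simp only [hF] at k
  unfold jointDensity tiltedValue
  simp only [hF]
  fun_prop

/-- `jointDensity` is the joint density for matrices of size at least two. -/
lemma isJointDensity_jointDensity (hτ₀ : 0 ≤ τ) (hτ₁ : τ < 1) (m : ℕ) :
    IsJointDensity τ (m + 2) (jointDensity τ m) := by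
  have hC1 := normConst_pos hτ₀ hτ₁ (m + 1)
  have hC2 := normConst_pos hτ₀ hτ₁ (m + 2)
  have hr1 := radialConst_pos m
  have hr2 := radialConst_pos (m + 1)
  refine ⟨fun z t ht => ?_, ?_, fun f hf => ?_⟩
  · have := tiltedValue_nonneg hτ₀ hτ₁ m z ht.le
    unfold jointDensity
    positivity
  · unfold jointDensity
    refine ContinuousOn.mul (by fun_prop) (ContinuousOn.mul (continuousOn_tiltedValue hτ₀ hτ₁ m) ?_)
    exact ContinuousOn.rpow_const (by fun_prop) fun y hy => Or.inl (ne_of_gt hy.2)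
  · rw [lintegral_eigenSum hτ₀ hτ₁ hf, lintegral_eigenIntegrand hf, ← mul_assoc,
      ← ENNReal.ofReal_mul (by positivity)]
    have hm := measurable_jointDensity hτ₀ hτ₁ m
    have hvol : (volume : Measure (ℝ × ℝ)).restrict (Set.univ ×ˢ Set.Ioi 0)
        = (volume : Measure ℝ).prod (volume.restrict (Set.Ioi 0)) := by
      rw [Measure.volume_eq_prod, ← Measure.prod_restrict, Measure.restrict_univ]
    rw [hvol, lintegral_prod _ (by fun_prop), ← lintegral_const_mul' _ _ (by finiteness)]
    refine lintegral_congr fun x => ?_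
    rw [lintegral_eigenIntegrand_zero hτ₀ hτ₁ hf, ← mul_assoc,
      ← ENNReal.ofReal_mul (by positivity), ← lintegral_const_mul' _ _ (by finiteness)]
    refine setLIntegral_congr_fun measurableSet_Ioi fun t ht => ?_
    have ht : 0 < t := ht
    have hT := tiltedValue_nonneg hτ₀ hτ₁ m x ht.le
    simp only [jointDensity]
    rw [ENNReal.ofReal_mul (by positivity) (q := tiltedValue τ m x t * _),
      ENNReal.ofReal_mul hT]
    ring

end Density

/-! ### The Mehler formula on the diagonal -/

section Mehler

open Nat

variable {τ : ℝ}

/-- A nonnegative sequence with `u_{k+2} ≤ δ u_{k+1} + η u_k` eventually grows at most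
geometrically, at the rate of any supersolution of the characteristic equation. -/
lemma exists_le_geometric {u : ℕ → ℝ} {δ η ρ : ℝ} (hδ : 0 ≤ δ) (hη : 0 ≤ η) (hρ : 0 < ρ)
    (h : δ * ρ + η ≤ ρ ^ 2) (hu : ∀ k, 0 ≤ u k) {K : ℕ}
    (hK : ∀ k, K ≤ k → u (k + 2) ≤ δ * u (k + 1) + η * u k) :
    ∃ A, 0 ≤ A ∧ ∀ k, u k ≤ A * ρ ^ k := by
  set A := ∑ k ∈ Finset.range (K + 2), u k / ρ ^ k with hA
  have hA0 : 0 ≤ A := Finset.sum_nonneg fun k _ => div_nonneg (hu k) (by positivity)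
  have hsmall : ∀ k, k < K + 2 → u k ≤ A * ρ ^ k := fun k hk => by
    rw [← div_le_iff₀ (by positivity)]
    exact Finset.single_le_sum (f := fun k => u k / ρ ^ k)
      (fun k _ => div_nonneg (hu k) (by positivity)) (Finset.mem_range.2 hk)
  refine ⟨A, hA0, fun k => ?_⟩
  induction k using Nat.twoStepInduction with
  | zero => exact hsmall 0 (by omega)
  | one => exact hsmall 1 (by omega)
  | more k h0 h1 =>
    rcases lt_or_ge k K with hk | hk
    · exact hsmall _ (by omega)
    · calc u (k + 2) ≤ δ * u (k + 1) + η * u k := hK k hk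
        _ ≤ δ * (A * ρ ^ (k + 1)) + η * (A * ρ ^ k) := by gcongr
        _ = (δ * ρ + η) * (A * ρ ^ k) := by ring
        _ ≤ ρ ^ 2 * (A * ρ ^ k) := by gcongr
        _ = A * ρ ^ (k + 2) := by ring

/-- The recurrence combined with `(p - q)² ≤ (1 + 1/ε) p² + (1 + ε) q²`. The first coefficient tends
to zero, so the second, close to `τ²`, governs two steps of growth. -/
lemma hermiteTerm_add_two_le (x : ℝ) {ε : ℝ} (hε : 0 < ε) (k : ℕ) :
    hermiteTerm τ x x (k + 2) ≤ (1 + ε⁻¹) * x ^ 2 / (k + 2) * hermiteTerm τ x x (k + 1)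
      + (1 + ε) * τ ^ 2 * hermiteTerm τ x x k := by
  have hk : (0 : ℝ) < k ! := by positivity
  have key : (x * scaledHermite τ (k + 1) x - τ * (k + 1) * scaledHermite τ k x) ^ 2
      ≤ (1 + ε⁻¹) * (x * scaledHermite τ (k + 1) x) ^ 2
        + (1 + ε) * (τ * (k + 1) * scaledHermite τ k x) ^ 2 := by
    generalize x * scaledHermite τ (k + 1) x = p
    generalize τ * (k + 1) * scaledHermite τ k x = q
    have h : 0 ≤ ε⁻¹ * (p + ε * q) ^ 2 := by positivity
    have h2 : ε⁻¹ * (p + ε * q) ^ 2 = ε⁻¹ * p ^ 2 + 2 * p * q + ε * q ^ 2 := by field_simp; ring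
    nlinarith
  have e2 : ((k + 2) ! : ℝ) = (k + 2) * ((k + 1) * k !) := by
    rw [Nat.factorial_succ, Nat.factorial_succ]; push_cast; ring
  have e1 : ((k + 1) ! : ℝ) = (k + 1) * k ! := by rw [Nat.factorial_succ]; push_cast; ring
  unfold hermiteTerm
  rw [e2, e1]
  have hA := sq_nonneg (scaledHermite τ (k + 1) x)
  have hB := sq_nonneg (scaledHermite τ k x)
  simp only [scaledHermite] at key ⊢
  calc _ = (x * scaledHermite τ (k + 1) x - τ * (k + 1) * scaledHermite τ k x) ^ 2
          / ((k + 2) * ((k + 1) * k !)) := by ring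
    _ ≤ ((1 + ε⁻¹) * (x * scaledHermite τ (k + 1) x) ^ 2
        + (1 + ε) * (τ * (k + 1) * scaledHermite τ k x) ^ 2) / ((k + 2) * ((k + 1) * k !)) := by
          gcongr
    _ = (1 + ε⁻¹) * x ^ 2 / (k + 2) * (scaledHermite τ (k + 1) x * scaledHermite τ (k + 1) x
          / ((k + 1) * k !)) + (1 + ε) * τ ^ 2 * (((k + 1) / (k + 2)) *
            (scaledHermite τ k x * scaledHermite τ k x / k !)) := by field_simp
    _ ≤ _ := by
      gcongr
      rw [← pow_two]
      refine mul_le_of_le_one_left (by positivity) ?_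
      rw [div_le_one (by positivity)]
      linarith

/-- The series of the squares of the Hermite polynomials has a radius of convergence above `1`. -/
lemma exists_summable_hermiteTerm (hτ₀ : 0 ≤ τ) (hτ₁ : τ < 1) (x : ℝ) :
    ∃ R, 1 < R ∧ Summable fun k : ℕ => (k + 1) * hermiteTerm τ x x k * R ^ k := by
  -- The rate `ρ` lies strictly between `τ` and `1`, and `2 ε = ρ² - τ²` leaves enough room for the
  -- characteristic inequality.
  set ρ := (1 + τ) / 2 with hρ
  have hρτ : τ < ρ := by linarith
  have hρ0 : 0 < ρ := by linarith
  have hρ1 : ρ < 1 := by linarith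
  set ε := (ρ ^ 2 - τ ^ 2) / 2 with hε
  have hε0 : 0 < ε := by nlinarith
  have hchar : ε * ρ + (1 + ε) * τ ^ 2 ≤ ρ ^ 2 := by
    have h1 : 0 ≤ ε * (1 - ρ) := mul_nonneg hε0.le (by linarith)
    have h2 : 0 ≤ ε * (1 - τ ^ 2) := mul_nonneg hε0.le (by nlinarith)
    have h3 : 2 * ε = ρ ^ 2 - τ ^ 2 := by rw [hε]; ring
    linarith
  -- Beyond `K` the coefficient `(1 + 1/ε) x² / (k + 2)` is at most `ε`.
  obtain ⟨K, hK⟩ := exists_nat_gt ((1 + ε⁻¹) * x ^ 2 / ε)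
  have hA : ∃ A, 0 ≤ A ∧ ∀ k, hermiteTerm τ x x k ≤ A * ρ ^ k := by
    refine exists_le_geometric (δ := ε) (η := (1 + ε) * τ ^ 2) (K := K) hε0.le (by positivity) hρ0
      hchar (hermiteTerm_self_nonneg x) fun k hk => ?_
    refine (hermiteTerm_add_two_le x hε0 k).trans ?_
    have := hermiteTerm_self_nonneg (τ := τ) x (k + 1)
    gcongr
    rw [div_le_iff₀ (by positivity)]
    rw [div_lt_iff₀ hε0] at hK
    have : (K : ℝ) ≤ k := by exact_mod_cast hk
    nlinarith
  obtain ⟨A, hA0, hA⟩ := hA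
  -- This radius exceeds `1`, while its product with `ρ` is `2 (1 + τ) / (3 + τ) < 1`.
  refine ⟨4 / (3 + τ), by rw [lt_div_iff₀ (by linarith)]; linarith, ?_⟩
  have hr0 : 0 ≤ ρ * (4 / (3 + τ)) := by positivity
  have hr1 : ρ * (4 / (3 + τ)) < 1 := by
    rw [← mul_div_assoc, div_lt_one (by linarith)]; linarith
  have hs : Summable fun k : ℕ => A * ((k + 1) * (ρ * (4 / (3 + τ))) ^ k) := by
    refine Summable.mul_left _ ?_
    have h1 := summable_pow_mul_geometric_of_norm_lt_one (R := ℝ) 1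
      (by rwa [Real.norm_of_nonneg hr0])
    have h2 := summable_geometric_of_lt_one hr0 hr1
    refine (h1.add h2).congr fun k => ?_
    ring
  refine Summable.of_nonneg_of_le (fun k => ?_) (fun k => ?_) hs
  · have := hermiteTerm_self_nonneg (τ := τ) x k
    positivity
  · calc (k + 1) * hermiteTerm τ x x k * (4 / (3 + τ)) ^ k
        ≤ (k + 1) * (A * ρ ^ k) * (4 / (3 + τ)) ^ k := by
          gcongr
          exact hA k
      _ = _ := by rw [mul_pow]; ring

/-- The generating function `∑ C_k(x)² s^k / k!`. -/
def mehlerSum (τ x s : ℝ) : ℝ := ∑' k, hermiteTerm τ x x k * s ^ k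

lemma succ_mul_hermiteTerm_succ (x : ℝ) (k : ℕ) :
    (k + 1) * hermiteTerm τ x x (k + 1) = scaledHermite τ (k + 1) x ^ 2 / k ! := by
  have hk : (k ! : ℝ) ≠ 0 := by positivity
  unfold hermiteTerm
  rw [Nat.factorial_succ]
  push_cast
  field_simp

lemma summable_hermiteTerm_pow (hτ₀ : 0 ≤ τ) (hτ₁ : τ < 1) (x : ℝ) {s : ℝ} (hs₀ : 0 ≤ s)
    (hs₁ : s ≤ 1) : Summable fun k : ℕ => (k + 1) * (hermiteTerm τ x x k * s ^ k) := by
  obtain ⟨R, hR, hsum⟩ := exists_summable_hermiteTerm hτ₀ hτ₁ x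
  refine Summable.of_nonneg_of_le (fun k => ?_) (fun k => ?_) hsum
  · have := hermiteTerm_self_nonneg (τ := τ) x k
    positivity
  · have := hermiteTerm_self_nonneg (τ := τ) x k
    rw [← mul_assoc]
    gcongr
    linarith

lemma summable_hermiteTerm (hτ₀ : 0 ≤ τ) (hτ₁ : τ < 1) (x : ℝ) {s : ℝ} (hs₀ : 0 ≤ s)
    (hs₁ : s ≤ 1) : Summable fun k : ℕ => hermiteTerm τ x x k * s ^ k := by
  refine Summable.of_nonneg_of_le (fun k => ?_) (fun k => ?_)
    (summable_hermiteTerm_pow hτ₀ hτ₁ x hs₀ hs₁)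
  · exact mul_nonneg (hermiteTerm_self_nonneg x k) (by positivity)
  · refine le_mul_of_one_le_left (mul_nonneg (hermiteTerm_self_nonneg x k) (by positivity)) ?_
    linarith [k.cast_nonneg (α := ℝ)]

lemma summable_scaledHermite_succ_sq (hτ₀ : 0 ≤ τ) (hτ₁ : τ < 1) (x : ℝ) {s : ℝ} (hs₀ : 0 ≤ s)
    (hs₁ : s ≤ 1) : Summable fun k : ℕ => scaledHermite τ (k + 1) x ^ 2 / k ! * s ^ k := by
  obtain ⟨R, hR, hsum⟩ := exists_summable_hermiteTerm hτ₀ hτ₁ x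
  refine Summable.of_nonneg_of_le (fun k => by positivity) (fun k => ?_)
    ((summable_nat_add_iff 1).2 hsum)
  have := hermiteTerm_self_nonneg (τ := τ) x (k + 1)
  rw [← succ_mul_hermiteTerm_succ]
  have h1 : s ^ k ≤ R ^ (k + 1) :=
    (pow_le_one₀ hs₀ hs₁).trans (one_le_pow₀ hR.le)
  push_cast
  gcongr
  linarith

/-- Termwise differentiation in a disc of radius greater than one, so that the derivative is
two-sided even at `s = 1`. -/
lemma hasDerivAt_mehlerSum (hτ₀ : 0 ≤ τ) (hτ₁ : τ < 1) (x : ℝ) {s : ℝ} (hs₀ : 0 ≤ s)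
    (hs₁ : s ≤ 1) :
    HasDerivAt (mehlerSum τ x) (∑' k : ℕ, scaledHermite τ (k + 1) x ^ 2 / k ! * s ^ k) s := by
  obtain ⟨R, hR, hsum⟩ := exists_summable_hermiteTerm hτ₀ hτ₁ x
  have hsR : s ∈ Metric.ball (0 : ℝ) R := by
    rw [mem_ball_zero_iff, Real.norm_of_nonneg hs₀]; linarith
  have h := hasDerivAt_tsum_of_isPreconnected (t := Metric.ball (0 : ℝ) R)
    (g := fun (k : ℕ) s => hermiteTerm τ x x k * s ^ k)
    (g' := fun (k : ℕ) s => hermiteTerm τ x x k * (k * s ^ (k - 1)))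
    hsum Metric.isOpen_ball (convex_ball _ _).isPreconnected
    (fun k y _ => (hasDerivAt_pow k y).const_mul _) (fun k y hy => ?_) hsR
    (summable_hermiteTerm hτ₀ hτ₁ x hs₀ hs₁) hsR
  · refine h.congr_deriv ?_
    have h0 := hermiteTerm_self_nonneg (τ := τ) x
    rw [Summable.tsum_eq_zero_add ((summable_nat_add_iff 1).1 ?_)]
    · simp only [Nat.cast_zero, zero_mul, mul_zero, zero_add, Nat.add_sub_cancel]
      refine tsum_congr fun k => ?_
      rw [← succ_mul_hermiteTerm_succ]
      push_cast
      ring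
    · refine (summable_scaledHermite_succ_sq hτ₀ hτ₁ x hs₀ hs₁).congr fun k => ?_
      rw [← succ_mul_hermiteTerm_succ]
      push_cast [Nat.add_sub_cancel]
      ring
  · have h0 := hermiteTerm_self_nonneg (τ := τ) x k
    rw [mem_ball_zero_iff] at hy
    rw [norm_mul, norm_mul, norm_pow, Real.norm_of_nonneg h0, Real.norm_natCast,
      mul_comm ((k : ℝ) + 1), mul_assoc]
    have h1 : ‖y‖ ^ (k - 1) ≤ R ^ k :=
      (pow_le_pow_left₀ (norm_nonneg _) hy.le _).trans (pow_le_pow_right₀ hR.le (Nat.sub_le _ _))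
    gcongr
    linarith

/-- The differential equation of the generating function. -/
lemma tsum_scaledHermite_succ_sq (hτ₀ : 0 ≤ τ) (hτ₁ : τ < 1) (x : ℝ) {s : ℝ} (hs₀ : 0 ≤ s)
    (hs₁ : s ≤ 1) :
    ∑' k : ℕ, scaledHermite τ (k + 1) x ^ 2 / k ! * s ^ k
      = (x ^ 2 / (1 + τ * s) ^ 2 + τ ^ 2 * s / (1 - τ ^ 2 * s ^ 2)) * mehlerSum τ x s := by
  set C := fun k => scaledHermite τ k x with hC
  have hM := summable_hermiteTerm hτ₀ hτ₁ x hs₀ hs₁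
  have hD := summable_scaledHermite_succ_sq hτ₀ hτ₁ x hs₀ hs₁
  have hk1 := summable_hermiteTerm_pow hτ₀ hτ₁ x hs₀ hs₁
  have hL : Summable fun k : ℕ => C k * C (k + 1) / k ! * s ^ k := by
    refine Summable.of_norm_bounded (hM.add hD) fun k => ?_
    have hk : (0 : ℝ) < k ! := by positivity
    have : |C k * C (k + 1)| ≤ C k * C k + C (k + 1) ^ 2 := by
      rw [abs_le]; constructor <;> nlinarith [sq_nonneg (C k + C (k+1)), sq_nonneg (C k - C (k+1)),
        sq_nonneg (C k), sq_nonneg (C (k+1))]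
    rw [Real.norm_eq_abs, abs_mul, abs_div, abs_of_pos hk, abs_of_nonneg (pow_nonneg hs₀ k)]
    unfold hermiteTerm
    rw [← add_mul, ← add_div]
    gcongr
  -- Summing the three-term recurrence gives linear relations between the series `M` of squares, `L`
  -- of products of neighbours and `D = M'`. Eliminating `L` leaves `D` as a multiple of `M`.
  set M := mehlerSum τ x s with hMdef
  set L := ∑' k : ℕ, C k * C (k + 1) / k ! * s ^ k with hLdef
  set D := ∑' k : ℕ, scaledHermite τ (k + 1) x ^ 2 / k ! * s ^ k with hDdef
  have hfac : ∀ k : ℕ, ((k + 1) ! : ℝ) = (k + 1) * k ! := fun k => by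
    rw [Nat.factorial_succ]; push_cast; ring
  have hne : ∀ k : ℕ, (k ! : ℝ) ≠ 0 := fun k => by positivity
  have hrec : ∀ k : ℕ, C (k + 2) = x * C (k + 1) - τ * (k + 1) * C k := fun k => rfl
  have hC0 : C 0 = 1 := rfl
  have hC1 : C 1 = x := rfl
  have eL : L = x * M - τ * s * L := by
    have h1 : L = C 0 * C 1 + ∑' k : ℕ, (x * (hermiteTerm τ x x (k + 1) * s ^ (k + 1))
        - τ * s * (C k * C (k + 1) / k ! * s ^ k)) := by
      rw [hLdef, hL.tsum_eq_zero_add]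
      congr 1
      · simp
      · refine tsum_congr fun k => ?_
        have := hne k
        have : (k : ℝ) + 1 ≠ 0 := by positivity
        simp only [hermiteTerm, hrec k, hfac]
        change _ = x * (C (k + 1) * C (k + 1) / _ * _) - _
        field_simp
        ring
    rw [Summable.tsum_sub (((summable_nat_add_iff 1).2 hM).mul_left x) (hL.mul_left _),
      tsum_mul_left, tsum_mul_left] at h1
    have h2 : M = 1 + ∑' k, hermiteTerm τ x x (k + 1) * s ^ (k + 1) := by
      rw [hMdef, mehlerSum, hM.tsum_eq_zero_add]
      simp [hermiteTerm, scaledHermite]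
    rw [h2]
    rw [hC0, hC1] at h1
    linarith
  have eK : ∑' k : ℕ, (k + 1) * (hermiteTerm τ x x k * s ^ k) = M + s * D := by
    have hkk : Summable fun k : ℕ => (k : ℝ) * (hermiteTerm τ x x k * s ^ k) := by
      refine (hk1.sub hM).congr fun k => ?_
      ring
    have h1 : ∑' k : ℕ, (k + 1) * (hermiteTerm τ x x k * s ^ k)
        = ∑' k : ℕ, (k : ℝ) * (hermiteTerm τ x x k * s ^ k) + M := by
      rw [hMdef, mehlerSum, ← hkk.tsum_add hM]
      exact tsum_congr fun k => by ring
    rw [h1, hkk.tsum_eq_zero_add, hDdef, ← tsum_mul_left, Nat.cast_zero, zero_mul, zero_add,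
      add_comm]
    congr 1
    refine tsum_congr fun k => ?_
    rw [← succ_mul_hermiteTerm_succ]
    push_cast
    ring
  have eD : D = x * L - τ * s * (x * L - τ * (M + s * D)) := by
    have h1 : D = x * x + ∑' k : ℕ, (x * (C (k + 1) * C (k + 1 + 1) / (k + 1) ! * s ^ (k + 1))
        - τ * s * (x * (C k * C (k + 1) / k ! * s ^ k)
          - τ * ((k + 1) * (hermiteTerm τ x x k * s ^ k)))) := by
      rw [hDdef, hD.tsum_eq_zero_add]
      congr 1
      · simp [scaledHermite, pow_two]
      · refine tsum_congr fun k => ?_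
        have := hne k
        have : (k : ℝ) + 1 ≠ 0 := by positivity
        have e : scaledHermite τ (k + 1 + 1) x = x * C (k + 1) - τ * (k + 1) * C k := rfl
        simp only [hermiteTerm, hrec k, hfac, e]
        change _ = _ - _ * (_ - _ * (_ * (C k * C k / _ * _)))
        field_simp
        ring
    rw [Summable.tsum_sub (((summable_nat_add_iff 1).2 hL).mul_left x)
      (((hL.mul_left _).sub (hk1.mul_left _)).mul_left _), tsum_mul_left, tsum_mul_left,
      Summable.tsum_sub (hL.mul_left _) (hk1.mul_left _), tsum_mul_left, tsum_mul_left, eK] at h1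
    have h2 : L = x + ∑' k, C (k + 1) * C (k + 1 + 1) / (k + 1) ! * s ^ (k + 1) := by
      rw [hLdef, hL.tsum_eq_zero_add]
      simp [hC0, hC1]
    nth_rewrite 1 [h2]
    linarith
  have hτs : τ * s < 1 := by nlinarith
  have p1 : 0 < 1 + τ * s := by positivity
  have p2 : 0 < 1 - τ ^ 2 * s ^ 2 := by nlinarith [mul_nonneg hτ₀ hs₀]
  have eL' : L = x * M / (1 + τ * s) := by
    rw [eq_div_iff p1.ne']; linarith
  have : (1 - τ ^ 2 * s ^ 2) * D = (1 - τ * s) * x * L + τ ^ 2 * s * M := by linarith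
  rw [eL'] at this
  have hD' : D = ((1 - τ * s) * x * (x * M / (1 + τ * s)) + τ ^ 2 * s * M)
      / (1 - τ ^ 2 * s ^ 2) := by
    rw [eq_div_iff p2.ne']; linarith
  have p3 : 1 - τ ^ 2 * s ^ 2 = (1 - τ * s) * (1 + τ * s) := by ring
  have p4 : 1 - τ * s ≠ 0 := by linarith
  rw [hD', p3]
  field_simp

/-- The generating function times the reciprocal of the claimed solution has zero derivative on `[0,
1]` and equals `1` at `s = 0`. -/
lemma mehlerSum_eq (hτ₀ : 0 ≤ τ) (hτ₁ : τ < 1) (x : ℝ) {s : ℝ} (hs₀ : 0 ≤ s) (hs₁ : s ≤ 1) :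
    mehlerSum τ x s = (√(1 - τ ^ 2 * s ^ 2))⁻¹ * Real.exp (s * x ^ 2 / (1 + τ * s)) := by
  set G := fun s => mehlerSum τ x s * (√(1 - τ ^ 2 * s ^ 2) * Real.exp (-(s * x ^ 2 / (1 + τ * s))))
    with hG
  have pos : ∀ s, 0 ≤ s → s ≤ 1 → 0 < 1 + τ * s ∧ 0 < 1 - τ ^ 2 * s ^ 2 := fun s h0 h1 => by
    have hτs : τ * s < 1 := by nlinarith
    exact ⟨by positivity, by nlinarith [mul_nonneg hτ₀ h0]⟩
  have hder : ∀ s, 0 ≤ s → s ≤ 1 → HasDerivAt G 0 s := fun s h0 h1 => by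
    obtain ⟨p1, p2⟩ := pos s h0 h1
    have hd := hasDerivAt_mehlerSum hτ₀ hτ₁ x h0 h1
    rw [tsum_scaledHermite_succ_sq hτ₀ hτ₁ x h0 h1] at hd
    have d1 : HasDerivAt (fun s => 1 - τ ^ 2 * s ^ 2) (-(τ ^ 2 * (2 * s))) s := by
      have := ((hasDerivAt_pow 2 s).const_mul (τ ^ 2)).const_sub 1
      simpa using this
    have d2 : HasDerivAt (fun s => s * x ^ 2 / (1 + τ * s)) (x ^ 2 / (1 + τ * s) ^ 2) s := by
      have := ((hasDerivAt_id s).mul_const (x ^ 2)).div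
        (((hasDerivAt_id s).const_mul τ).const_add 1) p1.ne'
      refine this.congr_deriv ?_
      simp only [id]
      field_simp
      ring
    have d := hd.mul ((d1.sqrt p2.ne').mul d2.neg.exp)
    refine d.congr_deriv ?_
    have hq : √(1 - τ ^ 2 * s ^ 2) ≠ 0 := (Real.sqrt_pos.2 p2).ne'
    have hsq : 1 - τ ^ 2 * s ^ 2 = √(1 - τ ^ 2 * s ^ 2) ^ 2 := (Real.sq_sqrt p2.le).symm
    have e1 : τ ^ 2 * s / (1 - τ ^ 2 * s ^ 2) = τ ^ 2 * s / √(1 - τ ^ 2 * s ^ 2) ^ 2 := by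
      rw [← hsq]
    rw [e1]
    simp only [Pi.mul_apply, Pi.neg_apply]
    field_simp
    ring
  have hconst := constant_of_has_deriv_right_zero (f := G) (a := 0) (b := 1)
    (fun s hs => (hder s hs.1 hs.2).continuousAt.continuousWithinAt)
    (fun s hs => (hder s hs.1 hs.2.le).hasDerivWithinAt) s ⟨hs₀, hs₁⟩
  have h0 : G 0 = 1 := by
    have : mehlerSum τ x 0 = 1 := by
      unfold mehlerSum
      rw [tsum_eq_single 0 fun k hk => by simp [hk]]
      simp [hermiteTerm, scaledHermite]
    simp [hG, this]
  rw [h0] at hconst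
  obtain ⟨p1, p2⟩ := pos s hs₀ hs₁
  have hq : √(1 - τ ^ 2 * s ^ 2) ≠ 0 := (Real.sqrt_pos.2 p2).ne'
  simp only [hG, Real.exp_neg] at hconst
  have he := Real.exp_pos (s * x ^ 2 / (1 + τ * s))
  field_simp at hconst ⊢
  linarith

/-- **Mehler's formula** on the diagonal. -/
lemma hasSum_hermiteTerm_pow (hτ₀ : 0 ≤ τ) (hτ₁ : τ < 1) (x : ℝ) {s : ℝ} (hs₀ : 0 ≤ s)
    (hs₁ : s ≤ 1) : HasSum (fun k => hermiteTerm τ x x k * s ^ k)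
      ((√(1 - τ ^ 2 * s ^ 2))⁻¹ * Real.exp (s * x ^ 2 / (1 + τ * s))) := by
  rw [← mehlerSum_eq hτ₀ hτ₁ x hs₀ hs₁]
  exact (summable_hermiteTerm hτ₀ hτ₁ x hs₀ hs₁).hasSum

end Mehler

/-! ### Concentration of the Hermite weights -/

section Concentration

variable {τ : ℝ}

/-- Summation of the recursion `W_{k+1} = τ W_k + a_{k+1}`. Up to a boundary term, the weighted
kernel is a plain partial sum divided by `1 - τ`. -/
lemma one_sub_mul_kernelSum (a : ℕ → ℝ) (m : ℕ) :
    (1 - τ) * kernelSum τ a m = ∑ k ∈ Finset.range (m + 1), a k - τ * accum τ a m := by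
  induction m with
  | zero => simp [kernelSum, accum]; ring
  | succ m ih =>
    rw [Finset.sum_range_succ, kernelSum, mul_add, ih, accum]
    ring

lemma kernelSum_eq_sum_accum (a : ℕ → ℝ) (m : ℕ) :
    kernelSum τ a m = ∑ k ∈ Finset.range (m + 1), accum τ a k := by
  induction m with
  | zero => simp [kernelSum, accum]
  | succ m ih => rw [Finset.sum_range_succ, ← ih, kernelSum]

lemma one_sub_mul_kernelSum_le (hτ₀ : 0 ≤ τ) {a : ℕ → ℝ} (ha : ∀ k, 0 ≤ a k) {T : ℝ}
    (hT : HasSum a T) (m : ℕ) : (1 - τ) * kernelSum τ a m ≤ T := by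
  rw [one_sub_mul_kernelSum]
  have h1 := mul_nonneg hτ₀ (accum_nonneg hτ₀ ha m)
  have h2 := sum_le_hasSum (Finset.range (m + 1)) (fun k _ => ha k) hT
  linarith

lemma sum_sum_range_succ (a : ℕ → ℝ) (m : ℕ) :
    ∑ j ∈ Finset.range m, ∑ k ∈ Finset.range (j + 1), a k
      = ∑ k ∈ Finset.range m, ((m : ℝ) - k) * a k := by
  induction m with
  | zero => simp
  | succ m ih =>
    rw [Finset.sum_range_succ, ih, Finset.sum_range_succ (fun k => a k), Finset.sum_range_succ,
      ← add_assoc, ← Finset.sum_add_distrib]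
    push_cast
    congr 1
    · exact Finset.sum_congr rfl fun k _ => by ring
    · ring

/-- The double sum of the kernels, up to an error of the order of the total mass. -/
lemma abs_sum_kernelSum_sub_le (hτ₀ : 0 ≤ τ) (hτ₁ : τ < 1) {a : ℕ → ℝ} (ha : ∀ k, 0 ≤ a k) {T : ℝ}
    (hT : HasSum a T) (m : ℕ) :
    |(1 - τ) * ∑ j ∈ Finset.range m, kernelSum τ a j
      - ∑ k ∈ Finset.range m, ((m : ℝ) - k) * a k| ≤ τ / (1 - τ) * T := by
  have h1 : (1 - τ) * ∑ j ∈ Finset.range m, kernelSum τ a j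
      - ∑ k ∈ Finset.range m, ((m : ℝ) - k) * a k
      = -(τ * ∑ j ∈ Finset.range m, accum τ a j) := by
    rw [← sum_sum_range_succ, Finset.mul_sum, Finset.mul_sum, ← Finset.sum_sub_distrib,
      ← Finset.sum_neg_distrib]
    exact Finset.sum_congr rfl fun j _ => by rw [one_sub_mul_kernelSum]; ring
  have h2 : 0 ≤ ∑ j ∈ Finset.range m, accum τ a j :=
    Finset.sum_nonneg fun k _ => accum_nonneg hτ₀ ha k
  have h3 : ∑ j ∈ Finset.range m, accum τ a j ≤ kernelSum τ a m := by
    rw [kernelSum_eq_sum_accum, Finset.sum_range_succ]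
    linarith [accum_nonneg hτ₀ ha m]
  have h4 := one_sub_mul_kernelSum_le hτ₀ ha hT m
  have h5 : ∑ j ∈ Finset.range m, accum τ a j ≤ T / (1 - τ) := by
    rw [le_div_iff₀ (by linarith)]
    nlinarith
  rw [h1, abs_neg, abs_of_nonneg (mul_nonneg hτ₀ h2)]
  calc τ * ∑ j ∈ Finset.range m, accum τ a j ≤ τ * (T / (1 - τ)) := by gcongr
    _ = _ := by ring

/-- The total mass `∑ C_k(x)² / k!` of the Hermite weights. -/
def hermiteMass (τ x : ℝ) : ℝ := (√(1 - τ ^ 2))⁻¹ * Real.exp (x ^ 2 / (1 + τ))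

lemma hermiteMass_pos (hτ₀ : 0 ≤ τ) (hτ₁ : τ < 1) (x : ℝ) : 0 < hermiteMass τ x := by
  have h1 : 0 < 1 - τ ^ 2 := by nlinarith
  unfold hermiteMass
  positivity

lemma hasSum_hermiteTerm (hτ₀ : 0 ≤ τ) (hτ₁ : τ < 1) (x : ℝ) :
    HasSum (hermiteTerm τ x x) (hermiteMass τ x) := by
  have := hasSum_hermiteTerm_pow hτ₀ hτ₁ x zero_le_one le_rfl
  simpa [hermiteMass] using this

/-- On `u ≤ 1` the slope of `exp (-u)` is at least `1/e` in absolute value, so `1 - u` is a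
Lipschitz function of `exp (-u)` with constant `e`; beyond `1` the truncation helps. This allows the
Laplace transform to control the truncated linear sum. -/
lemma abs_max_one_sub_le {u c : ℝ} (hc₁ : c ≤ 1) :
    |max (1 - u) 0 - (1 - c)| ≤ Real.exp 1 * |Real.exp (-u) - Real.exp (-c)| := by
  have key : ∀ a b : ℝ, a ≤ b → b ≤ 1 → b - a ≤ Real.exp 1 * (Real.exp (-a) - Real.exp (-b)) := by
    intro a b hab hb
    have h1 : b - a + 1 ≤ Real.exp (b - a) := Real.add_one_le_exp _
    have h2 : 1 ≤ Real.exp (1 - b) := Real.one_le_exp (by linarith)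
    have e : Real.exp 1 * (Real.exp (-a) - Real.exp (-b))
        = Real.exp (1 - b) * (Real.exp (b - a) - 1) := by
      rw [mul_sub, mul_sub, ← Real.exp_add, ← Real.exp_add, ← Real.exp_add]
      ring_nf
    rw [e]
    nlinarith
  rcases le_total u 1 with hu1 | hu1
  · rw [max_eq_left (by linarith)]
    rcases le_total u c with h | h
    · have := key u c h hc₁
      rw [abs_of_nonneg (by linarith), abs_of_nonneg (sub_nonneg.2 (Real.exp_le_exp.2 (by linarith)))]
      linarith
    · have := key c u h hu1
      rw [abs_of_nonpos (by linarith), abs_of_nonpos (sub_nonpos.2 (Real.exp_le_exp.2 (by linarith)))]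
      linarith
  · have := key c 1 hc₁ le_rfl
    have h3 : Real.exp (-u) ≤ Real.exp (-1) := Real.exp_le_exp.2 (by linarith)
    rw [max_eq_right (by linarith), abs_of_nonpos (by linarith),
      abs_of_nonpos (sub_nonpos.2 (Real.exp_le_exp.2 (by linarith)))]
    nlinarith [Real.exp_pos 1]

/-- Chebyshev's inequality for the weights `a`, through the Laplace transform. -/
lemma abs_sum_sub_le {a : ℕ → ℝ} (ha : ∀ k, 0 ≤ a k) {T T₁ T₂ c ε : ℝ} {m : ℕ} (hm : 0 < m)
    (hc₁ : c ≤ 1) (hε : 0 < ε) (h0 : HasSum a T)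
    (h1 : HasSum (fun k => a k * Real.exp (-1 / m) ^ k) T₁)
    (h2 : HasSum (fun k => a k * Real.exp (-2 / m) ^ k) T₂) :
    |(∑ k ∈ Finset.range m, ((m : ℝ) - k) * a k) / m - (1 - c) * T|
      ≤ Real.exp 1 * (ε * T
        + ε⁻¹ * (T₂ - 2 * Real.exp (-c) * T₁ + Real.exp (-c) ^ 2 * T)) := by
  have hm' : (0 : ℝ) < m := by exact_mod_cast hm
  have e1 : ∀ k : ℕ, Real.exp (-1 / m) ^ k = Real.exp (-(k / m)) := fun k => by
    rw [← Real.exp_nat_mul]; congr 1; ring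
  have e2 : ∀ k : ℕ, Real.exp (-2 / m) ^ k = Real.exp (-(k / m)) ^ 2 := fun k => by
    rw [← Real.exp_nat_mul, ← Real.exp_nat_mul]; congr 1; push_cast; ring
  simp only [e1] at h1
  simp only [e2] at h2
  -- The finite sum is a full series with weight `max (1 - k/m) 0`, since truncation removes the
  -- indices beyond `m`.
  have hs : HasSum (fun k : ℕ => max (1 - (k : ℝ) / m) 0 * a k)
      ((∑ k ∈ Finset.range m, ((m : ℝ) - k) * a k) / m) := by
    rw [Finset.sum_div]
    have := hasSum_sum_of_ne_finset_zero (f := fun k : ℕ => max (1 - (k : ℝ) / m) 0 * a k)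
      (s := Finset.range m) (L := .unconditional ℕ) (fun k hk => ?_)
    · convert this using 1
      refine Finset.sum_congr rfl fun k hk => ?_
      have : (k : ℝ) / m ≤ 1 := by
        rw [div_le_one hm']
        exact_mod_cast (Finset.mem_range.1 hk).le
      rw [max_eq_left (by linarith)]
      field_simp
    · have : 1 ≤ (k : ℝ) / m := by
        rw [one_le_div hm']
        exact_mod_cast (by simpa using hk : m ≤ k)
      rw [max_eq_right (by linarith), zero_mul]
  have hd := hs.sub (h0.mul_left (1 - c))
  have hb : HasSum (fun k : ℕ => Real.exp 1 * (ε * a k + ε⁻¹ * (a k * Real.exp (-(k / m)) ^ 2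
      - 2 * Real.exp (-c) * (a k * Real.exp (-(k / m))) + Real.exp (-c) ^ 2 * a k))) _ :=
    ((h0.mul_left ε).add (((h2.sub (h1.mul_left (2 * Real.exp (-c)))).add
      (h0.mul_left (Real.exp (-c) ^ 2))).mul_left ε⁻¹)).mul_left (Real.exp 1)
  rw [← hd.tsum_eq, ← hb.tsum_eq, ← Real.norm_eq_abs]
  refine tsum_of_norm_bounded hb.summable.hasSum fun k => ?_
  have h := abs_max_one_sub_le (u := (k : ℝ) / m) hc₁
  have hk := ha k
  set d := Real.exp (-((k : ℝ) / m)) - Real.exp (-c) with hd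
  -- The quadratic term, weighted by `a_k` and summed, is the variance-like combination of the two
  -- Laplace transforms with the total mass.
  have h3 : |d| ≤ ε + ε⁻¹ * d ^ 2 := by
    have : 0 ≤ ε⁻¹ * (|d| - ε) ^ 2 := by positivity
    have e : ε⁻¹ * (|d| - ε) ^ 2 = ε⁻¹ * d ^ 2 - 2 * |d| + ε := by
      rw [← sq_abs d]; field_simp; ring
    have := abs_nonneg d
    linarith
  rw [← sub_mul, Real.norm_eq_abs, abs_mul, abs_of_nonneg hk]
  calc |max (1 - (k : ℝ) / m) 0 - (1 - c)| * a k
      ≤ (Real.exp 1 * (ε + ε⁻¹ * d ^ 2)) * a k := by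
        gcongr
        exact h.trans (by gcongr)
    _ = _ := by rw [hd]; ring

lemma tendsto_mul_exp_sub_one (θ : ℝ) :
    Tendsto (fun m : ℕ => (m : ℝ) * (Real.exp (-θ / m) - 1)) atTop (𝓝 (-θ)) := by
  have h : HasDerivAt (fun y : ℝ => Real.exp (-θ * y)) (-θ) 0 := by
    simpa using ((hasDerivAt_id (0 : ℝ)).const_mul (-θ)).exp
  have h2 := h.tendsto_slope_zero_right.comp
    (tendsto_inv_atTop_nhdsGT_zero.comp (tendsto_natCast_atTop_atTop (R := ℝ)))
  refine h2.congr fun m => ?_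
  simp [div_eq_mul_inv]

/-- The Laplace transform of the Hermite weights at the scale of the matrix size. -/
lemma tendsto_laplace (hτ₀ : 0 ≤ τ) (hτ₁ : τ < 1) (z θ : ℝ) :
    Tendsto (fun m : ℕ => (√(1 - τ ^ 2 * Real.exp (-θ / m) ^ 2))⁻¹
        * Real.exp (Real.exp (-θ / m) * (√((m + 2 : ℕ) : ℝ) * z) ^ 2 / (1 + τ * Real.exp (-θ / m)))
        / hermiteMass τ (√((m + 2 : ℕ) : ℝ) * z)) atTop
      (𝓝 (Real.exp (-(θ * (z ^ 2 / (1 + τ) ^ 2))))) := by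
  have h1 : 0 < 1 - τ ^ 2 := by nlinarith
  have hs : Tendsto (fun m : ℕ => Real.exp (-θ / m)) atTop (𝓝 1) := by
    have := Real.continuous_exp.tendsto 0 |>.comp (tendsto_const_div_atTop_nhds_zero_nat (-θ))
    simpa [Function.comp_def] using this
  have hq : Tendsto (fun m : ℕ => (√(1 - τ ^ 2 * Real.exp (-θ / m) ^ 2))⁻¹ * √(1 - τ ^ 2)) atTop
      (𝓝 1) := by
    have h2 := ((((hs.pow 2).const_mul (τ ^ 2)).const_sub 1).sqrt.inv₀ (by
      simpa using (Real.sqrt_pos.2 h1).ne')).mul_const (√(1 - τ ^ 2))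
    simpa [(Real.sqrt_pos.2 h1).ne'] using h2
  have hN : Tendsto (fun m : ℕ => ((m + 2 : ℕ) : ℝ) / m) atTop (𝓝 1) := by
    have h2 := (tendsto_const_div_atTop_nhds_zero_nat (2 : ℝ)).const_add 1
    rw [add_zero] at h2
    refine h2.congr' ?_
    filter_upwards [eventually_gt_atTop 0] with m hm
    have : (m : ℝ) ≠ 0 := by positivity
    push_cast
    field_simp
  -- The difference of exponents is `s x² / (1 + τ s) - x² / (1 + τ) = (s - 1) x² / ((1 + τ s)(1 +
  -- τ))`, and `x² = N z²` matches `s - 1 ≈ -θ / m`.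
  have he : Tendsto (fun m : ℕ => ((m + 2 : ℕ) : ℝ) / m * ((m : ℝ) * (Real.exp (-θ / m) - 1))
      * (z ^ 2 / ((1 + τ * Real.exp (-θ / m)) * (1 + τ)))) atTop
      (𝓝 (-(θ * (z ^ 2 / (1 + τ) ^ 2)))) := by
    have h3 := (hN.mul (tendsto_mul_exp_sub_one θ)).mul
      ((tendsto_const_nhds (x := z ^ 2)).div (((hs.const_mul τ).const_add 1).mul_const (1 + τ))
        (by positivity))
    have e : -(θ * (z ^ 2 / (1 + τ) ^ 2)) = 1 * -θ * (z ^ 2 / ((1 + τ * 1) * (1 + τ))) := by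
      rw [mul_one τ, ← pow_two]
      ring
    rw [e]
    exact h3
  have := hq.mul ((Real.continuous_exp.tendsto _).comp he)
  rw [one_mul] at this
  refine this.congr' ?_
  filter_upwards [eventually_gt_atTop 0] with m hm
  have hm' : (m : ℝ) ≠ 0 := by positivity
  simp only [Function.comp_apply, hermiteMass, mul_pow, Real.sq_sqrt (Nat.cast_nonneg (m + 2))]
  set s := Real.exp (-θ / m)
  have hspos : 0 < s := Real.exp_pos _
  have e : Real.exp (((m + 2 : ℕ) : ℝ) / m * ((m : ℝ) * (s - 1))
      * (z ^ 2 / ((1 + τ * s) * (1 + τ))))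
      = Real.exp (s * (((m + 2 : ℕ) : ℝ) * z ^ 2) / (1 + τ * s))
        / Real.exp (((m + 2 : ℕ) : ℝ) * z ^ 2 / (1 + τ)) := by
    rw [← Real.exp_sub]
    congr 1
    field_simp
    ring
  rw [e]
  have := (Real.sqrt_pos.2 h1).ne'
  field_simp

/-- Concentration of the Hermite weights at `√N z` around `N z² / (1 + τ)²`. -/
lemma tendsto_sum_hermiteTerm (hτ₀ : 0 ≤ τ) (hτ₁ : τ < 1) {z : ℝ} (hz : |z| < 1 + τ) :
    Tendsto (fun m : ℕ => (∑ k ∈ Finset.range m, ((m : ℝ) - k)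
        * hermiteTerm τ (√((m + 2 : ℕ) : ℝ) * z) (√((m + 2 : ℕ) : ℝ) * z) k) / m
        / hermiteMass τ (√((m + 2 : ℕ) : ℝ) * z)) atTop (𝓝 (1 - z ^ 2 / (1 + τ) ^ 2)) := by
  set c := z ^ 2 / (1 + τ) ^ 2 with hc
  have hc₁ : c ≤ 1 := by
    rw [hc, div_le_one (by positivity)]
    exact sq_le_sq' (by linarith [(abs_lt.1 hz).1]) (abs_lt.1 hz).2.le
  -- The normalized second moment of `exp (-k/m) - exp (-c)` under the Hermite weights tends to
  -- zero: this is the concentration at `k ≈ c m`.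
  have hV := ((tendsto_laplace hτ₀ hτ₁ z 2).sub ((tendsto_laplace hτ₀ hτ₁ z 1).const_mul
    (2 * Real.exp (-c)))).add_const (Real.exp (-c) ^ 2)
  have hlim : Real.exp (-(2 * c)) - 2 * Real.exp (-c) * Real.exp (-(1 * c)) + Real.exp (-c) ^ 2
      = 0 := by
    have : Real.exp (-(2 * c)) = Real.exp (-c) ^ 2 := by
      rw [← Real.exp_nat_mul]; congr 1; push_cast; ring
    rw [this, one_mul]; ring
  rw [hlim] at hV
  rw [Metric.tendsto_nhds]
  intro δ hδ
  -- With the second moment below `ε²` the error is at most `2 e ε = 2 δ / 3`, relative to the total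
  -- mass.
  set ε := δ / (3 * Real.exp 1) with hε
  have hε0 : 0 < ε := by positivity
  filter_upwards [eventually_gt_atTop 0, hV.eventually (gt_mem_nhds (by positivity : 0 < ε ^ 2))]
    with m hm hVm
  set x := √((m + 2 : ℕ) : ℝ) * z with hx
  have hT := hermiteMass_pos hτ₀ hτ₁ x
  have hle : ∀ θ : ℝ, 0 ≤ θ → Real.exp (-θ / m) ≤ 1 := fun θ hθ => by
    rw [Real.exp_le_one_iff, neg_div, neg_nonpos]; positivity
  have hb := abs_sum_sub_le (hermiteTerm_self_nonneg x) hm hc₁ hε0 (hasSum_hermiteTerm hτ₀ hτ₁ x)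
    (hasSum_hermiteTerm_pow hτ₀ hτ₁ x (Real.exp_pos _).le (hle 1 (by norm_num)))
    (hasSum_hermiteTerm_pow hτ₀ hτ₁ x (Real.exp_pos _).le (hle 2 (by norm_num)))
  set T := hermiteMass τ x
  set T₁ := (√(1 - τ ^ 2 * Real.exp (-1 / m) ^ 2))⁻¹
    * Real.exp (Real.exp (-1 / m) * x ^ 2 / (1 + τ * Real.exp (-1 / m)))
  set T₂ := (√(1 - τ ^ 2 * Real.exp (-2 / m) ^ 2))⁻¹
    * Real.exp (Real.exp (-2 / m) * x ^ 2 / (1 + τ * Real.exp (-2 / m)))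
  set S := (∑ k ∈ Finset.range m, ((m : ℝ) - k) * hermiteTerm τ x x k) / m
  have hV' : T₂ - 2 * Real.exp (-c) * T₁ + Real.exp (-c) ^ 2 * T ≤ ε ^ 2 * T := by
    have h : T₂ / T - 2 * Real.exp (-c) * (T₁ / T) + Real.exp (-c) ^ 2 ≤ ε ^ 2 := hVm.le
    have h2 := mul_le_mul_of_nonneg_right h hT.le
    have e : (T₂ / T - 2 * Real.exp (-c) * (T₁ / T) + Real.exp (-c) ^ 2) * T
        = T₂ - 2 * Real.exp (-c) * T₁ + Real.exp (-c) ^ 2 * T := by field_simp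
    linarith
  have h4 : |S - (1 - c) * T| ≤ Real.exp 1 * (ε * T + ε⁻¹ * (ε ^ 2 * T)) :=
    hb.trans (by gcongr)
  have e5 : Real.exp 1 * (ε * T + ε⁻¹ * (ε ^ 2 * T)) = 2 / 3 * δ * T := by
    rw [hε]; field_simp; ring
  have e6 : S / T - (1 - c) = (S - (1 - c) * T) / T := by field_simp
  rw [Real.dist_eq, e6, abs_div, abs_of_pos hT, div_lt_iff₀ hT]
  nlinarith

/-- The double kernel sum at `√N z` is asymptotically `N (1 - z² / (1 + τ)²) / (1 - τ)` times the
total mass. -/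
lemma tendsto_sum_kernelSum (hτ₀ : 0 ≤ τ) (hτ₁ : τ < 1) {z : ℝ} (hz : |z| < 1 + τ) :
    Tendsto (fun m : ℕ => (∑ j ∈ Finset.range m, kernelSum τ
        (hermiteTerm τ (√((m + 2 : ℕ) : ℝ) * z) (√((m + 2 : ℕ) : ℝ) * z)) j) / m
        / hermiteMass τ (√((m + 2 : ℕ) : ℝ) * z)) atTop
      (𝓝 ((1 - z ^ 2 / (1 + τ) ^ 2) / (1 - τ))) := by
  have hτ : 0 < 1 - τ := by linarith
  suffices h : Tendsto (fun m : ℕ => ((1 - τ) * ∑ j ∈ Finset.range m, kernelSum τ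
      (hermiteTerm τ (√((m + 2 : ℕ) : ℝ) * z) (√((m + 2 : ℕ) : ℝ) * z)) j) / m
      / hermiteMass τ (√((m + 2 : ℕ) : ℝ) * z)) atTop (𝓝 (1 - z ^ 2 / (1 + τ) ^ 2)) by
    refine (h.div_const (1 - τ)).congr fun m => ?_
    field_simp
  have h0 : Tendsto (fun m : ℕ => τ / (1 - τ) / m) atTop (𝓝 0) :=
    tendsto_const_div_atTop_nhds_zero_nat _
  refine (tendsto_sum_hermiteTerm hτ₀ hτ₁ hz).congr_dist (squeeze_zero' (Eventually.of_forall
    fun _ => dist_nonneg) ?_ h0)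
  filter_upwards [eventually_gt_atTop 0] with m hm
  have hm' : (0 : ℝ) < m := by exact_mod_cast hm
  set x := √((m + 2 : ℕ) : ℝ) * z with hx
  have hT := hermiteMass_pos hτ₀ hτ₁ x
  have h := abs_sum_kernelSum_sub_le hτ₀ hτ₁ (hermiteTerm_self_nonneg x)
    (hasSum_hermiteTerm hτ₀ hτ₁ x) m
  rw [dist_comm, Real.dist_eq, ← sub_div, ← sub_div, abs_div, abs_div, abs_of_pos hT,
    abs_of_pos hm', div_div, div_le_iff₀ (by positivity)]
  refine h.trans (le_of_eq ?_)
  field_simp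

end Concentration

/-! ### Asymptotics of the tilt average -/

section TiltAsymptotics

open Nat

variable {τ : ℝ} {n : ℕ}

/-- The mean of the square of `μ det + c Tr adj`. Used with both signs of `c`, it replaces
Cauchy–Schwarz for the mixed average. -/
lemma quadratic_avg_nonneg (hτ₀ : 0 ≤ τ) (hτ₁ : τ < 1) (x μ c : ℝ) :
    0 ≤ μ ^ 2 * avgDetDet τ n x x + 2 * c * μ * avgDetTrace τ n x x
      + c ^ 2 * avgTraceTrace τ n x x := by
  have hprob := isProbabilityMeasure_ensemble hτ₀ hτ₁ n
  have hD := (tame_shiftDet (n := n) hτ₀ hτ₁).moments x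
  have hT := (tame_trace_shiftAdj (n := n) hτ₀ hτ₁).moments x
  have k1 := (hD.mul hD).const_mul (μ ^ 2)
  have k2 := (hD.mul hT).const_mul (2 * c * μ)
  have k3 := (hT.mul hT).const_mul (c ^ 2)
  unfold avgDetDet avgDetTrace avgTraceTrace
  rw [← integral_const_mul, ← integral_const_mul, ← integral_const_mul,
    ← integral_add k1.integrable k2.integrable,
    ← integral_add (k1.add k2).integrable k3.integrable]
  refine integral_nonneg fun X => ?_
  have := sq_nonneg (μ * shiftDet x X + c * (shiftAdj x X).trace)
  simp only [Pi.zero_apply]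
  nlinarith

/-- Entrywise `2 |A_ij A_ji| ≤ A_ij² + A_ji²`. Thus `avgTraceMul` is controlled on the diagonal
without an explicit formula there. -/
lemma abs_trace_mul_self_le (A : Matrix (Fin n) (Fin n) ℝ) :
    |(A * A).trace| ≤ (A * Aᵀ).trace := by
  have h1 : (A * A).trace = ∑ i, ∑ j, A i j * A j i := by simp [Matrix.trace, Matrix.mul_apply]
  have h2 : (A * Aᵀ).trace = ∑ i, ∑ j, (A i j ^ 2 + A j i ^ 2) / 2 := by
    have h3 : ∑ i, ∑ j, A j i ^ 2 = ∑ i, ∑ j, A i j ^ 2 := Finset.sum_comm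
    have h4 : (A * Aᵀ).trace = ∑ i, ∑ j, A i j ^ 2 := by
      simp [Matrix.trace, Matrix.mul_apply, pow_two]
    simp only [← Finset.sum_div, Finset.sum_add_distrib, h3, h4]
    ring
  rw [h1, h2]
  refine (Finset.abs_sum_le_sum_abs _ _).trans (Finset.sum_le_sum fun i _ =>
    (Finset.abs_sum_le_sum_abs _ _).trans (Finset.sum_le_sum fun j _ => ?_))
  rw [abs_le]
  constructor <;> nlinarith [sq_nonneg (A i j + A j i), sq_nonneg (A i j - A j i)]

lemma abs_avgTraceMul_le (hτ₀ : 0 ≤ τ) (hτ₁ : τ < 1) (x : ℝ) :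
    |avgTraceMul τ n x x| ≤ avgTraceMulTranspose τ n x x := by
  have hprob := isProbabilityMeasure_ensemble hτ₀ hτ₁ n
  unfold avgTraceMul avgTraceMulTranspose
  refine abs_integral_le_integral_abs.trans (integral_mono
    (hasMoments_trace_mul hτ₀ hτ₁ x x).integrable.abs
    (hasMoments_trace_mul_transpose hτ₀ hτ₁ x x).integrable fun X => abs_trace_mul_self_le _)

/-- The last term dominates in the tilt average. -/
lemma abs_tiltAverage_sub_le (hτ₀ : 0 ≤ τ) (hτ₁ : τ < 1) (μ q x : ℝ) (hq : 0 ≤ q) (a : ℝ) :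
    |tiltAverage τ n μ q a x - a * (1 - τ ^ 2) * avgTraceMulTranspose τ n x x|
      ≤ (2 * μ ^ 2 + q) * avgDetDet τ n x x + 2 * a ^ 2 * (avgTraceTrace τ n x x
        + avgTraceMulTranspose τ n x x) := by
  have h0 : 0 ≤ avgDetDet τ n x x := by simpa using quadratic_avg_nonneg (n := n) hτ₀ hτ₁ x 1 0
  have h2 : 0 ≤ avgTraceTrace τ n x x := by simpa using quadratic_avg_nonneg (n := n) hτ₀ hτ₁ x 0 1
  have h4 := abs_le.1 (abs_avgTraceMul_le (n := n) hτ₀ hτ₁ x)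
  -- The two signs together bound the mixed term `2 a τ μ avgDetTrace` from above and below.
  have hp := quadratic_avg_nonneg (n := n) hτ₀ hτ₁ x μ (a * τ)
  have hm := quadratic_avg_nonneg (n := n) hτ₀ hτ₁ x μ (-(a * τ))
  have hb : (a * τ) ^ 2 ≤ a ^ 2 := by
    rw [mul_pow]
    exact mul_le_of_le_one_right (sq_nonneg a) (by nlinarith)
  unfold tiltAverage
  generalize avgDetDet τ n x x = F0 at *
  generalize avgDetTrace τ n x x = F1 at *
  generalize avgTraceTrace τ n x x = F2 at *
  generalize avgTraceMul τ n x x = F4 at *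
  generalize avgTraceMulTranspose τ n x x = F3 at *
  have hF3 : 0 ≤ F3 := by linarith
  have hb0 : 0 ≤ (a * τ) ^ 2 := sq_nonneg _
  have hb2 : (a * τ) ^ 2 * (F2 + F3) ≤ a ^ 2 * (F2 + F3) := by gcongr
  have hqF := mul_nonneg hq h0
  have i1 : 0 ≤ (a * τ) ^ 2 * (F3 - F4) := mul_nonneg hb0 (by linarith)
  have i2 : 0 ≤ (a * τ) ^ 2 * (F3 + F4) := mul_nonneg hb0 (by linarith)
  have i3 := mul_nonneg (sq_nonneg μ) h0
  rw [neg_sq] at hm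
  rw [abs_le]
  constructor <;> linarith

lemma avgDetDet_le (hτ₀ : 0 ≤ τ) (hτ₁ : τ < 1) (m : ℕ) (x : ℝ) :
    avgDetDet τ m x x ≤ m ! * hermiteMass τ x * (1 - τ)⁻¹ := by
  have hτ : 0 < 1 - τ := by linarith
  rw [avgDetDet_eq hτ₀ hτ₁, mul_assoc]
  gcongr
  rw [← div_eq_mul_inv, le_div_iff₀ hτ, mul_comm]
  exact one_sub_mul_kernelSum_le hτ₀ (hermiteTerm_self_nonneg x) (hasSum_hermiteTerm hτ₀ hτ₁ x) m

lemma avgTraceTrace_add_le (hτ₀ : 0 ≤ τ) (hτ₁ : τ < 1) (m : ℕ) (x : ℝ) :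
    avgTraceTrace τ (m + 1) x x + avgTraceMulTranspose τ (m + 1) x x
      ≤ (m + 1) ! * hermiteMass τ x * (2 * (m + 1) * (1 - τ)⁻¹) := by
  have hτ : 0 < 1 - τ := by linarith
  have hk : ∀ j, kernelSum τ (hermiteTerm τ x x) j ≤ hermiteMass τ x * (1 - τ)⁻¹ := fun j => by
    rw [← div_eq_mul_inv, le_div_iff₀ hτ, mul_comm]
    exact one_sub_mul_kernelSum_le hτ₀ (hermiteTerm_self_nonneg x) (hasSum_hermiteTerm hτ₀ hτ₁ x) j
  have h1 := avgTraceTrace_succ_le hτ₀ hτ₁ m x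
  have h2 : ∑ j ∈ Finset.range (m + 1), kernelSum τ (hermiteTerm τ x x) j
      ≤ (m + 1) * (hermiteMass τ x * (1 - τ)⁻¹) := by
    refine (Finset.sum_le_sum fun j _ => hk j).trans ?_
    simp
  have h3 : ((m : ℝ) + 1) * kernelSum τ (hermiteTerm τ x x) m
      ≤ (m + 1) * (hermiteMass τ x * (1 - τ)⁻¹) := by
    gcongr
    exact hk m
  rw [avgTraceMulTranspose_eq hτ₀ hτ₁]
  have hf : (0 : ℝ) ≤ (m + 1) ! := by positivity
  nlinarith [mul_le_mul_of_nonneg_left h2 hf, mul_le_mul_of_nonneg_left h3 hf]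

/-- The limit of the tilt average along a scaling in which `m a_m` converges. -/
lemma tendsto_tiltAverage (hτ₀ : 0 ≤ τ) (hτ₁ : τ < 1) {z : ℝ} (hz : |z| < 1 + τ)
    {μ q a : ℕ → ℝ} {κ : ℝ} (hq₀ : ∀ m, 0 ≤ q m) (hμ : Tendsto μ atTop (𝓝 0))
    (hq : Tendsto q atTop (𝓝 0)) (ha : Tendsto (fun m : ℕ => (m : ℝ) * a m) atTop (𝓝 κ)) :
    Tendsto (fun m : ℕ => tiltAverage τ m (μ m) (q m) (a m) (√((m + 2 : ℕ) : ℝ) * z)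
        / (m ! * hermiteMass τ (√((m + 2 : ℕ) : ℝ) * z))) atTop
      (𝓝 (κ * (1 + τ) * (1 - z ^ 2 / (1 + τ) ^ 2))) := by
  have hτ : 0 < 1 - τ := by linarith
  have hmain : Tendsto (fun m : ℕ => (m * a m) * (1 - τ ^ 2) * ((∑ j ∈ Finset.range m, kernelSum τ
        (hermiteTerm τ (√((m + 2 : ℕ) : ℝ) * z) (√((m + 2 : ℕ) : ℝ) * z)) j) / m
        / hermiteMass τ (√((m + 2 : ℕ) : ℝ) * z))) atTop
      (𝓝 (κ * (1 + τ) * (1 - z ^ 2 / (1 + τ) ^ 2))) := by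
    have h := (ha.mul_const (1 - τ ^ 2)).mul (tendsto_sum_kernelSum hτ₀ hτ₁ hz)
    have e : κ * (1 + τ) * (1 - z ^ 2 / (1 + τ) ^ 2)
        = κ * (1 - τ ^ 2) * ((1 - z ^ 2 / (1 + τ) ^ 2) / (1 - τ)) := by
      field_simp
      ring
    rw [e]
    exact h
  have hinv : Tendsto (fun m : ℕ => (m : ℝ)⁻¹) atTop (𝓝 0) := tendsto_inv_atTop_nhds_zero_nat
  -- The determinant average is of order `m!` times the mass and the trace averages of order `m! m`;
  -- the latter carry `a² = (m a)² / m²`, so one power of `m` is gained.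
  have herr : Tendsto (fun m : ℕ => (2 * μ m ^ 2 + q m) * (1 - τ)⁻¹
      + 4 * (m * a m) ^ 2 * (1 - τ)⁻¹ * (m : ℝ)⁻¹) atTop (𝓝 0) := by
    have h := ((((hμ.pow 2).const_mul 2).add hq).mul_const (1 - τ)⁻¹).add
      ((((ha.pow 2).const_mul 4).mul_const (1 - τ)⁻¹).mul hinv)
    simpa using h
  refine hmain.congr_dist (squeeze_zero' (Eventually.of_forall fun _ => dist_nonneg) ?_ herr)
  filter_upwards [eventually_gt_atTop 0] with m hm
  obtain ⟨m, rfl⟩ : ∃ k, m = k + 1 := ⟨m - 1, by omega⟩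
  set x := √((m + 1 + 2 : ℕ) : ℝ) * z with hx
  have hT := hermiteMass_pos hτ₀ hτ₁ x
  have hf : (0 : ℝ) < (m + 1) ! := by positivity
  have hm' : (0 : ℝ) < (m + 1 : ℕ) := by positivity
  have hb := abs_tiltAverage_sub_le (n := m + 1) hτ₀ hτ₁ (μ (m + 1)) (q (m + 1)) x (hq₀ _)
    (a (m + 1))
  have h0 := avgDetDet_le hτ₀ hτ₁ (m + 1) x
  have h2 := avgTraceTrace_add_le hτ₀ hτ₁ m x
  have hq' := hq₀ (m + 1)
  have hb' : |tiltAverage τ (m + 1) (μ (m + 1)) (q (m + 1)) (a (m + 1)) x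
      - a (m + 1) * (1 - τ ^ 2) * avgTraceMulTranspose τ (m + 1) x x|
      ≤ (2 * μ (m + 1) ^ 2 + q (m + 1)) * ((m + 1) ! * hermiteMass τ x * (1 - τ)⁻¹)
        + 2 * a (m + 1) ^ 2 * ((m + 1) ! * hermiteMass τ x * (2 * (m + 1) * (1 - τ)⁻¹)) :=
    hb.trans (by gcongr)
  have e1 : (((m + 1 : ℕ) : ℝ) * a (m + 1)) * (1 - τ ^ 2) * ((∑ j ∈ Finset.range (m + 1),
      kernelSum τ (hermiteTerm τ x x) j) / (m + 1 : ℕ) / hermiteMass τ x)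
      = a (m + 1) * (1 - τ ^ 2) * avgTraceMulTranspose τ (m + 1) x x
        / ((m + 1) ! * hermiteMass τ x) := by
    rw [avgTraceMulTranspose_eq hτ₀ hτ₁]
    field_simp
  rw [e1, _root_.dist_comm, Real.dist_eq, ← sub_div, abs_div, abs_of_pos (by positivity : (0 : ℝ) < (m + 1) !
    * hermiteMass τ x), div_le_iff₀ (by positivity)]
  refine hb'.trans (le_of_eq ?_)
  push_cast at hm' ⊢
  field_simp
  ring

end TiltAsymptotics

/-! ### The limit of the joint density -/

section Limit

open Nat

variable {τ : ℝ}

/-- Legendre's duplication formula for the two consecutive half-integer arguments. -/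
lemma radialConst_mul_radialConst (m : ℕ) :
    radialConst (m + 2) * radialConst (m + 1) = Real.pi ^ (m + 1) * 2 ^ m / m ! := by
  have h := Real.Gamma_mul_Gamma_add_half (((m + 1 : ℕ) : ℝ) / 2)
  have e1 : ((m + 1 : ℕ) : ℝ) / 2 + 1 / 2 = ((m + 2 : ℕ) : ℝ) / 2 := by push_cast; ring
  have e2 : 2 * (((m + 1 : ℕ) : ℝ) / 2) = (m : ℝ) + 1 := by push_cast; ring
  have e3 : 1 - ((m : ℝ) + 1) = -(m : ℝ) := by ring
  rw [e1, e2, Real.Gamma_nat_eq_factorial, e3, Real.rpow_neg (by norm_num), Real.rpow_natCast] at h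
  have g1 : 0 < Real.Gamma (((m + 1 : ℕ) : ℝ) / 2) := Real.Gamma_pos_of_pos (by positivity)
  have g2 : 0 < Real.Gamma (((m + 2 : ℕ) : ℝ) / 2) := Real.Gamma_pos_of_pos (by positivity)
  have hpi := Real.sqrt_pos.2 Real.pi_pos
  have hsq := Real.sq_sqrt Real.pi_pos.le
  unfold radialConst
  rw [_root_.div_mul_div_comm, mul_comm (Real.Gamma _), h]
  have e4 : √Real.pi ^ (m + 2) * √Real.pi ^ (m + 1) = Real.pi ^ (m + 1) * √Real.pi := by
    calc _ = (√Real.pi ^ 2) ^ (m + 1) * √Real.pi := by ring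
      _ = _ := by rw [hsq]
  rw [e4]
  field_simp

lemma jointDensity_prefactor (hτ₀ : 0 ≤ τ) (hτ₁ : τ < 1) (m : ℕ) :
    (normConst τ (m + 2))⁻¹ * radialConst (m + 2) * (normConst τ (m + 1) * radialConst (m + 1))
      = (2 * √(2 * Real.pi) * √(1 + τ) * √(1 - τ ^ 2) ^ (m + 1) * m !)⁻¹ := by
  have h1 : 0 < 1 - τ ^ 2 := by nlinarith
  have h2 : 0 < 1 + τ := by linarith
  have hC := normConst_pos hτ₀ hτ₁ (m + 1)
  have hpi : 0 < 2 * Real.pi := by positivity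
  have hsq := Real.sq_sqrt hpi.le
  have s1 := Real.sqrt_pos.2 hpi
  have s2 := Real.sqrt_pos.2 h1
  have s3 := Real.sqrt_pos.2 h2
  rw [normConst_succ hτ₀ hτ₁ (m + 1), mul_one, Real.sqrt_mul hpi.le (1 + τ),
    Real.sqrt_mul hpi.le (1 - τ ^ 2)]
  have e : (√(2 * Real.pi) * √(1 + τ) * √(2 * Real.pi) ^ (m + 1)
      * (√(2 * Real.pi) * √(1 - τ ^ 2)) ^ (m + 1) * normConst τ (m + 1))⁻¹ * radialConst (m + 2)
      * (normConst τ (m + 1) * radialConst (m + 1))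
      = (√(2 * Real.pi) * √(1 + τ) * (√(2 * Real.pi) ^ 2) ^ (m + 1) * √(1 - τ ^ 2) ^ (m + 1))⁻¹
        * (radialConst (m + 2) * radialConst (m + 1)) := by
    rw [← pow_mul]
    field_simp
    ring
  rw [e, radialConst_mul_radialConst, hsq, mul_pow]
  have hp := Real.pi_pos
  field_simp
  ring

end Limit

/-! ### Scaling limit, uniqueness and inverse gamma form -/

section JointDensity

open Nat

variable {τ : ℝ}

/-- A regrouping in which every factor has a limit. The power of `w` and the tilt mass combine to
`(1 + (1 - τ²) / w)^(-m/2)`; the Gaussian factors combine with the Hermite mass, leaving an exponent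
that stays bounded when `x²` and `w` are of order `N`. -/
lemma jointDensity_eq (hτ₀ : 0 ≤ τ) (hτ₁ : τ < 1) (m : ℕ) (x : ℝ) {w : ℝ} (hw : 0 < w) :
    jointDensity τ m x w = (√w * √(1 + w / (1 - τ ^ 2) * (1 + τ)))⁻¹
      * (√(1 + (1 - τ ^ 2) / w))⁻¹ ^ m
      * Real.exp (x ^ 2 / (2 * (1 + τ) * (1 + w / (1 - τ ^ 2) * (1 + τ))))
      * (tiltAverage τ m (x / (1 + w / (1 - τ ^ 2) * (1 + τ)))
          ((1 + τ) / (1 + w / (1 - τ ^ 2) * (1 + τ))) (1 / (1 + w / (1 - τ ^ 2))) x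
        / (m ! * hermiteMass τ x)) * (2 * √(2 * Real.pi) * √(1 + τ) * (1 - τ ^ 2))⁻¹ := by
  have h1 : 0 < 1 - τ ^ 2 := by nlinarith
  have h2 : 0 < 1 + τ := by linarith
  have hpi : 0 < 2 * Real.pi := by positivity
  have epow : w ^ (((m + 1 : ℕ) : ℝ) / 2 - 1) = √w ^ m * (√w)⁻¹ := by
    have e : ((m + 1 : ℕ) : ℝ) / 2 - 1 = 1 / 2 * m - 1 / 2 := by push_cast; ring
    rw [e, Real.rpow_sub hw, Real.rpow_mul hw.le, Real.rpow_natCast, ← Real.sqrt_eq_rpow,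
      div_eq_mul_inv]
  have esqrt : √(1 - τ ^ 2) * √(1 + w / (1 - τ ^ 2)) = √w * √(1 + (1 - τ ^ 2) / w) := by
    rw [← Real.sqrt_mul h1.le, ← Real.sqrt_mul hw.le]
    congr 1
    field_simp
    ring
  have eexp : Real.exp (-x ^ 2 / (2 * (1 + τ)))
      * Real.exp (-(w / (1 - τ ^ 2) * x ^ 2 / (2 * (1 + w / (1 - τ ^ 2) * (1 + τ)))))
      = Real.exp (x ^ 2 / (2 * (1 + τ) * (1 + w / (1 - τ ^ 2) * (1 + τ))))
        * (Real.exp (x ^ 2 / (1 + τ)))⁻¹ := by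
    rw [← Real.exp_neg, ← Real.exp_add, ← Real.exp_add]
    congr 1
    have hβ : 0 < 1 + w / (1 - τ ^ 2) * (1 + τ) := by positivity
    set β := 1 + w / (1 - τ ^ 2) * (1 + τ) with hβdef
    have hs : w / (1 - τ ^ 2) = (β - 1) / (1 + τ) := by
      rw [eq_div_iff h2.ne', hβdef]
      ring
    rw [hs]
    field_simp
    ring
  have hpre := jointDensity_prefactor hτ₀ hτ₁ m
  have hsq := Real.mul_self_sqrt h1.le
  have p1 := Real.sqrt_pos.2 h1
  have p2 := Real.sqrt_pos.2 h2
  have p3 := Real.sqrt_pos.2 hpi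
  have p4 := Real.sqrt_pos.2 hw
  have p5 : 0 < √(1 + w / (1 - τ ^ 2) * (1 + τ)) := Real.sqrt_pos.2 (by positivity)
  have p6 : 0 < √(1 + w / (1 - τ ^ 2)) := Real.sqrt_pos.2 (by positivity)
  have p7 : 0 < √(1 + (1 - τ ^ 2) / w) := Real.sqrt_pos.2 (by positivity)
  have ebase : (√(1 + (1 - τ ^ 2) / w))⁻¹ = √w * ((√(1 - τ ^ 2))⁻¹ * (√(1 + w / (1 - τ ^ 2)))⁻¹) := by
    rw [← mul_inv, esqrt]
    field_simp
  unfold jointDensity tiltedValue hermiteMass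
  generalize tiltAverage τ m _ _ _ x = A
  calc _ = ((normConst τ (m + 2))⁻¹ * radialConst (m + 2)
        * (normConst τ (m + 1) * radialConst (m + 1)))
        * (Real.exp (-x ^ 2 / (2 * (1 + τ)))
          * Real.exp (-(w / (1 - τ ^ 2) * x ^ 2 / (2 * (1 + w / (1 - τ ^ 2) * (1 + τ))))))
        * ((√(1 + w / (1 - τ ^ 2) * (1 + τ)))⁻¹ * (√(1 + w / (1 - τ ^ 2)))⁻¹ ^ m * A
          * w ^ (((m + 1 : ℕ) : ℝ) / 2 - 1)) := by ring
    _ = _ := by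
      rw [hpre, eexp, epow, ebase, mul_pow, mul_pow, ← hsq, Real.sqrt_mul_self p1.le, pow_succ]
      simp only [inv_pow]
      have he := Real.exp_pos (x ^ 2 / (1 + τ))
      field_simp

lemma tendsto_sqrt_one_add_div_pow {b t : ℝ} (hb : 0 ≤ b) (ht : 0 < t) :
    Tendsto (fun m : ℕ => (√(1 + b / (((m + 2 : ℕ) : ℝ) * t)))⁻¹ ^ m) atTop
      (𝓝 (Real.exp (-(b / (2 * t))))) := by
  have hN : Tendsto (fun m : ℕ => (m : ℝ) * (b / (((m + 2 : ℕ) : ℝ) * t))) atTop (𝓝 (b / t)) := by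
    have h := (tendsto_natCast_div_add_atTop (2 : ℝ)).mul_const (b / t)
    rw [one_mul] at h
    refine h.congr fun m => ?_
    push_cast
    field_simp
  have h := (Real.tendsto_one_add_pow_exp_of_tendsto hN).sqrt.inv₀
    (Real.sqrt_pos.2 (Real.exp_pos _)).ne'
  have e : (√(Real.exp (b / t)))⁻¹ = Real.exp (-(b / (2 * t))) := by
    rw [Real.exp_neg, ← Real.exp_half]
    congr 2
    field_simp
  rw [e] at h
  refine h.congr fun m => ?_
  rw [inv_pow]
  congr 1
  have hnn : 0 ≤ 1 + b / (((m + 2 : ℕ) : ℝ) * t) := by positivity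
  rw [Real.sqrt_eq_iff_mul_self_eq (pow_nonneg hnn m) (by positivity), ← mul_pow,
    Real.mul_self_sqrt hnn]

/-- The scaled joint density converges to the bulk density. -/
lemma tendsto_jointDensity (hτ₀ : 0 ≤ τ) (hτ₁ : τ < 1) {z t : ℝ} (hz : |z| < 1 + τ) (ht : 0 < t) :
    Tendsto (fun m : ℕ => ((m + 2 : ℕ) : ℝ) * jointDensity τ m (√((m + 2 : ℕ) : ℝ) * z)
      (((m + 2 : ℕ) : ℝ) * t)) atTop (𝓝 (bulkDensity τ z t)) := by
  have h1 : 0 < 1 - τ ^ 2 := by nlinarith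
  have h2 : 0 < 1 + τ := by linarith
  set ν : ℕ → ℝ := fun m => ((m + 2 : ℕ) : ℝ) with hν
  have hν0 : ∀ m, 0 < ν m := fun m => by simp only [hν]; positivity
  have hy : Tendsto (fun m => (ν m)⁻¹) atTop (𝓝 0) :=
    (tendsto_add_atTop_iff_nat 2).2 (tendsto_inv_atTop_nhds_zero_nat (𝕜 := ℝ))
  set β : ℕ → ℝ := fun m => 1 + ν m * t / (1 - τ ^ 2) * (1 + τ) with hβ
  set b := t / (1 - τ ^ 2) * (1 + τ) with hb
  have hb0 : 0 < b := by positivity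
  have hβ0 : ∀ m, 0 < β m := fun m => by have := hν0 m; simp only [hβ]; positivity
  -- The factor `ν` is extracted from `β`, whose remainder tends to `b`; all scaled parameters
  -- become functions of `1 / ν`.
  have hβν : ∀ m, β m = ν m * ((ν m)⁻¹ + b) := fun m => by
    have := hν0 m
    simp only [hβ, hb]
    field_simp
  have hyb : Tendsto (fun m => (ν m)⁻¹ + b) atTop (𝓝 b) := by simpa using hy.add_const b
  have hyb0 : ∀ m, 0 < (ν m)⁻¹ + b := fun m => by have := hν0 m; positivity
  have hsy : Tendsto (fun m => √((ν m)⁻¹)) atTop (𝓝 0) := by simpa using hy.sqrt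
  have hsqν : ∀ m, √(ν m) = ν m * √((ν m)⁻¹) := fun m => by
    rw [Real.sqrt_inv]
    have h := Real.mul_self_sqrt (hν0 m).le
    have := Real.sqrt_pos.2 (hν0 m)
    field_simp
    linarith
  -- the parameters of the tilt
  have hμ : Tendsto (fun m => √(ν m) * z / β m) atTop (𝓝 0) := by
    have h := (hsy.mul_const z).div hyb hb0.ne'
    rw [zero_mul, zero_div] at h
    refine h.congr fun m => ?_
    have := hν0 m
    have := hyb0 m
    simp only [Pi.div_apply]
    rw [hβν, hsqν]
    field_simp
  have hq : Tendsto (fun m => (1 + τ) / β m) atTop (𝓝 0) := by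
    have h := (hy.const_mul (1 + τ)).div hyb hb0.ne'
    rw [mul_zero, zero_div] at h
    refine h.congr fun m => ?_
    have := hν0 m
    have := hyb0 m
    simp only [Pi.div_apply]
    rw [hβν]
    field_simp
  have ha : Tendsto (fun m : ℕ => (m : ℝ) * (1 / (1 + ν m * t / (1 - τ ^ 2)))) atTop
      (𝓝 ((1 - τ ^ 2) / t)) := by
    have h3 : Tendsto (fun m : ℕ => (m : ℝ) * (ν m)⁻¹) atTop (𝓝 1) := by
      refine (tendsto_natCast_div_add_atTop (2 : ℝ)).congr fun m => ?_
      simp only [hν]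
      push_cast
      rw [div_eq_mul_inv]
    have h := h3.div (hy.add_const (t / (1 - τ ^ 2))) (by positivity)
    have e : (1 : ℝ) / (0 + t / (1 - τ ^ 2)) = (1 - τ ^ 2) / t := by rw [zero_add, one_div_div]
    rw [e] at h
    refine h.congr fun m => ?_
    have := hν0 m
    simp only [Pi.div_apply]
    field_simp
  have hA := tendsto_tiltAverage hτ₀ hτ₁ hz (fun m => div_nonneg h2.le (hβ0 m).le) hμ hq ha
  -- the other factors
  have hroot : Tendsto (fun m => ν m * (√(ν m * t) * √(β m))⁻¹) atTop (𝓝 (√(t * b))⁻¹) := by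
    have h := ((hyb.const_mul t).sqrt).inv₀ (Real.sqrt_pos.2 (by positivity)).ne'
    refine h.congr fun m => ?_
    have hm := hν0 m
    rw [← Real.sqrt_mul (by positivity), hβν]
    have e : ν m * t * (ν m * ((ν m)⁻¹ + b)) = ν m ^ 2 * (t * ((ν m)⁻¹ + b)) := by ring
    have := Real.sqrt_pos.2 (mul_pos ht (hyb0 m))
    rw [e, Real.sqrt_mul (sq_nonneg (ν m)), Real.sqrt_sq hm.le]
    field_simp
  have hexp : Tendsto (fun m => Real.exp ((√(ν m) * z) ^ 2 / (2 * (1 + τ) * β m))) atTop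
      (𝓝 (Real.exp (z ^ 2 / (2 * (1 + τ) * b)))) := by
    refine (Real.continuous_exp.tendsto _).comp ?_
    have h := (tendsto_const_nhds (x := z ^ 2)).div (hyb.const_mul (2 * (1 + τ))) (by positivity)
    refine h.congr fun m => ?_
    have hm := hν0 m
    have := hyb0 m
    simp only [Pi.div_apply]
    rw [mul_pow, Real.sq_sqrt hm.le, hβν]
    field_simp
  have hfin := (((hroot.mul (tendsto_sqrt_one_add_div_pow h1.le ht)).mul hexp).mul hA).mul_const
    (2 * √(2 * Real.pi) * √(1 + τ) * (1 - τ ^ 2))⁻¹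
  have hval : (√(t * b))⁻¹ * Real.exp (-((1 - τ ^ 2) / (2 * t)))
      * Real.exp (z ^ 2 / (2 * (1 + τ) * b))
      * ((1 - τ ^ 2) / t * (1 + τ) * (1 - z ^ 2 / (1 + τ) ^ 2))
      * (2 * √(2 * Real.pi) * √(1 + τ) * (1 - τ ^ 2))⁻¹ = bulkDensity τ z t := by
    have e1 : √(t * b) = t * √(1 + τ) / √(1 - τ ^ 2) := by
      have e : t * b = t ^ 2 * (1 + τ) / (1 - τ ^ 2) := by rw [hb]; ring
      rw [e, Real.sqrt_div (by positivity), Real.sqrt_mul (by positivity), Real.sqrt_sq ht.le]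
    have e2 : Real.exp (-((1 - τ ^ 2) / (2 * t))) * Real.exp (z ^ 2 / (2 * (1 + τ) * b))
        = Real.exp (-((1 - τ ^ 2) / (2 * t)) * (1 - z ^ 2 / (1 + τ) ^ 2)) := by
      rw [← Real.exp_add]
      congr 1
      rw [hb]
      field_simp
      ring
    have p1 := Real.sqrt_pos.2 h1
    have p2 := Real.sqrt_pos.2 h2
    have p3 : 0 < √(2 * Real.pi) := Real.sqrt_pos.2 (by positivity)
    have hs := Real.mul_self_sqrt h2.le
    rw [mul_assoc (√(t * b))⁻¹, e2, e1, bulkDensity]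
    generalize 1 - z ^ 2 / (1 + τ) ^ 2 = c
    generalize Real.exp _ = E
    calc _ = √(1 - τ ^ 2) / (t ^ 2 * (√(1 + τ) * √(1 + τ))) * E * (1 + τ) * c
          / (2 * √(2 * Real.pi)) := by field_simp
      _ = _ := by
        rw [hs]
        field_simp
  rw [hval] at hfin
  refine hfin.congr fun m => ?_
  rw [jointDensity_eq hτ₀ hτ₁ m _ (mul_pos (hν0 m) ht)]
  simp only [hβ]
  ring

/-- The joint density is unique. -/
lemma IsJointDensity.eq {N : ℕ} {p p' : ℝ → ℝ → ℝ} (hp : IsJointDensity τ N p)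
    (hp' : IsJointDensity τ N p') (z : ℝ) {t : ℝ} (ht : 0 < t) : p z t = p' z t := by
  set U : Set (ℝ × ℝ) := Set.univ ×ˢ Set.Ioi 0 with hU
  have hUo : IsOpen U := isOpen_univ.prod isOpen_Ioi
  have hm : ∀ {p : ℝ → ℝ → ℝ}, IsJointDensity τ N p → AEMeasurable
      (fun y : ℝ × ℝ => ENNReal.ofReal (p y.1 y.2)) (volume.restrict U) := fun hp =>
    (hp.continuousOn.aemeasurable hUo.measurableSet).ennreal_ofReal
  -- Testing with indicator functions shows that both densities define the same measure; they agree
  -- almost everywhere, and by continuity everywhere on the open half plane.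
  have hwd : (volume.restrict U).withDensity (fun y : ℝ × ℝ => ENNReal.ofReal (p y.1 y.2))
      = (volume.restrict U).withDensity (fun y : ℝ × ℝ => ENNReal.ofReal (p' y.1 y.2)) := by
    ext s hs
    have key : ∀ {p : ℝ → ℝ → ℝ}, IsJointDensity τ N p →
        (volume.restrict U).withDensity (fun y : ℝ × ℝ => ENNReal.ofReal (p y.1 y.2)) s
        = ∫⁻ X, eigenSum (Matrix.of X) (s.indicator 1) ∂(ensemble τ N) := fun {p} hp => by
      rw [hp.expectation _ (measurable_one.indicator hs), withDensity_apply _ hs,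
        ← lintegral_indicator hs]
      refine lintegral_congr fun y => ?_
      by_cases hy : y ∈ s <;> simp [hy]
    rw [key hp, key hp']
  have hae := (withDensity_eq_iff_of_sigmaFinite (hm hp) (hm hp')).1 hwd
  have hae' : (fun y : ℝ × ℝ => p y.1 y.2) =ᵐ[volume.restrict U] fun y => p' y.1 y.2 := by
    filter_upwards [hae, ae_restrict_mem hUo.measurableSet] with y hy hyU
    exact (ENNReal.ofReal_eq_ofReal_iff (hp.nonneg _ _ hyU.2) (hp'.nonneg _ _ hyU.2)).1 hy
  exact Measure.eqOn_open_of_ae_eq hae' hUo hp.continuousOn hp'.continuousOn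
    (show (z, t) ∈ U from ⟨trivial, ht⟩)

lemma bulkDensity_eq_inverseGammaLaw (hτ₀ : 0 ≤ τ) (hτ₁ : τ < 1) (z : ℝ) {t : ℝ} (ht : 0 < t) :
    bulkDensity τ z t = inverseGammaLaw (1 / √(2 * Real.pi * (1 - τ ^ 2)))
      (√(1 - τ ^ 2) / (2 * √(2 * Real.pi)) * (1 - z ^ 2 / (1 + τ) ^ 2)) t := by
  have h1 : 0 < 1 - τ ^ 2 := by nlinarith
  have hpi : 0 < 2 * Real.pi := by positivity
  have p1 := Real.sqrt_pos.2 h1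
  have p3 := Real.sqrt_pos.2 hpi
  have hs := Real.mul_self_sqrt h1.le
  unfold bulkDensity inverseGammaLaw
  rw [Real.sqrt_mul hpi.le]
  generalize 1 - z ^ 2 / (1 + τ) ^ 2 = c
  have e : √(1 - τ ^ 2) / (2 * √(2 * Real.pi)) * c
      / (t * (1 / (√(2 * Real.pi) * √(1 - τ ^ 2)))) = (1 - τ ^ 2) / (2 * t) * c := by
    calc _ = √(1 - τ ^ 2) * √(1 - τ ^ 2) / (2 * t) * c := by field_simp
      _ = _ := by rw [hs]
  rw [e, neg_mul]
  generalize Real.exp _ = E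
  calc _ = √(1 - τ ^ 2) / (2 * √(2 * Real.pi)) * (c / t ^ 2) * E := rfl
    _ = (√(1 - τ ^ 2) * √(1 - τ ^ 2)) * c * E / (2 * t ^ 2 * √(2 * Real.pi) * √(1 - τ ^ 2)) := by
      field_simp
    _ = _ := by
      rw [hs]
      field_simp

end JointDensity

end EllipticGinibre

end

theorem corollary1 (τ z : ℝ) (hτ₀ : 0 ≤ τ) (hτ₁ : τ < 1) (hz : |z| < 1 + τ) :
    (∀ N : ℕ, 2 ≤ N → ∃ p : ℝ → ℝ → ℝ, EllipticGinibre.IsJointDensity τ N p) ∧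
    (∀ P : ℕ → ℝ → ℝ → ℝ,
      (∀ N : ℕ, 2 ≤ N → EllipticGinibre.IsJointDensity τ N (P N)) →
      ∀ t : ℝ, 0 < t →
        Tendsto (fun N : ℕ => (N : ℝ) * P N (Real.sqrt N * z) (N * t)) atTop
          (𝓝 (EllipticGinibre.bulkDensity τ z t))) ∧
    (∀ t : ℝ, 0 < t →
      EllipticGinibre.bulkDensity τ z t =
        EllipticGinibre.inverseGammaLaw
          (1 / Real.sqrt (2 * Real.pi * (1 - τ ^ 2)))
          (Real.sqrt (1 - τ ^ 2) / (2 * Real.sqrt (2 * Real.pi)) * (1 - z ^ 2 / (1 + τ) ^ 2))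
          t) := by
  refine ⟨fun N hN => ?_, fun P hP t ht => ?_,
    fun t ht => EllipticGinibre.bulkDensity_eq_inverseGammaLaw hτ₀ hτ₁ z ht⟩
  · obtain ⟨m, rfl⟩ : ∃ m, N = m + 2 := ⟨N - 2, by omega⟩
    exact ⟨_, EllipticGinibre.isJointDensity_jointDensity hτ₀ hτ₁ m⟩
  -- The sizes are `N = m + 2`. By uniqueness any continuous density agrees for positive arguments
  -- with the explicit one, whose limit is known.
  · rw [← tendsto_add_atTop_iff_nat 2]
    refine (EllipticGinibre.tendsto_jointDensity hτ₀ hτ₁ hz ht).congr fun m => ?_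
    rw [(hP (m + 2) (by omega)).eq (EllipticGinibre.isJointDensity_jointDensity hτ₀ hτ₁ m) _
      (by positivity)]
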